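/- Let $n\in\{1,2\}$ and $p>1+\frac2n$. Let $k_0=1$ if $n=1$, and $k_0=1+\varepsilon$ with an arbitrary $\varepsilon\in[0,2)$ if $n=2$. Let $f\in C^2(\mathbb R)$ satisfy $|f^{(j)}(z)|\le C|z|^{p-j}$ for all $z\in\mathbb R$, $j=0,1,2$, with some constant $C$ (for instance $f(z)=|z|^p$). Consider the Cauchy problem $$\partial_t^2u-\Delta u+\partial_tu-\Delta\partial_tu=f(u)\quad (t>0,\ x\in\mathbb R^n),\qquad u(0)=u_0,\quad \partial_tu(0)=u_1 .$$ A global solution is a function $u\in C([0,\infty);H^{k_0}(\mathbb R^n))$ such that for all $t\ge0$ $$u(t)=K_0(t)u_0+K_1(t)u_1+\int_0^tK_1(t-\tau)f(u(\tau))\,d\tau ,$$ where $K_0(t)$ and $K_1(t)$ are the Fourier multipliers with symbols $\frac{e^{-t|\xi|^2}-|\xi|^2e^{-t}}{1-|\xi|^2}$ and $\frac{e^{-t|\xi|^2}-e^{-t}}{1-|\xi|^2}$. Let $|\nabla|^k$ be the Fourier multiplier with symbol $|\xi|^k$, let $\|g\|_{H^k}=(\|g\|_2^2+\||\nabla|^kg\|_2^2)^{1/2}$,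 and let $G_t(x)=(4\pi t)^{-n/2}e^{-|x|^2/(4t)}$ be the Gauss kernel. **Theorem 1.2.** There is $\delta>0$, depending on $n$, $p$, $k_0$ and $f$, such that the following holds for all real-valued $u_0\in L^1\cap H^{k_0}$ and $u_1\in L^1\cap L^2$ with $$\|u_0\|_{L^1}+\|u_0\|_{H^{k_0}}+\|u_1\|_{L^1}+\|u_1\|_{L^2}\le\delta .$$ There is at most one global solution, and there is one if $k_0\le2$ or $u_1\in H^{k_0-2}$. The global solution $u$ satisfies $f(u)\in L^1((0,\infty)\times\mathbb R^n)$ and, for every $k\in[0,k_0]$, $$\lim_{t\to\infty}t^{\frac n4+\frac k2}\,\big\||\nabla|^k\big(u(t)-MG_t\big)\big\|_{L^2(\mathbb R^n)}=0,\qquad M=\int_{\mathbb R^n}(u_0+u_1)\,dy+\int_0^\infty\!\!\int_{\mathbb R^n}f(u(s,y))\,dy\,ds .$$ -/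

import Mathlib

open MeasureTheory Filter Topology Set FourierTransform
open scoped ENNReal

noncomputable section

/-- The Euclidean space `ℝⁿ`. -/
abbrev Rn (n : ℕ) : Type := EuclideanSpace ℝ (Fin n)

/-- A real-valued function regarded as a complex-valued one. -/
def toC {n : ℕ} (g : Rn n → ℝ) : Rn n → ℂ := fun x => (g x : ℂ)

theorem memLp_toC {n : ℕ} {g : Rn n → ℝ} (h : MemLp g 2 volume) :
    MemLp (toC g) 2 volume :=
  h.ofReal

/-- The Fourier–Plancherel transform of a square integrable function `g`, normalised with kernel
`exp (-2πi x·ξ)`, so that `∇` corresponds to multiplication by `2πi ξ`. -/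
def l2Fourier {n : ℕ} (g : Rn n → ℝ) (h : MemLp g 2) : Rn n → ℂ :=
  let F : Lp ℂ 2 (volume : Measure (Rn n)) := 𝓕 ((memLp_toC h).toLp (toC g))
  F

open Classical in
/-- `‖ |∇|^k g ‖_{L²}`, as an extended nonnegative real: the operator `|∇|^k` is the Fourier
multiplier `(2π|ξ|)^k`, and its `L²` norm is computed on the Fourier side by Plancherel.
The value is `∞` if `g` is not in `L²` or `|∇|^k g` is not in `L²`. -/
def gradNorm {n : ℕ} (k : ℝ) (g : Rn n → ℝ) : ℝ≥0∞ :=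
  if h : MemLp g 2 then
    eLpNorm (fun ξ : Rn n => (((2 * Real.pi * ‖ξ‖) ^ k : ℝ) : ℂ) * l2Fourier g h ξ) 2 volume
  else ∞

/-- The norm of `H^k(ℝⁿ)`: `(‖g‖₂² + ‖|∇|^k g‖₂²)^{1/2}`. -/
def sobolevNorm {n : ℕ} (k : ℝ) (g : Rn n → ℝ) : ℝ≥0∞ :=
  (eLpNorm g 2 volume ^ 2 + gradNorm k g ^ 2) ^ (1 / 2 : ℝ)

/-- Membership in the Sobolev space `H^k(ℝⁿ)`. -/
def MemSobolevH {n : ℕ} (k : ℝ) (g : Rn n → ℝ) : Prop :=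
  MemLp g 2 ∧ gradNorm k g < ∞

/-- The symbol of the evolution operator `K₀(t)`. Here `r = 2π|ξ|`; the sphere `r = 1`, where the
formula is read as a limit, is a null set and plays no role. -/
def symbolK0 {n : ℕ} (t : ℝ) (ξ : Rn n) : ℝ :=
  let r := 2 * Real.pi * ‖ξ‖
  (Real.exp (-t * r ^ 2) - r ^ 2 * Real.exp (-t)) / (1 - r ^ 2)

/-- The symbol of the evolution operator `K₁(t)`; same conventions as for `symbolK0`. -/
def symbolK1 {n : ℕ} (t : ℝ) (ξ : Rn n) : ℝ :=
  let r := 2 * Real.pi * ‖ξ‖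
  (Real.exp (-t * r ^ 2) - Real.exp (-t)) / (1 - r ^ 2)

/-- The Gauss kernel `G_t(x) = (4πt)^{-n/2} exp(-|x|²/(4t))`. -/
def gaussKernel {n : ℕ} (t : ℝ) (x : Rn n) : ℝ :=
  (Real.sqrt (4 * Real.pi * t) ^ n)⁻¹ * Real.exp (-‖x‖ ^ 2 / (4 * t))

/-- `f` is a `C²` nonlinearity of order `p`, such as `|z|^p` or `± |z|^{p-1} z` with `p > 2`. -/
def IsPowerNonlinearity (p : ℝ) (f : ℝ → ℝ) : Prop :=
  ContDiff ℝ 2 f ∧ ∃ C : ℝ, ∀ z : ℝ,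
    |f z| ≤ C * |z| ^ p ∧ |deriv f z| ≤ C * |z| ^ (p - 1) ∧
      |deriv (deriv f) z| ≤ C * |z| ^ (p - 2)

/-- `u` is a global solution, in the class `C([0,∞); H^{k₀}(ℝⁿ))`, of the Cauchy problem
`∂ₜ²u - Δu + ∂ₜu - Δ∂ₜu = f(u)`, `u(0) = u₀`, `∂ₜu(0) = u₁`, that is, of the integral equation
`u(t) = K₀(t)u₀ + K₁(t)u₁ + ∫₀ᵗ K₁(t-τ) f(u(τ)) dτ` for all `t ≥ 0`, written on the Fourier side.
The functions `u₀`, `u₁` and `f(u(τ))` are integrable, so their transforms are the usual integrals;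
`u(t)` is square integrable, and its transform is that of Plancherel. -/
structure IsGlobalSolution {n : ℕ} (f : ℝ → ℝ) (k₀ : ℝ) (u₀ u₁ : Rn n → ℝ)
    (u : ℝ → Rn n → ℝ) : Prop where
  mem : ∀ t : ℝ, 0 ≤ t → MemSobolevH k₀ (u t)
  continuous : ∀ t : ℝ, 0 ≤ t →
    Tendsto (fun s => sobolevNorm k₀ (fun x => u s x - u t x)) (𝓝[Ici 0] t) (𝓝 0)
  equation : ∀ (t : ℝ) (ht : 0 ≤ t), ∀ᵐ ξ : Rn n,
    l2Fourier (u t) (mem t ht).1 ξ =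
      (symbolK0 t ξ : ℂ) * 𝓕 (toC u₀) ξ + (symbolK1 t ξ : ℂ) * 𝓕 (toC u₁) ξ
        + ∫ τ in (0 : ℝ)..t, (symbolK1 (t - τ) ξ : ℂ) * 𝓕 (toC fun x => f (u τ x)) ξ

end

/-! Write r = 2π|ξ|. Off the sphere r = 1 one has K₀ = e^{-t} + K₁, so with φ = û₀ and ψ = û₀ + û₁
the transform of a solution is e^{-t}φ + K₁(t)ψ + ∫₀ᵗ K₁(t-τ)h(τ) dτ, where h is the transform of
f(u). The whole argument is carried out for this equation on the Fourier side. The symbol K₁(t) is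
at most a heat kernel e^{-(1+t)r²} plus an exponentially decaying term that gains two derivatives
(`symbolK1_le`).

Decay is measured by `energy (1 + t)`, the H¹ norm at the parabolic scale, expected to be of size
(1+t)^{-n/4}. For such functions the Gagliardo-Nirenberg-Sobolev inequality
(`exists_lintegral_rpow_le_homNorm`) bounds f(u) in L¹ by (1+t)^{-α} and in L² by (1+t)^{-α-n/4},
where α = n(p-1)/2. The condition p > 1 + 2/n says precisely that α > 1, so that the Duhamel
integral decays like the linear flow; for n ≤ 2 it also forces p > 2, which the inequality needs.
Small data then give a contraction in the decay norm (`exists_mild_solution`). Uniqueness in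
C([0,∞); H¹) is a Gronwall argument without smallness of the solution (`IsH1Curve.ae_eq_of_mild`),
so every global solution is the constructed one and decays.

Derivatives of order k < 2 of the Duhamel term come from K₁ alone. For 2 ≤ k < 3 one derivative is
placed on f(u). This requires a chain rule for bounded functions
(`IsPowerNonlinearity.exists_homNorm_one_le`) and a sup bound, obtained from 3/2 derivatives of u
(`exists_lintegral_enorm_le`).

For the profile, e^{-tr²} concentrates at r = 0 after parabolic rescaling, so K₁(t-τ)g is
asymptotically e^{-tr²}g(0) (`tendsto_homNorm_symbolK1_mul_sub`). The Duhamel integral is cut at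
t/2: the later half is of lower order because α > 1, and on the earlier half dominated convergence
in τ applies (`tendsto_homNorm_far`). The values at zero frequency add up to ψ(0) + ∫h(τ)(0)dτ = M.
When k₀ > 2 the profile is claimed without assuming u₁ ∈ H^{k₀-2}; that regularity is recovered from
the solution at time 1, because K₁(1) is bounded below by a multiple of 1/(1+r²)
(`le_symbolK1_one`). -/

/-! ### Fourier integrals and the Plancherel transform as a relation between functions. -/

theorem continuous_fourier_of_integrable {n : ℕ} {U : Rn n → ℂ} (hU : Integrable U) :
    Continuous (𝓕 U) :=
  VectorFourier.fourierIntegral_continuous Real.continuous_fourierChar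
    (innerSL ℝ).continuous₂ hU

theorem norm_fourier_le_integral {n : ℕ} (U : Rn n → ℂ) (ξ : Rn n) : ‖𝓕 U ξ‖ ≤ ∫ x, ‖U x‖ :=
  VectorFourier.norm_fourierIntegral_le_integral_norm _ _ _ _ _

theorem continuous_fourierInv_of_integrable {n : ℕ} {U : Rn n → ℂ} (hU : Integrable U) :
    Continuous (𝓕⁻ U) := by
  have : (𝓕⁻ U) = fun x => 𝓕 U (-x) := by ext x; exact Real.fourierInv_eq_fourier_neg U x
  rw [this]
  exact (continuous_fourier_of_integrable hU).comp continuous_neg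

theorem norm_fourierInv_le_integral {n : ℕ} (U : Rn n → ℂ) (ξ : Rn n) :
    ‖𝓕⁻ U ξ‖ ≤ ∫ x, ‖U x‖ := by
  rw [Real.fourierInv_eq_fourier_neg]
  exact norm_fourier_le_integral U _

theorem fourier_sub_of_integrable {n : ℕ} {U W : Rn n → ℂ} (hU : Integrable U)
    (hW : Integrable W) (ξ : Rn n) : 𝓕 (fun x => U x - W x) ξ = 𝓕 U ξ - 𝓕 W ξ := by
  rw [Real.fourier_eq, Real.fourier_eq, Real.fourier_eq, ← integral_sub]
  · simp_rw [smul_sub]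
  · exact (Real.fourierIntegral_convergent_iff ξ).2 hU
  · exact (Real.fourierIntegral_convergent_iff ξ).2 hW

theorem fourier_zero_eq_integral {n : ℕ} (U : Rn n → ℂ) : 𝓕 U 0 = ∫ x, U x := by
  simp [Real.fourier_eq]

/-- The functions `U` and `F` are square integrable and `F` is the Plancherel transform of `U`. -/
def IsL2Fourier {n : ℕ} (U F : Rn n → ℂ) : Prop :=
  ∃ g : Lp ℂ 2 (volume : Measure (Rn n)), U =ᵐ[volume] g ∧
    F =ᵐ[volume] (𝓕 g : Lp ℂ 2 (volume : Measure (Rn n)))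

namespace IsL2Fourier

variable {n : ℕ} {U F W G : Rn n → ℂ}

theorem memLp_left (h : IsL2Fourier U F) : MemLp U 2 := by
  obtain ⟨g, hU, -⟩ := h
  exact (memLp_congr_ae hU).2 (Lp.memLp g)

theorem memLp_right (h : IsL2Fourier U F) : MemLp F 2 := by
  obtain ⟨g, -, hF⟩ := h
  exact (memLp_congr_ae hF).2 (Lp.memLp _)

theorem eLpNorm_eq (h : IsL2Fourier U F) : eLpNorm U 2 volume = eLpNorm F 2 volume := by
  obtain ⟨g, hU, hF⟩ := h
  rw [eLpNorm_congr_ae hU, eLpNorm_congr_ae hF, ← Lp.enorm_def, ← Lp.enorm_def,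
    ← ofReal_norm, ← ofReal_norm, Lp.norm_fourier_eq]

theorem congr (h : IsL2Fourier U F) (hU : W =ᵐ[volume] U) (hF : G =ᵐ[volume] F) :
    IsL2Fourier W G := by
  obtain ⟨g, h1, h2⟩ := h
  exact ⟨g, hU.trans h1, hF.trans h2⟩

theorem sub (h : IsL2Fourier U F) (h' : IsL2Fourier W G) :
    IsL2Fourier (fun x => U x - W x) (fun x => F x - G x) := by
  obtain ⟨g, h1, h2⟩ := h
  obtain ⟨g', h1', h2'⟩ := h'
  refine ⟨g - g', ?_, ?_⟩
  · filter_upwards [h1, h1', Lp.coeFn_sub g g'] with x a b c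
    rw [c, a, b, Pi.sub_apply]
  · have : 𝓕 (g - g') = 𝓕 g - 𝓕 g' := (Lp.fourierTransformₗᵢ (Rn n) ℂ).map_sub g g'
    rw [this]
    filter_upwards [h2, h2', Lp.coeFn_sub (𝓕 g) (𝓕 g')] with x a b c
    rw [c, a, b, Pi.sub_apply]

theorem ae_eq_right (h : IsL2Fourier U F) (h' : IsL2Fourier U G) : F =ᵐ[volume] G := by
  have := h.sub h'
  have h0 : eLpNorm (fun x => F x - G x) 2 volume = 0 := by
    rw [← this.eLpNorm_eq]; simp
  rw [eLpNorm_eq_zero_iff this.memLp_right.1 (by norm_num)] at h0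
  filter_upwards [h0] with x hx
  exact sub_eq_zero.1 hx

theorem ae_eq_left (h : IsL2Fourier U F) (h' : IsL2Fourier W F) : U =ᵐ[volume] W := by
  have := h.sub h'
  have h0 : eLpNorm (fun x => U x - W x) 2 volume = 0 := by
    rw [this.eLpNorm_eq]; simp
  rw [eLpNorm_eq_zero_iff this.memLp_left.1 (by norm_num)] at h0
  filter_upwards [h0] with x hx
  exact sub_eq_zero.1 hx

theorem exists_left (hF : MemLp F 2) : ∃ U, IsL2Fourier U F := by
  refine ⟨(𝓕⁻ (hF.toLp F) : Lp ℂ 2 (volume : Measure (Rn n))), _, EventuallyEq.rfl, ?_⟩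
  rw [FourierInvPair.fourier_fourierInv_eq]
  exact (MemLp.coeFn_toLp hF).symm

theorem exists_right (hF : MemLp U 2) : ∃ F, IsL2Fourier U F :=
  ⟨_, hF.toLp U, (MemLp.coeFn_toLp hF).symm, EventuallyEq.rfl⟩

/-- Read off from the compatibility of the L² transform with the one on tempered distributions.
These pairings are the means of identifying Plancherel transforms with Fourier integrals. -/
theorem integral_smul (h : IsL2Fourier U F) (φ : SchwartzMap (Rn n) ℂ) :
    ∫ ξ, φ ξ • F ξ = ∫ x, (𝓕 (φ : Rn n → ℂ)) x • U x := by
  obtain ⟨g, hU, hF⟩ := h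
  have key := congrArg (fun T => T φ) (Lp.fourier_toTemperedDistribution_eq g)
  simp only [TemperedDistribution.fourier_apply, Lp.toTemperedDistribution_apply] at key
  rw [← SchwartzMap.fourier_coe]
  calc ∫ ξ, φ ξ • F ξ = ∫ ξ, φ ξ • (𝓕 g : Lp ℂ 2 (volume : Measure (Rn n))) ξ :=
        integral_congr_ae (by filter_upwards [hF] with x hx; rw [hx])
    _ = _ := key.symm
    _ = _ := integral_congr_ae (by filter_upwards [hU] with x hx; rw [hx])

theorem integral_smul' (h : IsL2Fourier U F) (φ : SchwartzMap (Rn n) ℂ) :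
    ∫ x, φ x • U x = ∫ ξ, (𝓕⁻ (φ : Rn n → ℂ)) ξ • F ξ := by
  have := h.integral_smul (𝓕⁻ φ)
  rw [← SchwartzMap.fourier_coe, FourierInvPair.fourier_fourierInv_eq,
    SchwartzMap.fourierInv_coe] at this
  exact this.symm

end IsL2Fourier

theorem isL2Fourier_toC {n : ℕ} {g : Rn n → ℝ} (h : MemLp g 2) :
    IsL2Fourier (toC g) (l2Fourier g h) :=
  ⟨(memLp_toC h).toLp (toC g), (MemLp.coeFn_toLp _).symm, EventuallyEq.rfl⟩

/-- Real smooth functions with compact support already separate locally integrable functions.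
Testing only with real φ is what allows `IsL2Fourier.ae_conj_eq` to pull the conjugation out of the
integral. -/
theorem ae_eq_of_forall_schwartz {n : ℕ} {F G : Rn n → ℂ} (hF : LocallyIntegrable F)
    (hG : LocallyIntegrable G)
    (h : ∀ φ : SchwartzMap (Rn n) ℂ, (∀ x, (starRingEnd ℂ) (φ x) = φ x) →
      ∫ x, φ x • F x = ∫ x, φ x • G x) : F =ᵐ[volume] G := by
  refine ae_eq_of_integral_contDiff_smul_eq hF hG fun g hg hc => ?_
  have hg' : ContDiff ℝ (⊤ : ℕ∞) (fun x => (g x : ℂ)) := Complex.ofRealCLM.contDiff.comp hg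
  have hc' : HasCompactSupport (fun x => (g x : ℂ)) :=
    hc.comp_left (g := fun y : ℝ => (y : ℂ)) (by simp)
  have := h (hc'.toSchwartzMap hg') (fun x => by simp)
  simpa using this

/-- The Fourier integral and the Plancherel transform have the same pairings with Schwartz
functions: the transform moves onto φ by Fubini in one case and by distributional duality in the
other. -/
theorem IsL2Fourier.of_integrable {n : ℕ} {U : Rn n → ℂ} (h1 : Integrable U) (h2 : MemLp U 2) :
    IsL2Fourier U (𝓕 U) := by
  obtain ⟨F, hF⟩ := IsL2Fourier.exists_right h2
  refine hF.congr EventuallyEq.rfl ?_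
  refine ae_eq_of_forall_schwartz (continuous_fourier_of_integrable h1).locallyIntegrable
    (hF.memLp_right.locallyIntegrable (by norm_num)) fun φ _ => ?_
  rw [hF.integral_smul φ]
  have := VectorFourier.integral_fourierIntegral_smul_eq_flip (L := innerₗ (Rn n))
    (μ := volume) (ν := volume) (f := φ) (g := U)
    Real.continuous_fourierChar (by exact continuous_inner) φ.integrable h1
  rw [flip_innerₗ] at this
  exact this.symm

theorem IsL2Fourier.of_integrable_right {n : ℕ} {F : Rn n → ℂ} (h1 : Integrable F)
    (h2 : MemLp F 2) : IsL2Fourier (𝓕⁻ F) F := by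
  obtain ⟨U, hU⟩ := IsL2Fourier.exists_left h2
  refine hU.congr ?_ EventuallyEq.rfl
  refine ae_eq_of_forall_schwartz (continuous_fourierInv_of_integrable h1).locallyIntegrable
    (hU.memLp_left.locallyIntegrable (by norm_num)) fun φ _ => ?_
  rw [hU.integral_smul' φ]
  -- The inverse transform is the Fourier integral for the pairing -⟨x, ξ⟩.
  have := VectorFourier.integral_fourierIntegral_smul_eq_flip (L := -innerₗ (Rn n))
    (μ := volume) (ν := volume) (f := φ) (g := F)
    Real.continuous_fourierChar (by exact continuous_inner.neg) φ.integrable h1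
  have hflip : (-innerₗ (Rn n)).flip = -innerₗ (Rn n) := by
    ext x y; simp [real_inner_comm]
  rw [hflip] at this
  exact this.symm

/-- The inverse transform of a Hermitian symmetric function is real. -/
theorem IsL2Fourier.ae_conj_eq {n : ℕ} {U F : Rn n → ℂ} (h : IsL2Fourier U F)
    (hF : ∀ᵐ ξ, F (-ξ) = (starRingEnd ℂ) (F ξ)) :
    (fun x => (starRingEnd ℂ) (U x)) =ᵐ[volume] U := by
  have hU := h.memLp_left
  have hconj : MemLp (fun x => (starRingEnd ℂ) (U x)) 2 := hU.star
  refine ae_eq_of_forall_schwartz (hconj.locallyIntegrable (by norm_num))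
    (hU.locallyIntegrable (by norm_num)) fun φ hφ => ?_
  have e1 : ∫ x, φ x • (starRingEnd ℂ) (U x) = (starRingEnd ℂ) (∫ x, φ x • U x) := by
    rw [← integral_conj]
    refine integral_congr_ae (Eventually.of_forall fun x => ?_)
    simp [hφ x]
  -- After ξ ↦ -ξ the symmetry of F cancels the conjugation; the inverse transform of φ has the same
  -- symmetry because φ is real.
  rw [e1, h.integral_smul' φ, ← integral_conj, ← integral_neg_eq_self]
  refine integral_congr_ae ?_
  filter_upwards [hF] with ξ hξ
  have e2 : (starRingEnd ℂ) ((𝓕⁻ (φ : Rn n → ℂ)) (-ξ)) = (𝓕⁻ (φ : Rn n → ℂ)) ξ := by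
    rw [Real.fourierInv_eq', Real.fourierInv_eq', ← integral_conj]
    refine integral_congr_ae (Eventually.of_forall fun x => ?_)
    simp [← Complex.exp_conj, hφ x, map_ofNat]
  rw [hξ]
  simp [e2]


/-! ### Homogeneous Sobolev norms and the Gagliardo-Nirenberg-Sobolev inequality. -/

/-- The frequency variable `2π|ξ|`. -/
noncomputable abbrev rad {n : ℕ} (ξ : Rn n) : ℝ := 2 * Real.pi * ‖ξ‖

/-- The norm `‖ |2πξ|^k F ‖_{L²}` on the Fourier side. -/
noncomputable def homNorm {n : ℕ} (k : ℝ) (F : Rn n → ℂ) : ℝ≥0∞ :=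
  eLpNorm (fun ξ => ((rad ξ ^ k : ℝ) : ℂ) * F ξ) 2 volume

theorem rad_nonneg {n : ℕ} (ξ : Rn n) : 0 ≤ rad ξ := by positivity

theorem eLpNorm_two_sq {α ε : Type*} [MeasurableSpace α] {μ : Measure α} [TopologicalSpace ε]
    [ContinuousENorm ε] (F : α → ε) : eLpNorm F 2 μ ^ 2 = ∫⁻ x, ‖F x‖ₑ ^ 2 ∂μ := by
  have := eLpNorm_nnreal_pow_eq_lintegral (μ := μ) (f := F) (p := 2) (by norm_num)
  simpa using this

theorem measurable_rad_rpow {n : ℕ} (k : ℝ) : Measurable (fun ξ : Rn n => rad ξ ^ k) := by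
  fun_prop

theorem ae_ne_zero {n : ℕ} (hn : 0 < n) : ∀ᵐ ξ : Rn n, ξ ≠ 0 := by
  have : Nonempty (Fin n) := ⟨⟨0, hn⟩⟩
  exact Measure.ae_ne volume 0

/-- In polar coordinates the radial integrand is a multiple of y^{n-1-2s}, integrable at the origin
because 2s < n. -/
theorem lintegral_ball_rad_rpow {n : ℕ} (hn : 0 < n) {s : ℝ} (hs : s < n / 2) :
    ∃ c : ℝ, 0 < c ∧ ∀ R : ℝ, 0 < R →
      ∫⁻ ξ in Metric.ball (0 : Rn n) R, ENNReal.ofReal (rad ξ ^ (-(2 * s)))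
        ≤ ENNReal.ofReal (c * R ^ ((n : ℝ) - 2 * s)) := by
  have : Nonempty (Fin n) := ⟨⟨0, hn⟩⟩
  have hpos : 0 < (n : ℝ) - 2 * s := by linarith
  have hfin : Module.finrank ℝ (Rn n) = n := by simp
  -- The `+ 1` only makes the constant evidently positive.
  refine ⟨n * (volume.real (Metric.ball (0 : Rn n) 1) + 1) *
    ((2 * Real.pi) ^ (-(2 * s)) / (n - 2 * s)), by positivity, fun R hR => ?_⟩
  have key : ∀ y ∈ Ioo (0 : ℝ) R, y ^ (n - 1) • ((2 * Real.pi * y) ^ (-(2 * s))) =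
      (2 * Real.pi) ^ (-(2 * s)) * y ^ ((n : ℝ) - 2 * s - 1) := by
    intro y hy
    have hy0 : 0 < y := hy.1
    rw [smul_eq_mul, Real.mul_rpow (by positivity) hy0.le, mul_left_comm, ← Real.rpow_natCast,
      ← Real.rpow_add hy0, Nat.cast_sub hn]
    congr 2
    push_cast
    ring
  have hint : IntegrableOn (fun y : ℝ => y ^ ((n : ℝ) - 2 * s - 1)) (Ioo 0 R) := by
    have := (intervalIntegral.intervalIntegrable_rpow' (a := 0) (b := R)
      (show -1 < (n : ℝ) - 2 * s - 1 by linarith)).1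
    exact this.mono_set Ioo_subset_Ioc_self
  have hint1 : IntegrableOn (fun y : ℝ => y ^ (n - 1) • ((2 * Real.pi * y) ^ (-(2 * s))))
      (Ioo 0 R) :=
    (integrableOn_congr_fun key measurableSet_Ioo).2 (hint.const_mul _)
  have hint2 : IntegrableOn (fun ξ : Rn n => (2 * Real.pi * ‖ξ‖) ^ (-(2 * s)))
      (Metric.ball 0 R) := by
    rw [integrableOn_fun_norm_addHaar volume (f := fun y => (2 * Real.pi * y) ^ (-(2 * s))), hfin]
    exact hint1
  rw [← ofReal_integral_eq_lintegral_ofReal hint2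
    (Eventually.of_forall fun ξ => by positivity)]
  apply ENNReal.ofReal_le_ofReal
  have e1 : ∫ ξ in Metric.ball (0 : Rn n) R, (2 * Real.pi * ‖ξ‖) ^ (-(2 * s)) =
      n * (volume.real (Metric.ball (0 : Rn n) 1) *
        ∫ y in Ioo (0 : ℝ) R, (2 * Real.pi) ^ (-(2 * s)) * y ^ ((n : ℝ) - 2 * s - 1)) := by
    rw [← integral_indicator measurableSet_ball]
    have e2 : (fun ξ : Rn n => (Metric.ball (0 : Rn n) R).indicator
        (fun ξ => (2 * Real.pi * ‖ξ‖) ^ (-(2 * s))) ξ) =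
        fun ξ => (Iio R).indicator (fun y => (2 * Real.pi * y) ^ (-(2 * s))) ‖ξ‖ := by
      ext ξ
      simp [indicator]
    rw [e2, integral_fun_norm_addHaar volume, hfin, nsmul_eq_mul, smul_eq_mul,
      ← setIntegral_congr_fun measurableSet_Ioo key]
    congr 2
    rw [← integral_indicator measurableSet_Ioi, ← integral_indicator measurableSet_Ioo]
    congr 1
    ext y
    by_cases h0 : 0 < y <;> by_cases h1 : y < R <;> simp [indicator, h0, h1]
  rw [e1, integral_const_mul, ← integral_Ioc_eq_integral_Ioo,
    ← intervalIntegral.integral_of_le hR.le, integral_rpow (Or.inl (by linarith))]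
  rw [sub_add_cancel, Real.zero_rpow hpos.ne', sub_zero]
  have hv : 0 ≤ volume.real (Metric.ball (0 : Rn n) 1) := measureReal_nonneg
  have hX : 0 ≤ (2 * Real.pi) ^ (-(2 * s)) * (R ^ ((n : ℝ) - 2 * s) / (n - 2 * s)) := by
    positivity
  have : (n : ℝ) * (volume.real (Metric.ball (0 : Rn n) 1) *
      ((2 * Real.pi) ^ (-(2 * s)) * (R ^ ((n : ℝ) - 2 * s) / (n - 2 * s)))) ≤
      n * ((volume.real (Metric.ball (0 : Rn n) 1) + 1) *
      ((2 * Real.pi) ^ (-(2 * s)) * (R ^ ((n : ℝ) - 2 * s) / (n - 2 * s)))) := by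
    gcongr
    linarith
  refine this.trans (le_of_eq ?_)
  ring

theorem enorm_rad_rpow_mul {n : ℕ} (k : ℝ) (ξ : Rn n) (z : ℂ) :
    ‖((rad ξ ^ k : ℝ) : ℂ) * z‖ₑ = ENNReal.ofReal (rad ξ ^ k) * ‖z‖ₑ := by
  rw [enorm_mul, ← ofReal_norm, Complex.norm_real, Real.norm_of_nonneg (by positivity)]

theorem homNorm_sq {n : ℕ} (k : ℝ) (F : Rn n → ℂ) :
    homNorm k F ^ 2 = ∫⁻ ξ, ENNReal.ofReal (rad ξ ^ (2 * k)) * ‖F ξ‖ₑ ^ 2 := by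
  rw [homNorm, eLpNorm_two_sq]
  congr 1
  ext ξ
  rw [enorm_rad_rpow_mul, mul_pow, ← ENNReal.ofReal_pow (by positivity), ← Real.rpow_natCast,
    ← Real.rpow_mul (by positivity)]
  congr 3
  push_cast
  ring

theorem lintegral_mul_sq_le {α : Type*} [MeasurableSpace α] {μ : Measure α} {f g : α → ℝ≥0∞}
    (hf : AEMeasurable f μ) (hg : AEMeasurable g μ) :
    (∫⁻ x, f x * g x ∂μ) ^ 2 ≤ (∫⁻ x, f x ^ 2 ∂μ) * ∫⁻ x, g x ^ 2 ∂μ := by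
  have := ENNReal.lintegral_mul_le_Lp_mul_Lq μ Real.HolderConjugate.two_two hf hg
  calc (∫⁻ x, f x * g x ∂μ) ^ 2 ≤ ((∫⁻ a, f a ^ (2 : ℝ) ∂μ) ^ (1 / 2 : ℝ) *
        (∫⁻ a, g a ^ (2 : ℝ) ∂μ) ^ (1 / 2 : ℝ)) ^ 2 := by gcongr; exact this
    _ = _ := by
      rw [mul_pow, ← ENNReal.rpow_natCast, ← ENNReal.rpow_mul, ← ENNReal.rpow_natCast,
        ← ENNReal.rpow_mul]
      norm_num

/-- Low frequencies are controlled in `L¹` by a homogeneous Sobolev norm. -/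
theorem lintegral_ball_enorm_sq_le {n : ℕ} (hn : 0 < n) {s : ℝ} (hs : s < n / 2) :
    ∃ c : ℝ, 0 < c ∧ ∀ R : ℝ, 0 < R → ∀ F : Rn n → ℂ, AEStronglyMeasurable F volume →
      (∫⁻ ξ in Metric.ball (0 : Rn n) R, ‖F ξ‖ₑ) ^ 2
        ≤ ENNReal.ofReal (c * R ^ ((n : ℝ) - 2 * s)) * homNorm s F ^ 2 := by
  obtain ⟨c, hc, h⟩ := lintegral_ball_rad_rpow hn hs
  refine ⟨c, hc, fun R hR F hF => ?_⟩
  -- The factor 1 = r^{-s} r^s, valid off the origin, prepares Cauchy-Schwarz.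
  have e : ∫⁻ ξ in Metric.ball (0 : Rn n) R, ‖F ξ‖ₑ =
      ∫⁻ ξ in Metric.ball (0 : Rn n) R,
        ENNReal.ofReal (rad ξ ^ (-s)) * (ENNReal.ofReal (rad ξ ^ s) * ‖F ξ‖ₑ) := by
    refine lintegral_congr_ae (ae_restrict_of_ae ?_)
    filter_upwards [ae_ne_zero hn] with ξ hξ
    have : 0 < rad ξ := by have := norm_pos_iff.2 hξ; positivity
    rw [← mul_assoc, ← ENNReal.ofReal_mul (by positivity), ← Real.rpow_add this]
    simp
  rw [e]
  refine (lintegral_mul_sq_le (by fun_prop) ?_).trans ?_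
  · exact (Measurable.aemeasurable (by fun_prop)).mul hF.restrict.enorm
  refine mul_le_mul' ?_ ?_
  · refine le_trans (le_of_eq ?_) (h R hR)
    congr 1
    ext ξ
    rw [← ENNReal.ofReal_pow (by positivity), ← Real.rpow_natCast, ← Real.rpow_mul (by positivity)]
    congr 2
    push_cast
    ring
  · rw [homNorm, eLpNorm_two_sq]
    simp_rw [enorm_rad_rpow_mul]
    exact setLIntegral_le_lintegral _ _

/-- The part of U with frequencies in the ball is bounded by the L¹ norm of its transform, hence by
lam/2. Where |U| > lam, the remaining part is therefore at least lam/2, and Chebyshev together with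
Plancherel bounds the measure of that set. -/
theorem IsL2Fourier.measure_lt_le {n : ℕ} {U F : Rn n → ℂ} (h : IsL2Fourier U F) {R lam : ℝ}
    (hlam : 0 < lam)
    (hlow : ∫⁻ ξ in Metric.ball (0 : Rn n) R, ‖F ξ‖ₑ ≤ ENNReal.ofReal (lam / 2)) :
    volume {x | lam < ‖U x‖} ≤
      ENNReal.ofReal (4 / lam ^ 2) * ∫⁻ ξ in (Metric.ball (0 : Rn n) R)ᶜ, ‖F ξ‖ₑ ^ 2 := by
  set Fl : Rn n → ℂ := (Metric.ball (0 : Rn n) R).indicator F with hFl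
  have hFl2 : MemLp Fl 2 := h.memLp_right.indicator measurableSet_ball
  have hFl1 : Integrable Fl := by
    refine ⟨hFl2.1, ?_⟩
    have : ∫⁻ ξ, ‖Fl ξ‖ₑ = ∫⁻ ξ in Metric.ball (0 : Rn n) R, ‖F ξ‖ₑ := by
      rw [← lintegral_indicator measurableSet_ball]
      congr 1
      ext ξ
      rw [hFl, enorm_indicator_eq_indicator_enorm]
    rw [HasFiniteIntegral, this]
    exact hlow.trans_lt ENNReal.ofReal_lt_top
  obtain ⟨v, hl, hbound⟩ : ∃ v, IsL2Fourier v Fl ∧ ∀ x, ‖v x‖ ≤ lam / 2 := by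
    refine ⟨_, IsL2Fourier.of_integrable_right hFl1 hFl2, fun x => ?_⟩
    refine (norm_fourierInv_le_integral _ _).trans ?_
    rw [integral_norm_eq_lintegral_enorm hFl2.1]
    refine ENNReal.toReal_le_of_le_ofReal (by positivity) (le_trans (le_of_eq ?_) hlow)
    rw [← lintegral_indicator measurableSet_ball]
    congr 1
    ext ξ
    rw [hFl, enorm_indicator_eq_indicator_enorm]
  have hh := h.sub hl
  have hsub : {x | lam < ‖U x‖} ⊆
      {x | ENNReal.ofReal (lam ^ 2 / 4) ≤ ‖U x - v x‖ₑ ^ 2} := by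
    intro x hx
    have h1 : lam < ‖U x‖ := hx
    have h2 : ‖U x‖ ≤ ‖U x - v x‖ + ‖v x‖ := norm_le_norm_sub_add _ _
    have h3 := hbound x
    have h4 : lam / 2 ≤ ‖U x - v x‖ := by linarith
    rw [mem_ofPred_eq, ← ofReal_norm, ← ENNReal.ofReal_pow (norm_nonneg _)]
    apply ENNReal.ofReal_le_ofReal
    nlinarith
  have hch := meas_ge_le_lintegral_div (μ := volume)
    (f := fun x => ‖U x - v x‖ₑ ^ 2) (hh.memLp_left.1.enorm.pow_const 2)
    (ε := ENNReal.ofReal (lam ^ 2 / 4)) (by simp; positivity) ENNReal.ofReal_ne_top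
  refine (measure_mono hsub).trans (hch.trans (le_of_eq ?_))
  rw [← eLpNorm_two_sq, hh.eLpNorm_eq, eLpNorm_two_sq, mul_comm, ENNReal.div_eq_inv_mul, mul_comm,
    ← ENNReal.ofReal_inv_of_pos (by positivity), inv_div,
    ← lintegral_indicator measurableSet_ball.compl]
  congr 2
  ext ξ
  by_cases hξ : ξ ∈ Metric.ball (0 : Rn n) R
  · rw [hFl, indicator_of_mem hξ, indicator_of_notMem (by simpa using hξ)]
    simp
  · rw [hFl, indicator_of_notMem hξ, indicator_of_mem hξ]
    simp

theorem lintegral_Ioc_rpow {a b : ℝ} (ha : -1 < a) (hb : 0 ≤ b) :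
    ∫⁻ t in Ioc 0 b, ENNReal.ofReal (t ^ a) = ENNReal.ofReal (b ^ (a + 1) / (a + 1)) := by
  have hi : IntegrableOn (fun t : ℝ => t ^ a) (Ioc 0 b) :=
    (intervalIntegral.intervalIntegrable_rpow' (a := 0) (b := b) ha).1
  rw [← ofReal_integral_eq_lintegral_ofReal hi, ← intervalIntegral.integral_of_le hb,
    integral_rpow (Or.inl ha), Real.zero_rpow (by linarith), sub_zero]
  filter_upwards [ae_restrict_mem measurableSet_Ioc] with t ht
  exact Real.rpow_nonneg ht.1.le _

/-- The Gagliardo-Nirenberg-Sobolev inequality `‖U‖_q ≤ C ‖ |∇|^s U ‖_2`, `s = n(1/2 - 1/q)`,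
proved by splitting each level set at its own frequency. -/
theorem exists_lintegral_rpow_le_homNorm {n : ℕ} (hn : 0 < n) {q s : ℝ} (hq : 2 < q)
    (hs : s = n * (1 / 2 - 1 / q)) : ∃ C : ℝ, 0 < C ∧ ∀ U F : Rn n → ℂ, IsL2Fourier U F →
      ∀ A : ℝ, 0 < A → homNorm s F ≤ ENNReal.ofReal A →
        ∫⁻ x, ENNReal.ofReal (‖U x‖ ^ q) ≤ ENNReal.ofReal (C * A ^ q) := by
  have hn' : (0 : ℝ) < n := by exact_mod_cast hn
  have hq0 : 0 < q := by linarith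
  have hs2 : (n : ℝ) - 2 * s = 2 * (n / q) := by rw [hs]; field_simp; ring
  have hnq : 0 < n / q := by positivity
  obtain ⟨c, hc, hlow⟩ := lintegral_ball_enorm_sq_le hn (s := s) (by linarith)
  -- Since n - 2s = 2n/q, the radius with R^{n/q} = t/(dA) satisfies c R^{n-2s} A² = t²/4 for this
  -- d, which is the low-frequency condition at level t.
  set d : ℝ := 2 * Real.sqrt c with hd
  have hd0 : 0 < d := by positivity
  refine ⟨q * 4 / (q - 2) * (d / (2 * Real.pi) ^ ((n : ℝ) / q)) ^ (q - 2),
    by have : 0 < q - 2 := by linarith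
       positivity, fun U F h A hA hAF => ?_⟩
  have hFm : AEMeasurable (fun ξ => ‖F ξ‖ₑ ^ 2) := h.memLp_right.1.enorm.pow_const 2
  rw [lintegral_rpow_eq_lintegral_meas_lt_mul volume (Eventually.of_forall fun x => norm_nonneg _)
    h.memLp_left.1.norm.aemeasurable hq0]
  -- the threshold radius
  have hmeas : ∀ t ∈ Ioi (0 : ℝ), volume {x | t < ‖U x‖} * ENNReal.ofReal (t ^ (q - 1)) ≤
      ∫⁻ ξ, (Ici t).indicator (fun _ => ENNReal.ofReal (4 * t ^ (q - 3)) * ‖F ξ‖ₑ ^ 2)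
        (d * A * ‖ξ‖ ^ ((n : ℝ) / q)) := by
    intro t ht
    have ht0 : 0 < t := ht
    set R : ℝ := (t / (d * A)) ^ ((n : ℝ) / q)⁻¹ with hR
    have hR0 : 0 < R := by positivity
    have hRq : R ^ ((n : ℝ) / q) = t / (d * A) := by
      rw [hR, ← Real.rpow_mul (by positivity), inv_mul_cancel₀ hnq.ne', Real.rpow_one]
    have h1 : ∫⁻ ξ in Metric.ball (0 : Rn n) R, ‖F ξ‖ₑ ≤ ENNReal.ofReal (t / 2) := by
      have h2 := hlow R hR0 F h.memLp_right.1
      have h3 : ENNReal.ofReal (c * R ^ ((n : ℝ) - 2 * s)) * homNorm s F ^ 2 ≤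
          ENNReal.ofReal (t / 2) ^ 2 := by
        calc _ ≤ ENNReal.ofReal (c * R ^ ((n : ℝ) - 2 * s)) * ENNReal.ofReal A ^ 2 := by gcongr
          _ = _ := by
            rw [← ENNReal.ofReal_pow hA.le, ← ENNReal.ofReal_mul (by positivity),
              ← ENNReal.ofReal_pow (by positivity), hs2, mul_comm 2, Real.rpow_mul hR0.le, hRq]
            congr 1
            have : Real.sqrt c ^ 2 = c := Real.sq_sqrt hc.le
            rw [hd]
            simp only [Real.rpow_two]
            field_simp
            rw [this]
      by_contra hcon
      exact absurd (h2.trans h3) (not_le.2 (ENNReal.pow_lt_pow_left two_ne_zero (not_le.1 hcon)))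
    have h4 := h.measure_lt_le ht0 h1
    calc _ ≤ (ENNReal.ofReal (4 / t ^ 2) * ∫⁻ ξ in (Metric.ball (0 : Rn n) R)ᶜ, ‖F ξ‖ₑ ^ 2) *
          ENNReal.ofReal (t ^ (q - 1)) := by gcongr
      _ = ∫⁻ ξ in (Metric.ball (0 : Rn n) R)ᶜ, ENNReal.ofReal (4 * t ^ (q - 3)) * ‖F ξ‖ₑ ^ 2 := by
          rw [lintegral_const_mul' _ _ ENNReal.ofReal_ne_top, mul_right_comm,
            ← ENNReal.ofReal_mul (by positivity)]
          congr 2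
          rw [show q - 1 = (q - 3) + 2 by ring, Real.rpow_add ht0, Real.rpow_two]
          field_simp
      _ ≤ _ := by
          rw [← lintegral_indicator measurableSet_ball.compl]
          refine lintegral_mono fun ξ => ?_
          by_cases hξ : ξ ∈ Metric.ball (0 : Rn n) R
          · rw [indicator_of_notMem (by simpa using hξ)]; exact zero_le
          · have : t ≤ d * A * ‖ξ‖ ^ ((n : ℝ) / q) := by
              have hξ' : R ≤ ‖ξ‖ := by simpa using hξ
              have : t / (d * A) ≤ ‖ξ‖ ^ ((n : ℝ) / q) := by rw [← hRq]; gcongr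
              rwa [div_le_iff₀ (by positivity), mul_comm] at this
            rw [indicator_of_mem hξ, indicator_of_mem (by exact this)]
  -- After Tonelli, the frequency ξ is counted for the levels t ≤ dA|ξ|^{n/q}. Integrating 4t^{q-3}
  -- up to there gives the power (q-2)n/q = 2s of |ξ|.
  have hint : ∀ ξ : Rn n, ∫⁻ t in Ioi (0 : ℝ),
      (Ici t).indicator (fun _ => ENNReal.ofReal (4 * t ^ (q - 3)) * ‖F ξ‖ₑ ^ 2)
        (d * A * ‖ξ‖ ^ ((n : ℝ) / q)) =
      ENNReal.ofReal (4 / (q - 2) * (d / (2 * Real.pi) ^ ((n : ℝ) / q)) ^ (q - 2) * A ^ (q - 2)) *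
        (ENNReal.ofReal (rad ξ ^ (2 * s)) * ‖F ξ‖ₑ ^ 2) := by
    intro ξ
    set b := d * A * ‖ξ‖ ^ ((n : ℝ) / q) with hb
    have hb0 : 0 ≤ b := by positivity
    have e1 : ∀ t ∈ Ioi (0 : ℝ), (Ici t).indicator
        (fun _ => ENNReal.ofReal (4 * t ^ (q - 3)) * ‖F ξ‖ₑ ^ 2) b =
        (Iic b).indicator (fun t => ENNReal.ofReal (t ^ (q - 3)) *
          (ENNReal.ofReal 4 * ‖F ξ‖ₑ ^ 2)) t := by
      intro t ht
      rw [ENNReal.ofReal_mul (by norm_num), mul_comm (ENNReal.ofReal 4), mul_assoc]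
      by_cases htb : t ≤ b <;> simp [indicator, htb]
    rw [setLIntegral_congr_fun measurableSet_Ioi e1, lintegral_indicator measurableSet_Iic,
      Measure.restrict_restrict measurableSet_Iic, inter_comm, Ioi_inter_Iic,
      lintegral_mul_const' _ _ (by finiteness), lintegral_Ioc_rpow (by linarith) hb0,
      ← mul_assoc, ← mul_assoc, ← ENNReal.ofReal_mul (by
        have : 0 ≤ q - 3 + 1 := by linarith
        positivity), ← ENNReal.ofReal_mul (by
        have : 0 ≤ q - 2 := by linarith
        positivity)]
    congr 2
    have e2 : 2 * s = n / q * (q - 2) := by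
      have : 2 * s = n - 2 * (n / q) := by linarith
      rw [this]; field_simp
    have hnn : b ^ (q - 2) = (d / (2 * Real.pi) ^ ((n : ℝ) / q)) ^ (q - 2) * A ^ (q - 2) *
        rad ξ ^ (2 * s) := by
      rw [e2, Real.rpow_mul (by positivity), ← Real.mul_rpow (by positivity) (by positivity),
        ← Real.mul_rpow (by positivity) (by positivity), hb, rad,
        Real.mul_rpow (y := ‖ξ‖) (by positivity) (by positivity)]
      congr 1
      field_simp
    rw [show q - 3 + 1 = q - 2 by ring, hnn]
    ring
  have hswap : ∫⁻ t in Ioi (0 : ℝ), ∫⁻ ξ, (Ici t).indicator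
      (fun _ => ENNReal.ofReal (4 * t ^ (q - 3)) * ‖F ξ‖ₑ ^ 2) (d * A * ‖ξ‖ ^ ((n : ℝ) / q)) =
      ∫⁻ ξ, ∫⁻ t in Ioi (0 : ℝ), (Ici t).indicator
      (fun _ => ENNReal.ofReal (4 * t ^ (q - 3)) * ‖F ξ‖ₑ ^ 2) (d * A * ‖ξ‖ ^ ((n : ℝ) / q)) := by
    rw [lintegral_lintegral_swap]
    have e3 : (Function.uncurry fun (t : ℝ) (ξ : Rn n) => (Ici t).indicator
        (fun _ => ENNReal.ofReal (4 * t ^ (q - 3)) * ‖F ξ‖ₑ ^ 2) (d * A * ‖ξ‖ ^ ((n : ℝ) / q))) =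
        {z : ℝ × Rn n | z.1 ≤ d * A * ‖z.2‖ ^ ((n : ℝ) / q)}.indicator
          (fun z => ENNReal.ofReal (4 * z.1 ^ (q - 3)) * ‖F z.2‖ₑ ^ 2) := by
      ext ⟨t, ξ⟩
      simp [indicator]
    rw [e3]
    have hS : MeasurableSet {z : ℝ × Rn n | z.1 ≤ d * A * ‖z.2‖ ^ ((n : ℝ) / q)} :=
      measurableSet_le measurable_fst (by fun_prop)
    refine AEMeasurable.indicator ?_ hS
    have hm : Measurable fun z : ℝ × Rn n => ENNReal.ofReal (4 * z.1 ^ (q - 3)) := by fun_prop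
    refine hm.aemeasurable.mul ?_
    exact hFm.comp_quasiMeasurePreserving Measure.quasiMeasurePreserving_snd
  calc _ ≤ ENNReal.ofReal q * ∫⁻ t in Ioi (0 : ℝ), ∫⁻ ξ, (Ici t).indicator
          (fun _ => ENNReal.ofReal (4 * t ^ (q - 3)) * ‖F ξ‖ₑ ^ 2)
        (d * A * ‖ξ‖ ^ ((n : ℝ) / q)) := by
        gcongr ENNReal.ofReal q * ?_
        exact setLIntegral_mono' measurableSet_Ioi hmeas
    _ ≤ ENNReal.ofReal q * (ENNReal.ofReal (4 / (q - 2) *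
        (d / (2 * Real.pi) ^ ((n : ℝ) / q)) ^ (q - 2) * A ^ (q - 2)) * ENNReal.ofReal A ^ 2) := by
        rw [hswap]
        simp_rw [hint]
        rw [lintegral_const_mul' _ _ ENNReal.ofReal_ne_top, ← homNorm_sq]
        gcongr
    _ = _ := by
        have hq2 : 0 < q - 2 := by linarith
        rw [← ENNReal.ofReal_pow hA.le, ← ENNReal.ofReal_mul (by positivity),
          ← ENNReal.ofReal_mul hq0.le]
        congr 1
        rw [show A ^ q = A ^ (q - 2) * A ^ 2 by
          rw [← Real.rpow_two, ← Real.rpow_add hA]; congr 1; ring]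
        ring


/-! ### Weighted norms on the Fourier side and the scaled energy. -/

/-- The weighted norm `‖w F‖_{L²}` on the Fourier side. -/
noncomputable def wNorm {n : ℕ} (w : Rn n → ℝ) (F : Rn n → ℂ) : ℝ≥0∞ :=
  eLpNorm (fun ξ => (w ξ : ℂ) * F ξ) 2 volume

/-- The `H¹` norm with the frequency scale `T^{-1/2}`. -/
noncomputable abbrev energy {n : ℕ} (T : ℝ) (F : Rn n → ℂ) : ℝ≥0∞ :=
  wNorm (fun ξ => 1 + Real.sqrt T * rad ξ) F

theorem homNorm_eq_wNorm {n : ℕ} (k : ℝ) (F : Rn n → ℂ) :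
    homNorm k F = wNorm (fun ξ => rad ξ ^ k) F := rfl

theorem wNorm_le_of_ae {n : ℕ} {w w' : Rn n → ℝ} {F G : Rn n → ℂ} {c : ℝ}
    (h : ∀ᵐ ξ, |w ξ| * ‖F ξ‖ ≤ c * (|w' ξ| * ‖G ξ‖)) :
    wNorm w F ≤ ENNReal.ofReal c * wNorm w' G := by
  have := eLpNorm_le_mul_eLpNorm_of_ae_le_mul (μ := (volume : Measure (Rn n))) (c := c)
    (f := fun ξ => (w ξ : ℂ) * F ξ) (g := fun ξ => (w' ξ : ℂ) * G ξ)
    (by filter_upwards [h] with ξ hξ; simpa using hξ) 2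
  exact this

theorem wNorm_mono {n : ℕ} {w w' : Rn n → ℝ} (F : Rn n → ℂ) {c : ℝ}
    (h : ∀ ξ, |w ξ| ≤ c * |w' ξ|) : wNorm w F ≤ ENNReal.ofReal c * wNorm w' F := by
  refine wNorm_le_of_ae (Eventually.of_forall fun ξ => ?_)
  rw [← mul_assoc]
  exact mul_le_mul_of_nonneg_right (h ξ) (norm_nonneg _)

theorem wNorm_congr {n : ℕ} {w : Rn n → ℝ} {F G : Rn n → ℂ} (h : F =ᵐ[volume] G) :
    wNorm w F = wNorm w G :=
  eLpNorm_congr_ae (by filter_upwards [h] with ξ hξ; rw [hξ])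

theorem wNorm_one {n : ℕ} (F : Rn n → ℂ) : wNorm (fun _ => 1) F = eLpNorm F 2 volume := by
  simp [wNorm]

theorem wNorm_add_le {n : ℕ} {w : Rn n → ℝ} (hw : Measurable w) {F G : Rn n → ℂ}
    (hF : AEStronglyMeasurable F volume) (hG : AEStronglyMeasurable G volume) :
    wNorm w (fun ξ => F ξ + G ξ) ≤ wNorm w F + wNorm w G := by
  have hw' : AEStronglyMeasurable (fun ξ => (w ξ : ℂ)) volume :=
    (Complex.measurable_ofReal.comp hw).aestronglyMeasurable
  have := eLpNorm_add_le (hw'.mul hF) (hw'.mul hG) (p := 2) (by norm_num)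
  refine le_trans (le_of_eq ?_) this
  unfold wNorm
  congr 1
  ext ξ
  simp [mul_add]

theorem wNorm_neg {n : ℕ} (w : Rn n → ℝ) (F : Rn n → ℂ) :
    wNorm w (fun ξ => -F ξ) = wNorm w F := by
  unfold wNorm
  rw [← eLpNorm_neg]
  congr 1
  ext ξ
  simp

theorem wNorm_sub_le {n : ℕ} {w : Rn n → ℝ} (hw : Measurable w) {F G : Rn n → ℂ}
    (hF : AEStronglyMeasurable F volume) (hG : AEStronglyMeasurable G volume) :
    wNorm w (fun ξ => F ξ - G ξ) ≤ wNorm w F + wNorm w G := by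
  have := wNorm_add_le hw hF hG.neg
  simp only [Pi.neg_apply, ← sub_eq_add_neg] at this
  refine this.trans (le_of_eq ?_)
  congr 1
  exact wNorm_neg w G

theorem wNorm_add_weight_le {n : ℕ} {w w' : Rn n → ℝ} (hw : Measurable w) (hw' : Measurable w')
    {F : Rn n → ℂ} (hF : AEStronglyMeasurable F volume) :
    wNorm (fun ξ => w ξ + w' ξ) F ≤ wNorm w F + wNorm w' F := by
  have h1 : AEStronglyMeasurable (fun ξ => (w ξ : ℂ)) volume :=
    (Complex.measurable_ofReal.comp hw).aestronglyMeasurable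
  have h2 : AEStronglyMeasurable (fun ξ => (w' ξ : ℂ)) volume :=
    (Complex.measurable_ofReal.comp hw').aestronglyMeasurable
  refine le_trans (le_of_eq ?_) (eLpNorm_add_le (h1.mul hF) (h2.mul hF) (p := 2) (by norm_num))
  unfold wNorm
  congr 1
  ext ξ
  simp [add_mul]

theorem homNorm_zero_eq {n : ℕ} (F : Rn n → ℂ) : homNorm 0 F = eLpNorm F 2 volume := by
  simp [homNorm]

/-- With y = √T r one has r^s = T^{-s/2} y^s, and y^s ≤ 1 + y for 0 ≤ s ≤ 1. -/
theorem homNorm_le_energy {n : ℕ} {s T : ℝ} (hs0 : 0 ≤ s) (hs1 : s ≤ 1) (hT : 0 < T)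
    (F : Rn n → ℂ) : homNorm s F ≤ ENNReal.ofReal (T ^ (-(s / 2))) * energy T F := by
  refine wNorm_mono F fun ξ => ?_
  have h0 : 0 ≤ Real.sqrt T * rad ξ := by positivity
  rw [abs_of_nonneg (by positivity), abs_of_nonneg (by positivity)]
  have h1 : rad ξ ^ s = T ^ (-(s / 2)) * (Real.sqrt T * rad ξ) ^ s := by
    rw [Real.mul_rpow (x := Real.sqrt T) (by positivity) (by positivity), Real.sqrt_eq_rpow, ← Real.rpow_mul hT.le,
      ← mul_assoc, ← Real.rpow_add hT]
    rw [show -(s / 2) + 1 / 2 * s = 0 by ring, Real.rpow_zero, one_mul]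
  rw [h1]
  gcongr
  rcases le_total (Real.sqrt T * rad ξ) 1 with h | h
  · exact (Real.rpow_le_one h0 h hs0).trans (by linarith)
  · calc (Real.sqrt T * rad ξ) ^ s ≤ (Real.sqrt T * rad ξ) ^ (1 : ℝ) :=
        Real.rpow_le_rpow_of_exponent_le h hs1
      _ ≤ _ := by rw [Real.rpow_one]; linarith

/-- Dimension at most two gives s ≤ 1, so the energy controls the derivative of order s for every
finite q > 2. -/
theorem exists_lintegral_rpow_le_energy {n : ℕ} (hn : 0 < n) (hn2 : n ≤ 2) {q s : ℝ} (hq : 2 < q)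
    (hs : s = n * (1 / 2 - 1 / q)) : ∃ C : ℝ, 0 < C ∧ ∀ U F : Rn n → ℂ, IsL2Fourier U F →
      ∀ T A : ℝ, 0 < T → 0 ≤ A → energy T F ≤ ENNReal.ofReal A →
        ∫⁻ x, ENNReal.ofReal (‖U x‖ ^ q) ≤ ENNReal.ofReal (C * (T ^ (-(s / 2)) * A) ^ q) := by
  obtain ⟨C, hC, h⟩ := exists_lintegral_rpow_le_homNorm hn hq hs
  have hn' : (0 : ℝ) < n := by exact_mod_cast hn
  have hn2' : (n : ℝ) ≤ 2 := by exact_mod_cast hn2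
  have hq1 : 1 / q < 1 / 2 := by
    rw [div_lt_div_iff₀ (by linarith) (by norm_num)]; linarith
  have hq2 : 0 < 1 / q := by positivity
  have hs0 : 0 ≤ s := by rw [hs]; exact mul_nonneg hn'.le (by linarith)
  have hs1 : s ≤ 1 := by rw [hs]; nlinarith
  refine ⟨C, hC, fun U F hUF T A hT hA hE => ?_⟩
  -- The inequality for `homNorm` needs a positive bound, whereas A may be 0; it is applied to
  -- larger A', and A' then decreases to the limit.
  have h1 : ∀ A' ∈ Ioi (T ^ (-(s / 2)) * A), ∫⁻ x, ENNReal.ofReal (‖U x‖ ^ q) ≤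
      ENNReal.ofReal (C * A' ^ q) := by
    intro A' hA'
    have h0 : 0 ≤ T ^ (-(s / 2)) * A := by positivity
    refine h U F hUF A' (h0.trans_lt hA') ?_
    calc homNorm s F ≤ ENNReal.ofReal (T ^ (-(s / 2))) * energy T F :=
          homNorm_le_energy hs0 hs1 hT F
      _ ≤ ENNReal.ofReal (T ^ (-(s / 2))) * ENNReal.ofReal A := by gcongr
      _ = ENNReal.ofReal (T ^ (-(s / 2)) * A) := (ENNReal.ofReal_mul (by positivity)).symm
      _ ≤ _ := ENNReal.ofReal_le_ofReal (le_of_lt hA')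
  have hcont : Continuous fun y : ℝ => ENNReal.ofReal (C * y ^ q) := by
    refine ENNReal.continuous_ofReal.comp (continuous_const.mul ?_)
    exact Real.continuous_rpow_const (by linarith)
  have ht := (hcont.tendsto (T ^ (-(s / 2)) * A)).mono_left
    (nhdsWithin_le_nhds (s := Ioi (T ^ (-(s / 2)) * A)))
  refine ge_of_tendsto ht ?_
  filter_upwards [self_mem_nhdsWithin] with A' hA' using h1 A' hA'

/-! ### Lipschitz estimates for the nonlinearity. -/

/-- Mean value inequality on the segment between b and a, on which |x| ≤ |a| + |b|. -/
theorem IsPowerNonlinearity.exists_abs_sub_le {p : ℝ} {f : ℝ → ℝ} (hp : 1 ≤ p)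
    (hf : IsPowerNonlinearity p f) :
    ∃ C : ℝ, 0 ≤ C ∧ ∀ a b : ℝ, |f a - f b| ≤ C * (|a| + |b|) ^ (p - 1) * |a - b| := by
  obtain ⟨hd, C, hC⟩ := hf
  have hC0 : 0 ≤ C := by
    have := (hC 1).1
    simp only [abs_one, Real.one_rpow, mul_one] at this
    exact (abs_nonneg _).trans this
  refine ⟨C, hC0, fun a b => ?_⟩
  have := Convex.norm_image_sub_le_of_norm_deriv_le (𝕜 := ℝ) (f := f) (s := uIcc b a) (x := b)
    (y := a) (C := C * (|a| + |b|) ^ (p - 1))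
    (fun x _ => (hd.differentiable (by norm_num)).differentiableAt) (fun x hx => ?_)
    (convex_uIcc b a) left_mem_uIcc right_mem_uIcc
  · simpa using this
  · refine ((hC x).2.1).trans ?_
    have : |x| ≤ |a| + |b| := by
      rcases abs_cases x with h | h <;> rcases abs_cases a with h' | h' <;>
        rcases abs_cases b with h'' | h'' <;> rcases mem_uIcc.1 hx with h3 | h3 <;> linarith
    have hp' : 0 ≤ p - 1 := by linarith
    gcongr

theorem IsPowerNonlinearity.map_zero {p : ℝ} {f : ℝ → ℝ} (hp : 0 < p)
    (hf : IsPowerNonlinearity p f) : f 0 = 0 := by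
  obtain ⟨-, C, hC⟩ := hf
  have := (hC 0).1
  rw [abs_zero, Real.zero_rpow hp.ne', mul_zero] at this
  exact abs_nonpos_iff.1 this

/-- The difference of the nonlinear terms in `L^m`, in terms of scaled `H¹` norms. -/
theorem exists_lintegral_nonlinearity_sub_le {n : ℕ} (hn : 0 < n) (hn2 : n ≤ 2) {p m : ℝ}
    (hp : 2 < p) (hm : 1 ≤ m) {f : ℝ → ℝ} (hf : IsPowerNonlinearity p f) :
    ∃ C : ℝ, 0 < C ∧ ∀ U F W G : Rn n → ℂ, IsL2Fourier U F → IsL2Fourier W G →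
      ∀ T A B : ℝ, 0 < T → 0 ≤ A → 0 ≤ B → energy T F ≤ ENNReal.ofReal A →
        energy T G ≤ ENNReal.ofReal A → energy T (fun ξ => F ξ - G ξ) ≤ ENNReal.ofReal B →
        ∫⁻ x, ENNReal.ofReal (|f (U x).re - f (W x).re| ^ m) ≤
          ENNReal.ofReal ((C * T ^ (-(n * (p / 4 - 1 / (2 * m)))) * A ^ (p - 1) * B) ^ m) := by
  have hm0 : 0 < m := by linarith
  have hp0 : 0 < p := by linarith
  have hp1 : 0 ≤ p - 1 := by linarith
  have hq : 2 < m * p := by nlinarith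
  obtain ⟨c, hc, hfc⟩ := hf.exists_abs_sub_le (by linarith)
  -- The exponent is q = mp: the difference in L^m is bounded by Hölder with exponents p/(p-1) and
  -- p, both factors being measured in L^{mp}.
  obtain ⟨K, hK, hGN⟩ := exists_lintegral_rpow_le_energy hn hn2 hq
    (s := n * (1 / 2 - 1 / (m * p))) rfl
  set s : ℝ := n * (1 / 2 - 1 / (m * p)) with hs
  refine ⟨(c + 1) * ((2 ^ (m * p) * (K + K)) ^ ((p - 1) / p) * K ^ (1 / p)) ^ (1 / m),
    by positivity, fun U F W G hU hW T A B hT hA hB hFA hGA hFG => ?_⟩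
  have e1 := hGN U F hU T A hT hA hFA
  have e2 := hGN W G hW T A hT hA hGA
  have e3 := hGN _ _ (hU.sub hW) T B hT hB hFG
  have hUm := hU.memLp_left.1.norm.aemeasurable
  have hWm := hW.memLp_left.1.norm.aemeasurable
  have hUWm := (hU.sub hW).memLp_left.1.norm.aemeasurable
  set a : Rn n → ℝ≥0∞ := fun x => ENNReal.ofReal ((‖U x‖ + ‖W x‖) ^ (m * p)) with ha
  set b : Rn n → ℝ≥0∞ := fun x => ENNReal.ofReal (‖U x - W x‖ ^ (m * p)) with hb
  have ham : AEMeasurable a volume := by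
    exact ((hUm.add hWm).pow_const _).ennreal_ofReal
  have hbm : AEMeasurable b volume := (hUWm.pow_const _).ennreal_ofReal
  have ha_le : ∫⁻ x, a x ≤ ENNReal.ofReal (2 ^ (m * p) * (K + K) *
      (T ^ (-(s / 2)) * A) ^ (m * p)) := by
    calc ∫⁻ x, a x ≤ ∫⁻ x, ENNReal.ofReal (2 ^ (m * p)) *
          (ENNReal.ofReal (‖U x‖ ^ (m * p)) + ENNReal.ofReal (‖W x‖ ^ (m * p))) := by
          refine lintegral_mono fun x => ?_
          rw [← ENNReal.ofReal_add (by positivity) (by positivity),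
            ← ENNReal.ofReal_mul (by positivity)]
          apply ENNReal.ofReal_le_ofReal
          have hU0 := norm_nonneg (U x)
          have hW0 := norm_nonneg (W x)
          have h1 : ‖U x‖ + ‖W x‖ ≤ 2 * max ‖U x‖ ‖W x‖ := by
            linarith [le_max_left ‖U x‖ ‖W x‖, le_max_right ‖U x‖ ‖W x‖]
          have h2 : (‖U x‖ + ‖W x‖) ^ (m * p) ≤ (2 * max ‖U x‖ ‖W x‖) ^ (m * p) := by gcongr
          refine h2.trans ?_
          rw [Real.mul_rpow (by norm_num) (by positivity)]
          gcongr
          rcases max_choice ‖U x‖ ‖W x‖ with h | h <;> rw [h]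
          · linarith [Real.rpow_nonneg hW0 (m * p)]
          · linarith [Real.rpow_nonneg hU0 (m * p)]
      _ = ENNReal.ofReal (2 ^ (m * p)) * ((∫⁻ x, ENNReal.ofReal (‖U x‖ ^ (m * p))) +
          ∫⁻ x, ENNReal.ofReal (‖W x‖ ^ (m * p))) := by
          rw [lintegral_const_mul' _ _ ENNReal.ofReal_ne_top,
            lintegral_add_left' ((hUm.pow_const _).ennreal_ofReal)]
      _ ≤ ENNReal.ofReal (2 ^ (m * p)) * (ENNReal.ofReal (K * (T ^ (-(s / 2)) * A) ^ (m * p)) +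
          ENNReal.ofReal (K * (T ^ (-(s / 2)) * A) ^ (m * p))) := by gcongr
      _ = _ := by
          rw [← ENNReal.ofReal_add (by positivity) (by positivity),
            ← ENNReal.ofReal_mul (by positivity)]
          congr 1
          ring
  have hcm : 0 ≤ c ^ m := by positivity
  have hpow : ∀ x y : ℝ, 0 ≤ x → 0 ≤ y → (x ^ (m * p)) ^ y = x ^ (m * p * y) :=
    fun x y hx _ => (Real.rpow_mul hx _ _).symm
  calc ∫⁻ x, ENNReal.ofReal (|f (U x).re - f (W x).re| ^ m)
      ≤ ∫⁻ x, ENNReal.ofReal (c ^ m) * (a x ^ ((p - 1) / p) * b x ^ (1 / p)) := by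
        refine lintegral_mono fun x => ?_
        rw [ha, hb]
        simp only
        rw [ENNReal.ofReal_rpow_of_nonneg (by positivity) (by positivity),
          ENNReal.ofReal_rpow_of_nonneg (by positivity) (by positivity),
          ← ENNReal.ofReal_mul (by positivity), ← ENNReal.ofReal_mul hcm]
        apply ENNReal.ofReal_le_ofReal
        rw [hpow _ _ (by positivity) (by positivity), hpow _ _ (by positivity) (by positivity),
          show m * p * ((p - 1) / p) = (p - 1) * m by field_simp,
          show m * p * (1 / p) = m by field_simp, Real.rpow_mul (by positivity),
          ← Real.mul_rpow (by positivity) (by positivity), ← Real.mul_rpow hc (by positivity)]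
        have h1 : |(U x).re - (W x).re| ≤ ‖U x - W x‖ := by
          rw [← Complex.sub_re]; exact Complex.abs_re_le_norm _
        have h2 := Complex.abs_re_le_norm (U x)
        have h3 := Complex.abs_re_le_norm (W x)
        gcongr
        refine (hfc _ _).trans ?_
        rw [mul_assoc]
        gcongr
    _ ≤ ENNReal.ofReal (c ^ m) * ((∫⁻ x, a x) ^ ((p - 1) / p) * (∫⁻ x, b x) ^ (1 / p)) := by
        rw [lintegral_const_mul' _ _ ENNReal.ofReal_ne_top]
        gcongr
        exact ENNReal.lintegral_mul_norm_pow_le ham hbm (by positivity) (by positivity)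
          (by field_simp; ring)
    _ ≤ ENNReal.ofReal (c ^ m) * (ENNReal.ofReal (2 ^ (m * p) * (K + K) *
          (T ^ (-(s / 2)) * A) ^ (m * p)) ^ ((p - 1) / p) *
          ENNReal.ofReal (K * (T ^ (-(s / 2)) * B) ^ (m * p)) ^ (1 / p)) := by
        gcongr
    _ = ENNReal.ofReal (c ^ m * ((2 ^ (m * p) * (K + K)) ^ ((p - 1) / p) * K ^ (1 / p)) *
          (T ^ (-(n * (p / 4 - 1 / (2 * m)))) * A ^ (p - 1) * B) ^ m) := by
        rw [ENNReal.ofReal_rpow_of_nonneg (by positivity) (by positivity),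
          ENNReal.ofReal_rpow_of_nonneg (by positivity) (by positivity),
          ← ENNReal.ofReal_mul (by positivity), ← ENNReal.ofReal_mul hcm]
        congr 1
        rw [Real.mul_rpow (y := (T ^ (-(s / 2)) * A) ^ (m * p)) (by positivity) (by positivity),
          Real.mul_rpow (y := (T ^ (-(s / 2)) * B) ^ (m * p)) (by positivity) (by positivity),
          hpow _ _ (by positivity) (by positivity), hpow _ _ (by positivity) (by positivity),
          show m * p * ((p - 1) / p) = (p - 1) * m by field_simp,
          show m * p * (1 / p) = m by field_simp,
          Real.mul_rpow (x := T ^ (-(s / 2))) (by positivity) hA,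
          Real.mul_rpow (x := T ^ (-(s / 2))) (by positivity) hB,
          Real.mul_rpow (y := B) (by positivity) hB,
          Real.mul_rpow (y := A ^ (p - 1)) (by positivity) (by positivity), Real.rpow_mul hA]
        -- The p factors T^{-s/2} combine to the stated rate, since ps/2 = n(p/4 - 1/(2m)).
        have h1 : (T ^ (-(s / 2))) ^ ((p - 1) * m) * (T ^ (-(s / 2))) ^ m =
            (T ^ (-(n * (p / 4 - 1 / (2 * m))))) ^ m := by
          rw [← Real.rpow_mul hT.le, ← Real.rpow_mul hT.le, ← Real.rpow_mul hT.le,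
            ← Real.rpow_add hT]
          congr 1
          rw [hs]
          field_simp
          ring
        rw [← h1]
        ring
    _ ≤ _ := by
        apply ENNReal.ofReal_le_ofReal
        have hX : 0 ≤ (2 ^ (m * p) * (K + K)) ^ ((p - 1) / p) * K ^ (1 / p) := by positivity
        have hY : 0 ≤ T ^ (-(n * (p / 4 - 1 / (2 * m)))) * A ^ (p - 1) * B := by positivity
        generalize (2 ^ (m * p) * (K + K)) ^ ((p - 1) / p) * K ^ (1 / p) = X at hX ⊢
        have h2 : (c + 1) * X ^ (1 / m) * T ^ (-(n * (p / 4 - 1 / (2 * m)))) * A ^ (p - 1) * B =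
            ((c + 1) * X ^ (1 / m)) * (T ^ (-(n * (p / 4 - 1 / (2 * m)))) * A ^ (p - 1) * B) := by
          ring
        rw [h2]
        generalize T ^ (-(n * (p / 4 - 1 / (2 * m)))) * A ^ (p - 1) * B = Y at hY ⊢
        rw [Real.mul_rpow (by positivity) hY, Real.mul_rpow (x := c + 1) (by positivity)
          (by positivity), ← Real.rpow_mul hX, one_div_mul_cancel hm0.ne', Real.rpow_one]
        gcongr
        linarith


/-! ### Pointwise bounds for the symbols, and norms of heat kernels. -/

/-- Numerator and denominator change sign together at r = 1, where the quotient is 0 by the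
convention on division. -/
theorem symbolK1_nonneg {n : ℕ} {t : ℝ} (ht : 0 ≤ t) (ξ : Rn n) : 0 ≤ symbolK1 t ξ := by
  simp only [symbolK1]
  rcases le_total ((2 * Real.pi * ‖ξ‖) ^ 2) 1 with h | h
  · refine div_nonneg ?_ (by linarith)
    rw [sub_nonneg, Real.exp_le_exp]
    nlinarith
  · refine div_nonneg_of_nonpos ?_ (by linarith)
    rw [sub_nonpos, Real.exp_le_exp]
    nlinarith

theorem measurable_symbolK1 {n : ℕ} : Measurable fun z : ℝ × Rn n => symbolK1 z.1 z.2 := by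
  unfold symbolK1
  fun_prop

theorem continuous_symbolK1 {n : ℕ} (ξ : Rn n) : Continuous fun t => symbolK1 t ξ := by
  unfold symbolK1
  fun_prop

theorem one_sub_exp_neg_le (x : ℝ) : 1 - Real.exp (-x) ≤ x := by
  linarith [Real.add_one_le_exp (-x)]

/-- The symbol `K₁` is dominated by a heat kernel at low frequencies and decays exponentially in
time, with a gain of two derivatives, at high frequencies. -/
theorem symbolK1_le {n : ℕ} {t : ℝ} (ht : 0 ≤ t) (ξ : Rn n) :
    symbolK1 t ξ ≤ 12 * (Real.exp (-((1 + t) * rad ξ ^ 2)) +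
      Real.exp (-(t / 4)) / (1 + rad ξ ^ 2)) := by
  simp only [symbolK1]
  change (Real.exp (-t * rad ξ ^ 2) - Real.exp (-t)) / (1 - rad ξ ^ 2) ≤ _
  have ha : 0 ≤ rad ξ ^ 2 := by positivity
  generalize rad ξ ^ 2 = a at ha ⊢
  have hE1 := Real.exp_pos (-((1 + t) * a))
  have hE2 : 0 < Real.exp (-(t / 4)) / (1 + a) := by positivity
  -- Here a = r². For a ≤ 1/2 the denominator is at least 1/2, and replacing t by 1 + t in the heat
  -- factor costs e^a ≤ 3. For a ≥ 2 the numerator is dominated by e^{-t}.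
  rcases le_total a (1 / 2) with h1 | h1
  · rw [div_le_iff₀ (by linarith)]
    have e1 : Real.exp (-t * a) = Real.exp a * Real.exp (-((1 + t) * a)) := by
      rw [← Real.exp_add]; ring_nf
    have e2 : Real.exp a ≤ 3 := by
      have : Real.exp a ≤ Real.exp 1 := Real.exp_le_exp.2 (by linarith)
      linarith [Real.exp_one_lt_d9]
    have := Real.exp_pos (-t)
    nlinarith [mul_le_mul_of_nonneg_right e2 hE1.le]
  rcases le_total 2 a with h2 | h2
  · rw [← neg_div_neg_eq, div_le_iff₀ (by linarith)]
    have e1 : Real.exp (-t) ≤ Real.exp (-(t / 4)) := Real.exp_le_exp.2 (by linarith)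
    have e2 : Real.exp (-(t / 4)) = Real.exp (-(t / 4)) / (1 + a) * (1 + a) := by
      field_simp
    have := Real.exp_pos (-t * a)
    nlinarith
  -- Around the removable singularity a = 1 the expression is a difference quotient of e^{-ta}, at
  -- most t e^{-t/2}; lowering the rate to 1/4 absorbs the factor t.
  · have e0 : t * Real.exp (-(t / 2)) ≤ 4 * Real.exp (-(t / 4)) := by
      have : Real.exp (-(t / 2)) = Real.exp (-(t / 4)) * Real.exp (-(t / 4)) := by
        rw [← Real.exp_add]; ring_nf
      have h3 : t / 4 ≤ Real.exp (t / 4) := by linarith [Real.add_one_le_exp (t / 4)]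
      have h4 : Real.exp (t / 4) * Real.exp (-(t / 4)) = 1 := by rw [← Real.exp_add]; simp
      have h5 := Real.exp_pos (-(t / 4))
      rw [this]
      nlinarith
    have e3 : 4 * Real.exp (-(t / 4)) ≤ 12 * (Real.exp (-(t / 4)) / (1 + a)) := by
      rw [← mul_div_assoc, le_div_iff₀ (by linarith)]
      nlinarith [Real.exp_pos (-(t / 4))]
    suffices (Real.exp (-t * a) - Real.exp (-t)) / (1 - a) ≤ t * Real.exp (-(t / 2)) by linarith
    rcases lt_trichotomy a 1 with h | h | h
    · rw [div_le_iff₀ (by linarith)]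
      have e4 : Real.exp (-t) = Real.exp (-t * a) * Real.exp (-(t * (1 - a))) := by
        rw [← Real.exp_add]; ring_nf
      have e5 := one_sub_exp_neg_le (t * (1 - a))
      have e6 : Real.exp (-t * a) ≤ Real.exp (-(t / 2)) := Real.exp_le_exp.2 (by nlinarith)
      have e7 : 0 ≤ t * (1 - a) := mul_nonneg ht (by linarith)
      have e8 := Real.exp_pos (-t * a)
      calc _ = Real.exp (-t * a) * (1 - Real.exp (-(t * (1 - a)))) := by rw [e4]; ring
        _ ≤ Real.exp (-t * a) * (t * (1 - a)) := by gcongr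
        _ ≤ Real.exp (-(t / 2)) * (t * (1 - a)) := by gcongr
        _ = _ := by ring
    -- At a = 1 the quotient is 0 by convention.
    · rw [h]; simp; positivity
    · rw [← neg_div_neg_eq, div_le_iff₀ (by linarith)]
      have e4 : Real.exp (-t * a) = Real.exp (-t) * Real.exp (-(t * (a - 1))) := by
        rw [← Real.exp_add]; ring_nf
      have e5 := one_sub_exp_neg_le (t * (a - 1))
      have e6 : Real.exp (-t) ≤ Real.exp (-(t / 2)) := Real.exp_le_exp.2 (by linarith)
      have e7 : 0 ≤ t * (a - 1) := mul_nonneg ht (by linarith)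
      have e8 := Real.exp_pos (-t)
      calc _ = Real.exp (-t) * (1 - Real.exp (-(t * (a - 1)))) := by rw [e4]; ring
        _ ≤ Real.exp (-t) * (t * (a - 1)) := by gcongr
        _ ≤ Real.exp (-(t / 2)) * (t * (a - 1)) := by gcongr
        _ = _ := by ring

theorem exp_neg_le_one_div {a : ℝ} (ha : 0 ≤ a) : Real.exp (-a) ≤ 1 / (1 + a) := by
  rw [Real.exp_neg, ← one_div]
  exact one_div_le_one_div_of_le (by linarith) (by linarith [Real.add_one_le_exp a])

theorem symbolK1_le_div {n : ℕ} {t : ℝ} (ht : 0 ≤ t) (ξ : Rn n) :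
    symbolK1 t ξ ≤ 24 / (1 + rad ξ ^ 2) := by
  refine (symbolK1_le ht ξ).trans ?_
  have ha : 0 ≤ rad ξ ^ 2 := by positivity
  have h1 : Real.exp (-((1 + t) * rad ξ ^ 2)) ≤ 1 / (1 + rad ξ ^ 2) :=
    (Real.exp_le_exp.2 (by nlinarith)).trans (exp_neg_le_one_div ha)
  have h2 : Real.exp (-(t / 4)) / (1 + rad ξ ^ 2) ≤ 1 / (1 + rad ξ ^ 2) := by
    gcongr
    exact Real.exp_le_one_iff.2 (by linarith)
  calc _ ≤ 12 * (1 / (1 + rad ξ ^ 2) + 1 / (1 + rad ξ ^ 2)) := by gcongr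
    _ = _ := by ring

theorem rpow_le_one_add_sq {y κ : ℝ} (hy : 0 ≤ y) (h0 : 0 ≤ κ) (h2 : κ ≤ 2) :
    y ^ κ ≤ 1 + y ^ 2 := by
  rcases le_total y 1 with h | h
  · have := Real.rpow_le_one hy h h0
    nlinarith
  · have : y ^ κ ≤ y ^ (2 : ℝ) := Real.rpow_le_rpow_of_exponent_le h h2
    rw [Real.rpow_two] at this
    linarith

/-- `K₁` maps `L²` into `H^κ`, `κ ≤ 2`, with the parabolic decay rate. -/
theorem rad_rpow_mul_symbolK1_le {n : ℕ} {t κ : ℝ} (ht : 0 ≤ t) (h0 : 0 ≤ κ) (h2 : κ ≤ 2)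
    (ξ : Rn n) : rad ξ ^ κ * symbolK1 t ξ ≤ 60 * (1 + t) ^ (-(κ / 2)) := by
  have hr := rad_nonneg ξ
  have ht1 : 0 < 1 + t := by linarith
  have hpow : 0 < (1 + t) ^ (-(κ / 2)) := by positivity
  -- In the parabolic variable y = √(1+t) r the claim is y^κ e^{-y²} ≤ 1, true because κ ≤ 2.
  have e1 : rad ξ ^ κ * Real.exp (-((1 + t) * rad ξ ^ 2)) ≤ (1 + t) ^ (-(κ / 2)) := by
    set y := Real.sqrt (1 + t) * rad ξ with hy
    have hy0 : 0 ≤ y := by positivity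
    have hy2 : y ^ 2 = (1 + t) * rad ξ ^ 2 := by
      rw [hy, mul_pow, Real.sq_sqrt ht1.le]
    have h3 : rad ξ ^ κ = (1 + t) ^ (-(κ / 2)) * y ^ κ := by
      rw [hy, Real.mul_rpow (x := Real.sqrt (1 + t)) (by positivity) hr, Real.sqrt_eq_rpow,
        ← Real.rpow_mul ht1.le, ← mul_assoc, ← Real.rpow_add ht1,
        show -(κ / 2) + 1 / 2 * κ = 0 by ring, Real.rpow_zero, one_mul]
    have h4 := rpow_le_one_add_sq hy0 h0 h2
    have h5 := exp_neg_le_one_div (sq_nonneg y)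
    rw [h3, ← hy2, mul_assoc]
    refine mul_le_of_le_one_right hpow.le ?_
    calc y ^ κ * Real.exp (-y ^ 2) ≤ (1 + y ^ 2) * (1 / (1 + y ^ 2)) := by gcongr
      _ = 1 := by field_simp
  have e2 : rad ξ ^ κ * (Real.exp (-(t / 4)) / (1 + rad ξ ^ 2)) ≤ 4 * (1 + t) ^ (-(κ / 2)) := by
    have h4 := rpow_le_one_add_sq hr h0 h2
    have h5 : Real.exp (-(t / 4)) ≤ 4 * (1 + t) ^ (-(κ / 2)) := by
      have h6 : (1 + t) ^ (κ / 2) ≤ 1 + t := by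
        calc (1 + t) ^ (κ / 2) ≤ (1 + t) ^ (1 : ℝ) :=
              Real.rpow_le_rpow_of_exponent_le (by linarith) (by linarith)
          _ = _ := Real.rpow_one _
      have h7 : 1 + t ≤ 4 * Real.exp (t / 4) := by linarith [Real.add_one_le_exp (t / 4)]
      rw [Real.rpow_neg ht1.le, Real.exp_neg, ← div_eq_mul_inv, le_div_iff₀ (by positivity),
        inv_mul_le_iff₀ (Real.exp_pos _)]
      linarith
    calc _ ≤ (1 + rad ξ ^ 2) * (Real.exp (-(t / 4)) / (1 + rad ξ ^ 2)) := by gcongr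
      _ = Real.exp (-(t / 4)) := by field_simp
      _ ≤ _ := h5
  calc rad ξ ^ κ * symbolK1 t ξ ≤ rad ξ ^ κ * (12 * (Real.exp (-((1 + t) * rad ξ ^ 2)) +
        Real.exp (-(t / 4)) / (1 + rad ξ ^ 2))) := by gcongr; exact symbolK1_le ht ξ
    _ = 12 * (rad ξ ^ κ * Real.exp (-((1 + t) * rad ξ ^ 2)) +
        rad ξ ^ κ * (Real.exp (-(t / 4)) / (1 + rad ξ ^ 2))) := by ring
    _ ≤ 12 * ((1 + t) ^ (-(κ / 2)) + 4 * (1 + t) ^ (-(κ / 2))) := by gcongr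
    _ = _ := by ring

/-- This eliminates K₀: the data enter through e^{-t}û₀ and K₁(û₀ + û₁). The first is exponentially
small, so the mass of the profile comes from u₀ + u₁. -/
theorem symbolK0_eq {n : ℕ} (t : ℝ) {ξ : Rn n} (h : rad ξ ≠ 1) :
    symbolK0 t ξ = Real.exp (-t) + symbolK1 t ξ := by
  have h1 : 1 - rad ξ ^ 2 ≠ 0 := by
    intro h2
    have : rad ξ ^ 2 = 1 := by linarith
    exact h ((pow_eq_one_iff_of_nonneg (rad_nonneg ξ) two_ne_zero).1 this)
  simp only [symbolK0, symbolK1]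
  change _ / (1 - rad ξ ^ 2) = _ + _ / (1 - rad ξ ^ 2)
  rw [← rad] at *
  generalize rad ξ ^ 2 = a at h1 ⊢
  field_simp
  ring

theorem ae_rad_ne_one {n : ℕ} (hn : 0 < n) : ∀ᵐ ξ : Rn n, rad ξ ≠ 1 := by
  have : Nonempty (Fin n) := ⟨⟨0, hn⟩⟩
  have h := Measure.addHaar_sphere (volume : Measure (Rn n)) 0 (1 / (2 * Real.pi))
  have : {ξ : Rn n | ¬ rad ξ ≠ 1} ⊆ Metric.sphere 0 (1 / (2 * Real.pi)) := by
    intro ξ hξ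
    have hξ' : rad ξ = 1 := by simpa using hξ
    have : ‖ξ‖ = 1 / (2 * Real.pi) := by
      rw [eq_div_iff (by positivity), ← hξ', rad]; ring
    simpa using this
  exact measure_mono_null this h

theorem exists_rpow_mul_exp_neg_le {k : ℝ} (hk : 0 ≤ k) :
    ∃ C : ℝ, 0 < C ∧ ∀ y : ℝ, 0 ≤ y → y ^ k * Real.exp (-y) ≤ C := by
  rcases hk.eq_or_lt with rfl | hk
  · exact ⟨1, one_pos, fun y hy => by simpa using hy⟩
  refine ⟨k ^ k, by positivity, fun y hy => ?_⟩
  have h1 : y / k ≤ Real.exp (y / k) := by linarith [Real.add_one_le_exp (y / k)]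
  have h2 : y ^ k ≤ k ^ k * Real.exp y := by
    calc y ^ k = k ^ k * (y / k) ^ k := by
          rw [← Real.mul_rpow hk.le (by positivity)]; congr 1; field_simp
      _ ≤ k ^ k * Real.exp (y / k) ^ k := by gcongr
      _ = _ := by rw [← Real.exp_mul]; congr 2; field_simp
  calc y ^ k * Real.exp (-y) ≤ k ^ k * Real.exp y * Real.exp (-y) := by gcongr
    _ = k ^ k := by rw [mul_assoc, ← Real.exp_add]; simp

theorem lintegral_exp_neg_mul_rad_sq {n : ℕ} {b : ℝ} (hb : 0 < b) :
    ∫⁻ ξ : Rn n, ENNReal.ofReal (Real.exp (-(b * rad ξ ^ 2))) =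
      ENNReal.ofReal ((4 * Real.pi * b) ^ (-((n : ℝ) / 2))) := by
  have h := GaussianFourier.integral_rexp_neg_mul_sq_norm (V := Rn n)
    (b := 4 * Real.pi ^ 2 * b) (by positivity)
  have e : ∀ ξ : Rn n, Real.exp (-(b * rad ξ ^ 2)) =
      Real.exp (-(4 * Real.pi ^ 2 * b) * ‖ξ‖ ^ 2) := fun ξ => by
    congr 1; rw [rad]; ring
  -- Integrability follows from the value of the integral: a non-integrable function would have
  -- integral 0, but the Gaussian formula is positive.
  have hi : Integrable fun ξ : Rn n => Real.exp (-(4 * Real.pi ^ 2 * b) * ‖ξ‖ ^ 2) := by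
    by_contra hcon
    rw [integral_undef hcon] at h
    have : 0 < (Real.pi / (4 * Real.pi ^ 2 * b)) ^ ((Module.finrank ℝ (Rn n) : ℝ) / 2) := by
      positivity
    linarith
  simp_rw [e]
  rw [← ofReal_integral_eq_lintegral_ofReal hi (Eventually.of_forall fun ξ => by positivity), h]
  congr 1
  rw [Real.rpow_neg (by positivity), ← Real.inv_rpow (by positivity)]
  simp only [finrank_euclideanSpace, Fintype.card_fin]
  congr 1
  field_simp

/-- The `L²` norms of heat kernels. -/
theorem exists_homNorm_exp_le {n : ℕ} {k : ℝ} (hk : 0 ≤ k) :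
    ∃ C : ℝ, 0 < C ∧ ∀ T : ℝ, 0 < T →
      homNorm k (fun ξ : Rn n => (Real.exp (-(T * rad ξ ^ 2)) : ℂ)) ≤
        ENNReal.ofReal (C * T ^ (-((n : ℝ) / 4 + k / 2))) := by
  obtain ⟨C, hC, h⟩ := exists_rpow_mul_exp_neg_le hk
  -- Squaring produces two factors e^{-Tr²}: one absorbs r^{2k} at the cost of T^{-k}, the other is
  -- integrated.
  refine ⟨Real.sqrt (C * (4 * Real.pi) ^ (-((n : ℝ) / 2))), by positivity, fun T hT => ?_⟩
  rw [← ENNReal.pow_le_pow_left_iff two_ne_zero, homNorm_sq]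
  calc ∫⁻ ξ : Rn n, ENNReal.ofReal (rad ξ ^ (2 * k)) * ‖(Real.exp (-(T * rad ξ ^ 2)) : ℂ)‖ₑ ^ 2
      ≤ ∫⁻ ξ : Rn n, ENNReal.ofReal (C * T ^ (-k)) *
          ENNReal.ofReal (Real.exp (-(T * rad ξ ^ 2))) := by
        refine lintegral_mono fun ξ => ?_
        have hr := rad_nonneg ξ
        rw [← ofReal_norm, Complex.norm_real,
          Real.norm_of_nonneg (Real.exp_pos _).le, ← ENNReal.ofReal_pow (Real.exp_pos _).le,
          ← ENNReal.ofReal_mul (by positivity), ← ENNReal.ofReal_mul (by positivity)]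
        apply ENNReal.ofReal_le_ofReal
        have h1 := h (T * rad ξ ^ 2) (by positivity)
        have h2 : (T * rad ξ ^ 2) ^ k = T ^ k * rad ξ ^ (2 * k) := by
          rw [Real.mul_rpow hT.le (by positivity), ← Real.rpow_natCast,
            ← Real.rpow_mul hr]
          norm_num
        have h3 : rad ξ ^ (2 * k) * Real.exp (-(T * rad ξ ^ 2)) ≤ C * T ^ (-k) := by
          rw [Real.rpow_neg hT.le, ← div_eq_mul_inv, le_div_iff₀ (by positivity)]
          rw [h2] at h1
          linarith
        rw [sq, ← mul_assoc]
        gcongr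
    _ = ENNReal.ofReal (C * T ^ (-k)) * ENNReal.ofReal ((4 * Real.pi * T) ^ (-((n : ℝ) / 2))) := by
        rw [lintegral_const_mul' _ _ ENNReal.ofReal_ne_top, lintegral_exp_neg_mul_rad_sq hT]
    _ ≤ _ := by
        rw [← ENNReal.ofReal_mul (by positivity), ← ENNReal.ofReal_pow (by positivity), mul_pow,
          Real.sq_sqrt (by positivity)]
        apply ENNReal.ofReal_le_ofReal
        apply le_of_eq
        rw [Real.mul_rpow (x := 4 * Real.pi) (by positivity) hT.le, ← Real.rpow_natCast,
          ← Real.rpow_mul hT.le]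
        rw [show -((n : ℝ) / 4 + k / 2) * ((2 : ℕ) : ℝ) = -k + -((n : ℝ) / 2) by push_cast; ring,
          Real.rpow_add hT]
        ring


/-! ### Minkowski's inequality and the linear estimates. -/

/-- Minkowski's integral inequality in `L²`. -/
theorem eLpNorm_lintegral_le {α β : Type*} [MeasurableSpace α] [MeasurableSpace β] {μ : Measure α}
    {ν : Measure β} [SFinite μ] [SFinite ν] {H : β → α → ℝ≥0∞}
    (hH : Measurable (Function.uncurry H)) :
    eLpNorm (fun x => ∫⁻ y, H y x ∂ν) 2 μ ≤ ∫⁻ y, eLpNorm (H y) 2 μ ∂ν := by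
  rw [← ENNReal.pow_le_pow_left_iff two_ne_zero, eLpNorm_two_sq]
  simp only [enorm_eq_self]
  have hHx : ∀ x, Measurable fun y => H y x := fun x => hH.comp (measurable_id.prodMk measurable_const)
  have hHy : ∀ y, Measurable (H y) := fun y => hH.comp (measurable_const.prodMk measurable_id)
  have hsq : ∀ y, (∫⁻ x, H y x ^ 2 ∂μ) = eLpNorm (H y) 2 μ ^ 2 := fun y => by
    rw [eLpNorm_two_sq]; simp
  have hH' : Measurable (Function.uncurry fun x y => H y x) := hH.comp measurable_swap
  -- The square of the inner integral is a double integral over (y, z); after Tonelli,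
  -- Cauchy-Schwarz in x bounds each inner product of H y and H z.
  calc ∫⁻ x, (∫⁻ y, H y x ∂ν) ^ 2 ∂μ = ∫⁻ x, ∫⁻ y, H y x * (∫⁻ z, H z x ∂ν) ∂ν ∂μ := by
        congr 1
        ext x
        rw [lintegral_mul_const _ (hHx x), sq]
    _ = ∫⁻ y, ∫⁻ x, H y x * (∫⁻ z, H z x ∂ν) ∂μ ∂ν := by
        rw [lintegral_lintegral_swap]
        exact (hH'.mul (hH'.lintegral_prod_right.comp measurable_fst)).aemeasurable
    _ = ∫⁻ y, ∫⁻ z, ∫⁻ x, H y x * H z x ∂μ ∂ν ∂ν := by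
        congr 1
        ext y
        rw [lintegral_lintegral_swap]
        · congr 1
          ext x
          rw [lintegral_const_mul _ (hHx x)]
        · exact ((hH.comp (measurable_const.prodMk measurable_snd)).mul
            (hH.comp (measurable_fst.prodMk measurable_snd))).aemeasurable
    _ ≤ ∫⁻ y, ∫⁻ z, eLpNorm (H y) 2 μ * eLpNorm (H z) 2 μ ∂ν ∂ν := by
        refine lintegral_mono fun y => lintegral_mono fun z => ?_
        rw [← ENNReal.pow_le_pow_left_iff two_ne_zero, mul_pow, ← hsq, ← hsq]
        exact lintegral_mul_sq_le (hHy y).aemeasurable (hHy z).aemeasurable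
    _ = _ := by
        have hm : Measurable fun y => eLpNorm (H y) 2 μ := by
          have : (fun y => eLpNorm (H y) 2 μ) = fun y => (∫⁻ x, H y x ^ 2 ∂μ) ^ (1 / 2 : ℝ) := by
            ext y
            rw [hsq, ← ENNReal.rpow_natCast, ← ENNReal.rpow_mul]
            norm_num
          rw [this]
          exact (hH.pow_const 2).lintegral_prod_right.pow_const _
        rw [sq, ← lintegral_mul_const _ hm]
        congr 1
        ext y
        rw [lintegral_const_mul _ hm]

theorem measurable_wNorm {n : ℕ} {w : Rn n → ℝ} (hw : Measurable w) {g : ℝ → Rn n → ℂ}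
    (hg : Measurable (Function.uncurry g)) : Measurable fun τ => wNorm w (g τ) := by
  have : (fun τ => wNorm w (g τ)) =
      fun τ => (∫⁻ ξ, ‖(w ξ : ℂ) * g τ ξ‖ₑ ^ 2) ^ (1 / 2 : ℝ) := by
    ext τ
    rw [wNorm, ← eLpNorm_two_sq, ← ENNReal.rpow_natCast, ← ENNReal.rpow_mul]
    norm_num
  rw [this]
  have h1 : Measurable fun z : ℝ × Rn n => (w z.2 : ℂ) * g z.1 z.2 :=
    (Complex.measurable_ofReal.comp (hw.comp measurable_snd)).mul hg
  exact (h1.enorm.pow_const 2).lintegral_prod_right.pow_const _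

theorem wNorm_integral_le {n : ℕ} {w : Rn n → ℝ} (hw : Measurable w) {g : ℝ → Rn n → ℂ}
    (hg : Measurable (Function.uncurry g)) {a b : ℝ} (hab : a ≤ b) :
    wNorm w (fun ξ => ∫ τ in a..b, g τ ξ) ≤ ∫⁻ τ in Ioc a b, wNorm w (g τ) := by
  have h1 : Measurable fun z : ℝ × Rn n => ‖(w z.2 : ℂ) * g z.1 z.2‖ₑ :=
    ((Complex.measurable_ofReal.comp (hw.comp measurable_snd)).mul hg).enorm
  have := eLpNorm_lintegral_le (μ := (volume : Measure (Rn n)))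
    (ν := (volume : Measure ℝ).restrict (Ioc a b))
    (H := fun τ ξ => ‖(w ξ : ℂ) * g τ ξ‖ₑ) h1
  refine le_trans (eLpNorm_mono_enorm fun ξ => ?_) (this.trans (le_of_eq ?_))
  · simp only
    rw [enorm_eq_self, intervalIntegral.integral_of_le hab, ← integral_const_mul]
    exact enorm_integral_le_lintegral_enorm _
  · simp only [wNorm, eLpNorm_enorm]

theorem wNorm_le_of_norm_le {n : ℕ} {w : Rn n → ℝ} {F G : Rn n → ℂ}
    (h : ∀ᵐ ξ, ‖F ξ‖ ≤ ‖G ξ‖) : wNorm w F ≤ wNorm w G := by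
  have := wNorm_le_of_ae (w := w) (w' := w) (F := F) (G := G) (c := 1)
    (by filter_upwards [h] with ξ hξ; rw [one_mul]; gcongr)
  simpa using this

/-- Linear estimate without loss of integrability. -/
theorem homNorm_symbolK1_mul_le {n : ℕ} {s m κ : ℝ} (hs : 0 ≤ s) (hm : 0 ≤ m) (h0 : 0 ≤ κ)
    (h2 : κ ≤ 2) (g : Rn n → ℂ) :
    homNorm (m + κ) (fun ξ => (symbolK1 s ξ : ℂ) * g ξ) ≤
      ENNReal.ofReal (60 * (1 + s) ^ (-(κ / 2))) * homNorm m g := by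
  refine wNorm_le_of_ae (Eventually.of_forall fun ξ => ?_)
  have hr := rad_nonneg ξ
  have hK := symbolK1_nonneg hs ξ
  have := rad_rpow_mul_symbolK1_le hs h0 h2 ξ
  rw [abs_of_nonneg (by positivity), abs_of_nonneg (by positivity), norm_mul, Complex.norm_real,
    Real.norm_of_nonneg hK, Real.rpow_add_of_nonneg hr hm h0]
  calc rad ξ ^ m * rad ξ ^ κ * (symbolK1 s ξ * ‖g ξ‖) =
      rad ξ ^ κ * symbolK1 s ξ * (rad ξ ^ m * ‖g ξ‖) := by ring
    _ ≤ _ := by gcongr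

/-- Linear estimate using boundedness of `g`, i.e. integrability of its inverse transform. -/
theorem exists_homNorm_symbolK1_mul_le {n : ℕ} {m κ : ℝ} (hm : 0 ≤ m) (h0 : 0 ≤ κ) (h2 : κ ≤ 2) :
    ∃ C : ℝ, 0 < C ∧ ∀ s : ℝ, 0 ≤ s → ∀ g : Rn n → ℂ, AEStronglyMeasurable g volume →
      ∀ M : ℝ, 0 ≤ M → (∀ ξ, ‖g ξ‖ ≤ M) →
      homNorm (m + κ) (fun ξ => (symbolK1 s ξ : ℂ) * g ξ) ≤
        ENNReal.ofReal (C * M * (1 + s) ^ (-((n : ℝ) / 4 + (m + κ) / 2))) +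
        ENNReal.ofReal (C * Real.exp (-(s / 4))) * homNorm m g := by
  obtain ⟨C, hC, h⟩ := exists_homNorm_exp_le (n := n) (k := m + κ) (by linarith)
  -- In `symbolK1_le` the heat kernel is paired with the sup bound M and yields the full rate n/4 +
  -- (m+κ)/2, while the exponential term gains κ ≤ 2 derivatives over the norm of order m.
  refine ⟨12 * C + 12, by positivity, fun s hs g hg M hM hgM => ?_⟩
  set G1 : Rn n → ℂ := fun ξ => (Real.exp (-((1 + s) * rad ξ ^ 2)) : ℂ) with hG1
  have e1 : homNorm (m + κ) (fun ξ => (symbolK1 s ξ : ℂ) * g ξ) ≤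
      homNorm (m + κ) (fun ξ => ((12 * Real.exp (-((1 + s) * rad ξ ^ 2)) +
        12 * (Real.exp (-(s / 4)) / (1 + rad ξ ^ 2)) : ℝ) : ℂ) * g ξ) := by
    refine wNorm_le_of_norm_le (Eventually.of_forall fun ξ => ?_)
    rw [norm_mul, norm_mul, Complex.norm_real, Complex.norm_real,
      Real.norm_of_nonneg (symbolK1_nonneg hs ξ), Real.norm_of_nonneg (by positivity)]
    gcongr
    exact (symbolK1_le hs ξ).trans (by rw [mul_add])
  have e2 : homNorm (m + κ) (fun ξ => ((12 * Real.exp (-((1 + s) * rad ξ ^ 2)) +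
        12 * (Real.exp (-(s / 4)) / (1 + rad ξ ^ 2)) : ℝ) : ℂ) * g ξ) ≤
      homNorm (m + κ) (fun ξ => ((12 * Real.exp (-((1 + s) * rad ξ ^ 2)) : ℝ) : ℂ) * g ξ) +
      homNorm (m + κ) (fun ξ => ((12 * (Real.exp (-(s / 4)) / (1 + rad ξ ^ 2)) : ℝ) : ℂ) * g ξ) := by
    have := wNorm_add_le (w := fun ξ : Rn n => rad ξ ^ (m + κ)) (measurable_rad_rpow _)
      (F := fun ξ => ((12 * Real.exp (-((1 + s) * rad ξ ^ 2)) : ℝ) : ℂ) * g ξ)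
      (G := fun ξ => ((12 * (Real.exp (-(s / 4)) / (1 + rad ξ ^ 2)) : ℝ) : ℂ) * g ξ)
      ((Measurable.aestronglyMeasurable (by fun_prop)).mul hg)
      ((Measurable.aestronglyMeasurable (by fun_prop)).mul hg)
    refine le_trans (le_of_eq ?_) this
    rw [homNorm_eq_wNorm]
    congr 1
    ext ξ
    push_cast
    ring
  refine e1.trans (e2.trans (add_le_add ?_ ?_))
  · have : homNorm (m + κ) (fun ξ => ((12 * Real.exp (-((1 + s) * rad ξ ^ 2)) : ℝ) : ℂ) * g ξ) ≤
        ENNReal.ofReal (12 * M) * homNorm (m + κ) G1 := by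
      refine wNorm_le_of_ae (Eventually.of_forall fun ξ => ?_)
      rw [norm_mul, Complex.norm_real, Real.norm_of_nonneg (by positivity), hG1]
      simp only
      rw [Complex.norm_real, Real.norm_of_nonneg (Real.exp_pos _).le]
      calc |rad ξ ^ (m + κ)| * (12 * Real.exp (-((1 + s) * rad ξ ^ 2)) * ‖g ξ‖) ≤
          |rad ξ ^ (m + κ)| * (12 * Real.exp (-((1 + s) * rad ξ ^ 2)) * M) := by
            gcongr; exact hgM ξ
        _ = _ := by ring
    calc _ ≤ ENNReal.ofReal (12 * M) * homNorm (m + κ) G1 := this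
      _ ≤ ENNReal.ofReal (12 * M) *
          ENNReal.ofReal (C * (1 + s) ^ (-((n : ℝ) / 4 + (m + κ) / 2))) := by
          gcongr; exact h (1 + s) (by linarith)
      _ ≤ _ := by
          rw [← ENNReal.ofReal_mul (by positivity)]
          apply ENNReal.ofReal_le_ofReal
          have : 0 ≤ M * (1 + s) ^ (-((n : ℝ) / 4 + (m + κ) / 2)) := by positivity
          nlinarith
  · refine (wNorm_le_of_ae (c := 12 * Real.exp (-(s / 4))) (w' := fun ξ => rad ξ ^ m) (G := g)
      (Eventually.of_forall fun ξ => ?_)).trans ?_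
    · have hr := rad_nonneg ξ
      rw [norm_mul, Complex.norm_real, Real.norm_of_nonneg (by positivity),
        abs_of_nonneg (by positivity), abs_of_nonneg (by positivity),
        Real.rpow_add_of_nonneg hr hm h0]
      have h3 : rad ξ ^ κ / (1 + rad ξ ^ 2) ≤ 1 := by
        rw [div_le_one (by positivity)]; exact rpow_le_one_add_sq hr h0 h2
      calc _ = rad ξ ^ κ / (1 + rad ξ ^ 2) *
            (12 * Real.exp (-(s / 4)) * (rad ξ ^ m * ‖g ξ‖)) := by ring
        _ ≤ 1 * (12 * Real.exp (-(s / 4)) * (rad ξ ^ m * ‖g ξ‖)) := by gcongr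
        _ = _ := one_mul _
    · rw [homNorm_eq_wNorm]
      gcongr
      linarith


/-! ### Decay of the Duhamel term. -/

theorem lintegral_Ioc_one_add_rpow_le {α b : ℝ} (hα : 1 < α) (hb : 0 ≤ b) :
    ∫⁻ τ in Ioc 0 b, ENNReal.ofReal ((1 + τ) ^ (-α)) ≤ ENNReal.ofReal (1 / (α - 1)) := by
  have hc : ContinuousOn (fun τ : ℝ => (1 + τ) ^ (-α)) (uIcc 0 b) := by
    refine ContinuousOn.rpow_const (by fun_prop) fun x hx => Or.inl ?_
    rw [uIcc_of_le hb] at hx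
    linarith [hx.1]
  rw [← ofReal_integral_eq_lintegral_ofReal hc.intervalIntegrable.1 (by
    filter_upwards [ae_restrict_mem measurableSet_Ioc] with τ hτ
    exact Real.rpow_nonneg (by linarith [hτ.1]) _), ← intervalIntegral.integral_of_le hb]
  apply ENNReal.ofReal_le_ofReal
  rw [intervalIntegral.integral_comp_add_left (fun x : ℝ => x ^ (-α)) 1, integral_rpow]
  · have : 0 ≤ (1 + b) ^ (-α + 1) := Real.rpow_nonneg (by linarith) _
    rw [add_zero, Real.one_rpow, ← neg_div_neg_eq,
      show -(-α + 1) = α - 1 by ring]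
    gcongr
    linarith
  · right
    refine ⟨by linarith, ?_⟩
    rw [uIcc_of_le (by linarith)]
    intro h
    linarith [h.1]

/-- The restriction κ < 2 keeps 1 - κ/2 positive, so that the integral grows like a power of its
length, without a logarithm. -/
theorem lintegral_Ioc_one_add_sub_rpow_le {κ a t : ℝ} (hκ : κ < 2) (hat : a ≤ t) :
    ∫⁻ τ in Ioc a t, ENNReal.ofReal ((1 + (t - τ)) ^ (-(κ / 2))) ≤
      ENNReal.ofReal ((1 + (t - a)) ^ (1 - κ / 2) / (1 - κ / 2)) := by
  have hc : ContinuousOn (fun τ : ℝ => (1 + (t - τ)) ^ (-(κ / 2))) (uIcc a t) := by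
    refine ContinuousOn.rpow_const (by fun_prop) fun x hx => Or.inl ?_
    rw [uIcc_of_le hat] at hx
    linarith [hx.2]
  rw [← ofReal_integral_eq_lintegral_ofReal hc.intervalIntegrable.1 (by
    filter_upwards [ae_restrict_mem measurableSet_Ioc] with τ hτ
    exact Real.rpow_nonneg (by linarith [hτ.2]) _), ← intervalIntegral.integral_of_le hat]
  apply ENNReal.ofReal_le_ofReal
  have e : ∀ τ, (1 + (t - τ)) ^ (-(κ / 2)) = ((1 + t) - τ) ^ (-(κ / 2)) := fun τ => by
    congr 1; ring
  simp_rw [e]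
  rw [intervalIntegral.integral_comp_sub_left (fun x : ℝ => x ^ (-(κ / 2))) (1 + t),
    integral_rpow (Or.inl (by linarith)), show -(κ / 2) + 1 = 1 - κ / 2 by ring,
    show 1 + t - a = 1 + (t - a) by ring]
  have : 0 ≤ (1 + t - t) ^ (1 - κ / 2) := Real.rpow_nonneg (by linarith) _
  have h2 : 0 < 1 - κ / 2 := by linarith
  gcongr
  linarith

theorem exists_exp_neg_le_rpow {c γ : ℝ} (hc : 0 < c) (hγ : 0 ≤ γ) :
    ∃ C : ℝ, 0 < C ∧ ∀ t : ℝ, 0 ≤ t → Real.exp (-(c * t)) ≤ C * (1 + t) ^ (-γ) := by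
  obtain ⟨C, hC, h⟩ := exists_rpow_mul_exp_neg_le hγ
  refine ⟨C * Real.exp c / c ^ γ, by positivity, fun t ht => ?_⟩
  have h1 := h (c * (1 + t)) (by positivity)
  rw [Real.mul_rpow hc.le (by linarith)] at h1
  have h2 : Real.exp (-(c * t)) = Real.exp c * Real.exp (-(c * (1 + t))) := by
    rw [← Real.exp_add]; ring_nf
  have h3 : 0 < (1 + t) ^ γ := by positivity
  rw [h2, Real.rpow_neg (by linarith), ← div_eq_mul_inv, le_div_iff₀ h3, le_div_iff₀ (by positivity)]
  have := Real.exp_pos c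
  nlinarith

theorem one_add_half_rpow_le {t γ : ℝ} (ht : 0 ≤ t) (hγ : 0 ≤ γ) {x : ℝ} (hx : t / 2 ≤ x) :
    (1 + x) ^ (-γ) ≤ 2 ^ γ * (1 + t) ^ (-γ) := by
  have h1 : (1 + x) ^ (-γ) ≤ ((1 + t) / 2) ^ (-γ) :=
    Real.rpow_le_rpow_of_nonpos (by linarith) (by linarith) (by linarith)
  refine h1.trans (le_of_eq ?_)
  rw [Real.div_rpow (by linarith) (by norm_num), Real.rpow_neg (x := 2) (by norm_num), div_inv_eq_mul,
    mul_comm]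

/-- The Duhamel term `∫₀ᵗ K₁(t-τ) h(τ) dτ`. -/
noncomputable def duhamel {n : ℕ} (h : ℝ → Rn n → ℂ) (t : ℝ) (ξ : Rn n) : ℂ :=
  ∫ τ in (0 : ℝ)..t, (symbolK1 (t - τ) ξ : ℂ) * h τ ξ

theorem measurable_symbolK1_mul {n : ℕ} {h : ℝ → Rn n → ℂ}
    (hh : Continuous (Function.uncurry h)) (t : ℝ) :
    Measurable (Function.uncurry fun τ ξ => (symbolK1 (t - τ) ξ : ℂ) * h τ ξ) := by
  have h1 : Measurable fun z : ℝ × Rn n => symbolK1 (t - z.1) z.2 :=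
    measurable_symbolK1.comp ((measurable_const.sub measurable_fst).prodMk measurable_snd)
  exact (Complex.measurable_ofReal.comp h1).mul hh.measurable

theorem continuous_symbolK1_mul {n : ℕ} {h : ℝ → Rn n → ℂ}
    (hh : Continuous (Function.uncurry h)) (t : ℝ) (ξ : Rn n) :
    Continuous fun τ => (symbolK1 (t - τ) ξ : ℂ) * h τ ξ := by
  have h1 : Continuous fun τ => symbolK1 (t - τ) ξ :=
    (continuous_symbolK1 ξ).comp (continuous_const.sub continuous_id)
  exact (Complex.continuous_ofReal.comp h1).mul
    (hh.comp (continuous_id.prodMk continuous_const))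

theorem stronglyMeasurable_integral_symbolK1_mul {n : ℕ} {h : ℝ → Rn n → ℂ}
    (hh : Continuous (Function.uncurry h)) (t a b : ℝ) :
    StronglyMeasurable fun ξ => ∫ τ in a..b, (symbolK1 (t - τ) ξ : ℂ) * h τ ξ := by
  have := (measurable_symbolK1_mul hh t).stronglyMeasurable.comp_measurable measurable_swap
  simp only [intervalIntegral]
  exact (this.integral_prod_right' (ν := volume.restrict (Ioc a b))).sub
    (this.integral_prod_right' (ν := volume.restrict (Ioc b a)))

theorem duhamel_split {n : ℕ} {h : ℝ → Rn n → ℂ} (hh : Continuous (Function.uncurry h))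
    (t a : ℝ) : duhamel h t = fun ξ => (∫ τ in (0 : ℝ)..a, (symbolK1 (t - τ) ξ : ℂ) * h τ ξ) +
      ∫ τ in a..t, (symbolK1 (t - τ) ξ : ℂ) * h τ ξ := by
  ext ξ
  exact (intervalIntegral.integral_add_adjacent_intervals
    ((continuous_symbolK1_mul hh t ξ).intervalIntegrable _ _)
    ((continuous_symbolK1_mul hh t ξ).intervalIntegrable _ _)).symm

theorem homNorm_integral_symbolK1_le {n : ℕ} {m κ : ℝ} (hm : 0 ≤ m) (h0 : 0 ≤ κ) (h2 : κ < 2)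
    {h : ℝ → Rn n → ℂ} (hh : Continuous (Function.uncurry h)) {a t B : ℝ} (hat : a ≤ t)
    (hB : 0 ≤ B) (hhB : ∀ τ, a ≤ τ → homNorm m (h τ) ≤ ENNReal.ofReal B) :
    homNorm (m + κ) (fun ξ => ∫ τ in a..t, (symbolK1 (t - τ) ξ : ℂ) * h τ ξ) ≤
      ENNReal.ofReal (60 * B * ((1 + (t - a)) ^ (1 - κ / 2) / (1 - κ / 2))) := by
  refine (wNorm_integral_le (measurable_rad_rpow _) (measurable_symbolK1_mul hh t) hat).trans ?_
  calc _ ≤ ∫⁻ τ in Ioc a t, ENNReal.ofReal (60 * B) *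
        ENNReal.ofReal ((1 + (t - τ)) ^ (-(κ / 2))) := by
        refine setLIntegral_mono' measurableSet_Ioc fun τ hτ => ?_
        refine (homNorm_symbolK1_mul_le (by linarith [hτ.2]) hm h0 h2.le (h τ)).trans ?_
        rw [mul_comm 60 B, ENNReal.ofReal_mul hB, mul_assoc, mul_comm (ENNReal.ofReal B),
          ← ENNReal.ofReal_mul (by norm_num)]
        gcongr
        exact hhB τ hτ.1.le
    _ ≤ ENNReal.ofReal (60 * B) * ENNReal.ofReal ((1 + (t - a)) ^ (1 - κ / 2) / (1 - κ / 2)) := by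
        rw [lintegral_const_mul' _ _ ENNReal.ofReal_ne_top]
        gcongr
        exact lintegral_Ioc_one_add_sub_rpow_le h2 hat
    _ = _ := (ENNReal.ofReal_mul (by positivity)).symm

/-- The part of the Duhamel term near the final time is of lower order. -/
theorem exists_homNorm_duhamel_near_le {n : ℕ} {α m κ : ℝ} (hα : 1 < α) (hm : 0 ≤ m) (h0 : 0 ≤ κ)
    (h2 : κ < 2) : ∃ C : ℝ, 0 < C ∧ ∀ h : ℝ → Rn n → ℂ, Continuous (Function.uncurry h) →
      ∀ A : ℝ, 0 ≤ A →
      (∀ τ, 0 ≤ τ → homNorm m (h τ) ≤ ENNReal.ofReal (A * (1 + τ) ^ (-(α + n / 4 + m / 2)))) →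
      ∀ t, 0 ≤ t →
        homNorm (m + κ) (fun ξ => ∫ τ in (t / 2)..t, (symbolK1 (t - τ) ξ : ℂ) * h τ ξ) ≤
          ENNReal.ofReal (C * A * (1 + t) ^ (1 - α - ((n : ℝ) / 4 + (m + κ) / 2))) := by
  have hκ : 0 < 1 - κ / 2 := by linarith
  refine ⟨60 * 2 ^ (α + n / 4 + m / 2) / (1 - κ / 2), by positivity, fun h hh A hA hhA t ht => ?_⟩
  have hγ : 0 ≤ α + n / 4 + m / 2 := by positivity
  -- For τ ≥ t/2 the bound on h is, up to a constant, the one at time t, and integrating K₁ costs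
  -- (1+t)^{1-κ/2}. Compared with the heat rate, a factor (1+t)^{1-α} remains.
  refine (homNorm_integral_symbolK1_le hm h0 h2 hh (by linarith)
    (B := A * (2 ^ (α + n / 4 + m / 2) * (1 + t) ^ (-(α + n / 4 + m / 2)))) (by positivity)
    fun τ hτ => ?_).trans ?_
  · refine (hhA τ (by linarith)).trans (ENNReal.ofReal_le_ofReal ?_)
    gcongr
    exact one_add_half_rpow_le ht hγ hτ
  · apply ENNReal.ofReal_le_ofReal
    have h3 : (1 + (t - t / 2)) ^ (1 - κ / 2) ≤ (1 + t) ^ (1 - κ / 2) := by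
      apply Real.rpow_le_rpow <;> linarith
    have h4 : (1 + t) ^ (1 - α - ((n : ℝ) / 4 + (m + κ) / 2)) =
        (1 + t) ^ (-(α + n / 4 + m / 2)) * (1 + t) ^ (1 - κ / 2) := by
      rw [← Real.rpow_add (by linarith)]; congr 1; ring
    rw [h4]
    calc _ ≤ 60 * (A * (2 ^ (α + n / 4 + m / 2) * (1 + t) ^ (-(α + n / 4 + m / 2)))) *
          ((1 + t) ^ (1 - κ / 2) / (1 - κ / 2)) := by gcongr
      _ = _ := by ring

/-- The Duhamel term decays like the heat kernel. -/
theorem exists_homNorm_duhamel_le {n : ℕ} {α m κ : ℝ} (hα : 1 < α) (hm : 0 ≤ m) (h0 : 0 ≤ κ)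
    (h2 : κ < 2) : ∃ C : ℝ, 0 < C ∧ ∀ h : ℝ → Rn n → ℂ, Continuous (Function.uncurry h) →
      ∀ A : ℝ, 0 ≤ A → (∀ τ, 0 ≤ τ → ∀ ξ, ‖h τ ξ‖ ≤ A * (1 + τ) ^ (-α)) →
      (∀ τ, 0 ≤ τ → homNorm m (h τ) ≤ ENNReal.ofReal (A * (1 + τ) ^ (-(α + n / 4 + m / 2)))) →
      ∀ t, 0 ≤ t → homNorm (m + κ) (duhamel h t) ≤
          ENNReal.ofReal (C * A * (1 + t) ^ (-((n : ℝ) / 4 + (m + κ) / 2))) := by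
  obtain ⟨C1, hC1, hnear⟩ := exists_homNorm_duhamel_near_le (n := n) hα hm h0 h2
  obtain ⟨C2, hC2, hlin⟩ := exists_homNorm_symbolK1_mul_le (n := n) hm h0 h2.le
  set γ : ℝ := (n : ℝ) / 4 + (m + κ) / 2 with hγ
  have hγ0 : 0 ≤ γ := by positivity
  obtain ⟨C3, hC3, hexp⟩ := exists_exp_neg_le_rpow (c := 1 / 8) (by norm_num) hγ0
  have hα1 : 0 < α - 1 := by linarith
  refine ⟨C1 + C2 * (2 ^ γ + C3) * (1 / (α - 1)), by positivity, fun h hh A hA hhb hhA t ht => ?_⟩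
  have hT : 0 < (1 + t) ^ (-γ) := by positivity
  -- For τ ≤ t/2 the elapsed time t - τ is at least t/2, so K₁(t-τ) supplies the whole decay and the
  -- factor (1+τ)^{-α} is integrated over time.
  have hfar : homNorm (m + κ) (fun ξ => ∫ τ in (0 : ℝ)..(t / 2), (symbolK1 (t - τ) ξ : ℂ) * h τ ξ) ≤
      ENNReal.ofReal (C2 * (2 ^ γ + C3) * (1 / (α - 1)) * A * (1 + t) ^ (-γ)) := by
    refine (wNorm_integral_le (measurable_rad_rpow _) (measurable_symbolK1_mul hh t)
      (by linarith)).trans ?_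
    calc _ ≤ ∫⁻ τ in Ioc 0 (t / 2), ENNReal.ofReal (C2 * (2 ^ γ + C3) * A * (1 + t) ^ (-γ)) *
          ENNReal.ofReal ((1 + τ) ^ (-α)) := by
          refine setLIntegral_mono' measurableSet_Ioc fun τ hτ => ?_
          have hτ0 : 0 < 1 + τ := by linarith [hτ.1]
          have hs : t / 2 ≤ t - τ := by linarith [hτ.2]
          have hb : 0 ≤ A * (1 + τ) ^ (-α) := by positivity
          have hm' := hlin (t - τ) (by linarith) (h τ)
            (hh.comp (Continuous.prodMk_right τ)).aestronglyMeasurable _ hb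
            (hhb τ hτ.1.le)
          refine hm'.trans ?_
          have e1 : homNorm m (h τ) ≤ ENNReal.ofReal (A * (1 + τ) ^ (-α)) := by
            refine (hhA τ hτ.1.le).trans (ENNReal.ofReal_le_ofReal ?_)
            gcongr
            · linarith [hτ.1]
            · have : 0 ≤ (n : ℝ) / 4 + m / 2 := by positivity
              linarith
          have e2 : Real.exp (-((t - τ) / 4)) ≤ C3 * (1 + t) ^ (-γ) := by
            refine le_trans (Real.exp_le_exp.2 ?_) (hexp t ht)
            linarith
          have e3 := one_add_half_rpow_le ht hγ0 hs
          calc _ ≤ ENNReal.ofReal (C2 * (A * (1 + τ) ^ (-α)) * (2 ^ γ * (1 + t) ^ (-γ))) +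
                ENNReal.ofReal (C2 * (C3 * (1 + t) ^ (-γ))) *
                  ENNReal.ofReal (A * (1 + τ) ^ (-α)) := by gcongr
            _ = _ := by
                rw [← ENNReal.ofReal_mul (by positivity), ← ENNReal.ofReal_mul (by positivity),
                  ← ENNReal.ofReal_add (by positivity) (by positivity)]
                congr 1
                ring
      _ ≤ ENNReal.ofReal (C2 * (2 ^ γ + C3) * A * (1 + t) ^ (-γ)) *
          ENNReal.ofReal (1 / (α - 1)) := by
          rw [lintegral_const_mul' _ _ ENNReal.ofReal_ne_top]
          gcongr
          exact lintegral_Ioc_one_add_rpow_le hα (by linarith)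
      _ = _ := by
          rw [← ENNReal.ofReal_mul (by positivity)]
          congr 1
          ring
  have hsplit := wNorm_add_le (w := fun ξ : Rn n => rad ξ ^ (m + κ)) (measurable_rad_rpow _)
    (stronglyMeasurable_integral_symbolK1_mul hh t 0 (t / 2)).aestronglyMeasurable
    (stronglyMeasurable_integral_symbolK1_mul hh t (t / 2) t).aestronglyMeasurable
  rw [duhamel_split hh t (t / 2)]
  refine hsplit.trans ((add_le_add hfar (hnear h hh A hA hhA t ht)).trans ?_)
  have e4 : (1 + t) ^ (1 - α - γ) ≤ (1 + t) ^ (-γ) :=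
    Real.rpow_le_rpow_of_exponent_le (by linarith) (by linarith)
  rw [← ENNReal.ofReal_add (by positivity) (by positivity)]
  apply ENNReal.ofReal_le_ofReal
  calc _ ≤ C2 * (2 ^ γ + C3) * (1 / (α - 1)) * A * (1 + t) ^ (-γ) + C1 * A * (1 + t) ^ (-γ) := by
        gcongr
    _ = _ := by ring


/-! ### The nonlinear term along curves in H¹. -/

/-- The nonlinear term, as a complex-valued function of the real part of the state. -/
noncomputable def nonlin {n : ℕ} (f : ℝ → ℝ) (U : Rn n → ℂ) : Rn n → ℂ :=
  fun x => ((f (U x).re : ℝ) : ℂ)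

theorem aestronglyMeasurable_nonlin {n : ℕ} {f : ℝ → ℝ} (hf : Continuous f) {U : Rn n → ℂ}
    (hU : AEStronglyMeasurable U volume) : AEStronglyMeasurable (nonlin f U) volume :=
  (Complex.continuous_ofReal.comp (hf.comp Complex.continuous_re)).comp_aestronglyMeasurable hU

theorem isL2Fourier_zero {n : ℕ} : IsL2Fourier (fun _ : Rn n => (0 : ℂ)) (fun _ => 0) := by
  refine ⟨0, (Lp.coeFn_zero _ _ _).symm, ?_⟩
  have : 𝓕 (0 : Lp ℂ 2 (volume : Measure (Rn n))) = 0 := (Lp.fourierTransformₗᵢ (Rn n) ℂ).map_zero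
  rw [this]
  exact (Lp.coeFn_zero _ _ _).symm

theorem nonlin_zero {n : ℕ} {p : ℝ} (hp : 0 < p) {f : ℝ → ℝ} (hf : IsPowerNonlinearity p f) :
    nonlin (n := n) f (fun _ => 0) = fun _ => 0 := by
  ext x
  simp [nonlin, hf.map_zero hp]

/-- The cases m = 1 and m = 2 of the L^m estimate. On the Fourier side the first bounds the
transform uniformly and the second, by Plancherel, bounds it in L². -/
theorem exists_nonlin_sub_le {n : ℕ} (hn : 0 < n) (hn2 : n ≤ 2) {p : ℝ} (hp : 2 < p) {f : ℝ → ℝ}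
    (hf : IsPowerNonlinearity p f) :
    ∃ C : ℝ, 0 < C ∧ ∀ U F W G : Rn n → ℂ, IsL2Fourier U F → IsL2Fourier W G →
      ∀ T A B : ℝ, 0 < T → 0 ≤ A → 0 ≤ B → energy T F ≤ ENNReal.ofReal A →
        energy T G ≤ ENNReal.ofReal A → energy T (fun ξ => F ξ - G ξ) ≤ ENNReal.ofReal B →
        eLpNorm (fun x => nonlin f U x - nonlin f W x) 1 volume ≤
          ENNReal.ofReal (C * T ^ (-(n * (p - 2) / 4)) * A ^ (p - 1) * B) ∧
        eLpNorm (fun x => nonlin f U x - nonlin f W x) 2 volume ≤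
          ENNReal.ofReal (C * T ^ (-(n * (p - 1) / 4)) * A ^ (p - 1) * B) := by
  obtain ⟨C1, hC1, h1⟩ := exists_lintegral_nonlinearity_sub_le hn hn2 hp (le_refl 1) hf
  obtain ⟨C2, hC2, h2⟩ := exists_lintegral_nonlinearity_sub_le hn hn2 hp (m := 2) (by norm_num) hf
  refine ⟨max C1 C2, by positivity, fun U F W G hU hW T A B hT hA hB hFA hGA hFG => ⟨?_, ?_⟩⟩
  · have := h1 U F W G hU hW T A B hT hA hB hFA hGA hFG
    simp only [Real.rpow_one] at this
    rw [eLpNorm_one_eq_lintegral_enorm]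
    refine le_trans (le_of_eq ?_) (this.trans (ENNReal.ofReal_le_ofReal ?_))
    · congr 1
      ext x
      rw [nonlin, nonlin, ← Complex.ofReal_sub, ← ofReal_norm, Complex.norm_real, Real.norm_eq_abs]
    · rw [show -((n : ℝ) * (p / 4 - 1 / (2 * 1))) = -(n * (p - 2) / 4) by ring]
      gcongr
      exact le_max_left _ _
  · have := h2 U F W G hU hW T A B hT hA hB hFA hGA hFG
    simp only [Real.rpow_two] at this
    rw [← ENNReal.pow_le_pow_left_iff two_ne_zero, eLpNorm_two_sq]
    rw [ENNReal.ofReal_pow (by positivity)] at this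
    refine le_trans (le_of_eq ?_) (this.trans ?_)
    · congr 1
      ext x
      rw [nonlin, nonlin, ← Complex.ofReal_sub, ← ofReal_norm, Complex.norm_real, Real.norm_eq_abs,
        ENNReal.ofReal_pow (abs_nonneg _)]
    · gcongr ?_ ^ 2
      apply ENNReal.ofReal_le_ofReal
      rw [show -((n : ℝ) * (p / 4 - 1 / (2 * 2))) = -(n * (p - 1) / 4) by ring]
      gcongr
      exact le_max_right _ _

/-- Comparison with the zero function, using f(0) = 0. -/
theorem exists_nonlin_le {n : ℕ} (hn : 0 < n) (hn2 : n ≤ 2) {p : ℝ} (hp : 2 < p) {f : ℝ → ℝ}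
    (hf : IsPowerNonlinearity p f) :
    ∃ C : ℝ, 0 < C ∧ ∀ U F : Rn n → ℂ, IsL2Fourier U F →
      ∀ T A : ℝ, 0 < T → 0 ≤ A → energy T F ≤ ENNReal.ofReal A →
        eLpNorm (nonlin f U) 1 volume ≤ ENNReal.ofReal (C * T ^ (-(n * (p - 2) / 4)) * A ^ p) ∧
        eLpNorm (nonlin f U) 2 volume ≤ ENNReal.ofReal (C * T ^ (-(n * (p - 1) / 4)) * A ^ p) := by
  obtain ⟨C, hC, h⟩ := exists_nonlin_sub_le hn hn2 hp hf
  refine ⟨C, hC, fun U F hU T A hT hA hFA => ?_⟩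
  have e0 : energy T (fun _ : Rn n => (0 : ℂ)) ≤ ENNReal.ofReal A := by
    simp [energy, wNorm]
  have := h U F _ _ hU isL2Fourier_zero T A A hT hA hA hFA e0 (by simpa using hFA)
  rw [nonlin_zero (by linarith) hf] at this
  simp only [sub_zero] at this
  have hA' : A ^ p = A ^ (p - 1) * A := by
    rcases hA.eq_or_lt with rfl | hA
    · rw [Real.zero_rpow (by linarith), mul_zero]
    · nth_rewrite 3 [← Real.rpow_one A]
      rw [← Real.rpow_add hA]; congr 1; ring
  rw [hA', ← mul_assoc, ← mul_assoc]
  exact this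

theorem memLp_nonlin {n : ℕ} (hn : 0 < n) (hn2 : n ≤ 2) {p : ℝ} (hp : 2 < p) {f : ℝ → ℝ}
    (hf : IsPowerNonlinearity p f) {U F : Rn n → ℂ} (hU : IsL2Fourier U F) (hF : energy 1 F < ∞) :
    Integrable (nonlin f U) ∧ MemLp (nonlin f U) 2 := by
  obtain ⟨C, hC, h⟩ := exists_nonlin_le hn hn2 hp hf
  have hm := aestronglyMeasurable_nonlin hf.1.continuous hU.memLp_left.1
  have := h U F hU 1 _ one_pos ENNReal.toReal_nonneg (ENNReal.ofReal_toReal hF.ne).ge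
  exact ⟨memLp_one_iff_integrable.1 ⟨hm, this.1.trans_lt ENNReal.ofReal_lt_top⟩,
    hm, this.2.trans_lt ENNReal.ofReal_lt_top⟩

theorem norm_fourier_le_of_eLpNorm {n : ℕ} {U : Rn n → ℂ} (hU : AEStronglyMeasurable U volume)
    {M : ℝ} (hM : 0 ≤ M) (h : eLpNorm U 1 volume ≤ ENNReal.ofReal M) (ξ : Rn n) : ‖𝓕 U ξ‖ ≤ M := by
  refine (norm_fourier_le_integral U ξ).trans ?_
  rw [integral_norm_eq_lintegral_enorm hU, ← eLpNorm_one_eq_lintegral_enorm]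
  exact ENNReal.toReal_le_of_le_ofReal hM h

/-- The Lipschitz bounds for the nonlinear term on the Fourier side. -/
theorem exists_fourier_nonlin_sub_le {n : ℕ} (hn : 0 < n) (hn2 : n ≤ 2) {p : ℝ} (hp : 2 < p)
    {f : ℝ → ℝ} (hf : IsPowerNonlinearity p f) :
    ∃ C : ℝ, 0 < C ∧ ∀ U F W G : Rn n → ℂ, IsL2Fourier U F → IsL2Fourier W G →
      energy 1 F < ∞ → energy 1 G < ∞ →
      ∀ T A B : ℝ, 0 < T → 0 ≤ A → 0 ≤ B → energy T F ≤ ENNReal.ofReal A →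
        energy T G ≤ ENNReal.ofReal A → energy T (fun ξ => F ξ - G ξ) ≤ ENNReal.ofReal B →
        (∀ ξ, ‖𝓕 (nonlin f U) ξ - 𝓕 (nonlin f W) ξ‖ ≤
          C * T ^ (-(n * (p - 2) / 4)) * A ^ (p - 1) * B) ∧
        eLpNorm (fun ξ => 𝓕 (nonlin f U) ξ - 𝓕 (nonlin f W) ξ) 2 volume ≤
          ENNReal.ofReal (C * T ^ (-(n * (p - 1) / 4)) * A ^ (p - 1) * B) := by
  obtain ⟨C, hC, h⟩ := exists_nonlin_sub_le hn hn2 hp hf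
  refine ⟨C, hC, fun U F W G hU hW hF1 hG1 T A B hT hA hB hFA hGA hFG => ?_⟩
  obtain ⟨h1, h2⟩ := h U F W G hU hW T A B hT hA hB hFA hGA hFG
  obtain ⟨iU, mU⟩ := memLp_nonlin hn hn2 hp hf hU hF1
  obtain ⟨iW, mW⟩ := memLp_nonlin hn hn2 hp hf hW hG1
  refine ⟨fun ξ => ?_, ?_⟩
  · rw [← fourier_sub_of_integrable iU iW]
    exact norm_fourier_le_of_eLpNorm (iU.1.sub iW.1) (by positivity) h1 ξ
  · rw [← ((IsL2Fourier.of_integrable iU mU).sub (IsL2Fourier.of_integrable iW mW)).eLpNorm_eq]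
    exact h2

/-- A continuous curve in `H¹`, given by functions and their transforms. -/
structure IsH1Curve {n : ℕ} (U F : ℝ → Rn n → ℂ) : Prop where
  isL2Fourier : ∀ t, 0 ≤ t → IsL2Fourier (U t) (F t)
  energy_lt_top : ∀ t, 0 ≤ t → energy 1 (F t) < ∞
  tendsto : ∀ t, 0 ≤ t →
    Tendsto (fun s => energy 1 (fun ξ => F s ξ - F t ξ)) (𝓝[Ici 0] t) (𝓝 0)

/-- The transform of the nonlinear term along a curve, extended to negative times. -/
noncomputable def nonlinHat {n : ℕ} (f : ℝ → ℝ) (U : ℝ → Rn n → ℂ) (τ : ℝ) : Rn n → ℂ :=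
  𝓕 (nonlin f (U (max τ 0)))

theorem measurable_energy_weight {n : ℕ} (T : ℝ) :
    Measurable fun ξ : Rn n => 1 + Real.sqrt T * rad ξ := by fun_prop

theorem energy_le_add_energy_sub {n : ℕ} {T : ℝ} {F G : Rn n → ℂ}
    (hF : AEStronglyMeasurable F volume) (hG : AEStronglyMeasurable G volume) :
    energy T F ≤ energy T G + energy T (fun ξ => F ξ - G ξ) := by
  refine le_trans (le_of_eq ?_) (wNorm_add_le (measurable_energy_weight T) hG (hF.sub hG))
  congr 1
  ext ξ
  simp

/-- Along a curve in `H¹` the nonlinear term is continuous in `L¹`. -/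
theorem IsH1Curve.tendsto_nonlin_sub {n : ℕ} (hn : 0 < n) (hn2 : n ≤ 2) {p : ℝ} (hp : 2 < p)
    {f : ℝ → ℝ} (hf : IsPowerNonlinearity p f) {U F : ℝ → Rn n → ℂ} (h : IsH1Curve U F) (t : ℝ) :
    Tendsto (fun s => eLpNorm (fun x => nonlin f (U (max s 0)) x - nonlin f (U (max t 0)) x) 1 volume)
      (𝓝 t) (𝓝 0) := by
  obtain ⟨C, hC, hN⟩ := exists_nonlin_sub_le hn hn2 hp hf
  have hpos : ∀ t : ℝ, 0 ≤ max t 0 := fun t => le_max_right _ _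
  have hmax : Tendsto (fun s : ℝ => max s 0) (𝓝 t) (𝓝[Ici 0] (max t 0)) :=
    tendsto_nhdsWithin_iff.2 ⟨(continuous_id.max continuous_const).tendsto t,
      Eventually.of_forall hpos⟩
  have he := (h.tendsto _ (hpos t)).comp hmax
  -- For s close to t the energies at both times are at most A, so the Lipschitz bound at scale T =
  -- 1 applies with a fixed constant.
  set A : ℝ := (energy 1 (F (max t 0))).toReal + 1 with hA
  have hA0 : 0 ≤ A := by positivity
  have hFt : energy 1 (F (max t 0)) ≤ ENNReal.ofReal A := by
    rw [hA, ENNReal.ofReal_add (by positivity) one_pos.le,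
      ENNReal.ofReal_toReal (h.energy_lt_top _ (hpos t)).ne]
    exact le_self_add
  have h1 : Tendsto (fun s : ℝ => ENNReal.ofReal (C * A ^ (p - 1) *
      (energy 1 (fun ξ => F (max s 0) ξ - F (max t 0) ξ)).toReal)) (𝓝 t) (𝓝 0) := by
    have := ((ENNReal.tendsto_toReal ENNReal.zero_ne_top).comp he).const_mul (C * A ^ (p - 1))
    rw [ENNReal.toReal_zero, mul_zero] at this
    have := (ENNReal.continuous_ofReal.tendsto 0).comp this
    rwa [ENNReal.ofReal_zero] at this
  refine tendsto_of_tendsto_of_tendsto_of_le_of_le' tendsto_const_nhds h1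
    (Eventually.of_forall fun _ => zero_le) ?_
  filter_upwards [he.eventually (gt_mem_nhds (show (0 : ℝ≥0∞) < 1 by norm_num))] with s hs
  have hs' : energy 1 (fun ξ => F (max s 0) ξ - F (max t 0) ξ) < 1 := hs
  have hFs : energy 1 (F (max s 0)) ≤ ENNReal.ofReal A := by
    refine (energy_le_add_energy_sub (h.isL2Fourier _ (hpos s)).memLp_right.1
      (h.isL2Fourier _ (hpos t)).memLp_right.1).trans ?_
    rw [hA, ENNReal.ofReal_add (by positivity) one_pos.le,
      ENNReal.ofReal_toReal (h.energy_lt_top _ (hpos t)).ne, ENNReal.ofReal_one]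
    gcongr
  have := (hN _ _ _ _ (h.isL2Fourier _ (hpos s)) (h.isL2Fourier _ (hpos t)) 1 A _ one_pos hA0
    ENNReal.toReal_nonneg hFs hFt
    (ENNReal.ofReal_toReal (hs'.trans ENNReal.one_lt_top).ne).ge).1
  rwa [Real.one_rpow, mul_one] at this

theorem IsH1Curve.integrable_nonlin {n : ℕ} (hn : 0 < n) (hn2 : n ≤ 2) {p : ℝ} (hp : 2 < p)
    {f : ℝ → ℝ} (hf : IsPowerNonlinearity p f) {U F : ℝ → Rn n → ℂ} (h : IsH1Curve U F) (t : ℝ) :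
    Integrable (nonlin f (U (max t 0))) :=
  (memLp_nonlin hn hn2 hp hf (h.isL2Fourier _ (le_max_right _ _))
    (h.energy_lt_top _ (le_max_right _ _))).1

theorem IsH1Curve.continuous_integral_norm_nonlin {n : ℕ} (hn : 0 < n) (hn2 : n ≤ 2) {p : ℝ}
    (hp : 2 < p) {f : ℝ → ℝ} (hf : IsPowerNonlinearity p f) {U F : ℝ → Rn n → ℂ}
    (h : IsH1Curve U F) : Continuous fun t => ∫ x, ‖nonlin f (U (max t 0)) x‖ := by
  refine continuous_iff_continuousAt.2 fun t => ?_
  have h1 := (ENNReal.tendsto_toReal ENNReal.zero_ne_top).comp (h.tendsto_nonlin_sub hn hn2 hp hf t)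
  have hi := h.integrable_nonlin hn hn2 hp hf
  refine tendsto_iff_norm_sub_tendsto_zero.2 (squeeze_zero (fun _ => norm_nonneg _) (fun s => ?_) h1)
  have hst : Integrable fun x => nonlin f (U (max s 0)) x - nonlin f (U (max t 0)) x :=
    (hi s).sub (hi t)
  simp only [Function.comp_apply]
  rw [eLpNorm_one_eq_lintegral_enorm, ← integral_norm_eq_lintegral_enorm hst.1,
    ← integral_sub (hi s).norm (hi t).norm]
  refine (norm_integral_le_integral_norm _).trans (integral_mono ((hi s).norm.sub (hi t).norm).norm
    hst.norm fun x => ?_)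
  exact abs_norm_sub_norm_le _ _

/-- Continuity of f(u) in L¹ makes its transform continuous in time uniformly in ξ; together with
continuity in ξ at a fixed time this is joint continuity. The extension to negative times makes it
hold on the whole product space, as the Duhamel estimates require. -/
theorem IsH1Curve.continuous_nonlinHat {n : ℕ} (hn : 0 < n) (hn2 : n ≤ 2) {p : ℝ} (hp : 2 < p)
    {f : ℝ → ℝ} (hf : IsPowerNonlinearity p f) {U F : ℝ → Rn n → ℂ} (h : IsH1Curve U F) :
    Continuous (Function.uncurry (nonlinHat f U)) := by
  have hi := h.integrable_nonlin hn hn2 hp hf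
  rw [continuous_iff_continuousAt]
  rintro ⟨t, ξ⟩
  have hcont : Continuous (nonlinHat f U t) := continuous_fourier_of_integrable (hi t)
  have h1 := (ENNReal.tendsto_toReal ENNReal.zero_ne_top).comp (h.tendsto_nonlin_sub hn hn2 hp hf t)
  have hb (s : ℝ) (η : Rn n) : ‖nonlinHat f U s η - nonlinHat f U t η‖ ≤
      (eLpNorm (fun x => nonlin f (U (max s 0)) x - nonlin f (U (max t 0)) x) 1 volume).toReal := by
    rw [nonlinHat, nonlinHat, ← fourier_sub_of_integrable (hi s) (hi t)]
    have hL : Integrable fun x => nonlin f (U (max s 0)) x - nonlin f (U (max t 0)) x :=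
      (hi s).sub (hi t)
    exact norm_fourier_le_of_eLpNorm hL.1 ENNReal.toReal_nonneg
      (ENNReal.ofReal_toReal (memLp_one_iff_integrable.2 hL).2.ne).ge η
  have hlim : Tendsto (fun z : ℝ × Rn n => nonlinHat f U z.1 z.2 - nonlinHat f U t z.2)
      (𝓝 (t, ξ)) (𝓝 0) :=
    squeeze_zero_norm (fun z => hb z.1 z.2) (h1.comp (continuous_fst.tendsto (t, ξ)))
  have h3 : Tendsto (fun z : ℝ × Rn n => nonlinHat f U t z.2) (𝓝 (t, ξ))
      (𝓝 (nonlinHat f U t ξ)) := (hcont.comp continuous_snd).tendsto (t, ξ)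
  have := hlim.add h3
  simpa [ContinuousAt, Function.uncurry_def] using this


/-! ### The integral equation and its continuity in time. -/

/-- The right-hand side of the integral equation, on the Fourier side. -/
noncomputable def mild {n : ℕ} (φ ψ : Rn n → ℂ) (h : ℝ → Rn n → ℂ) (t : ℝ) (ξ : Rn n) : ℂ :=
  (Real.exp (-t) : ℂ) * φ ξ + (symbolK1 t ξ : ℂ) * ψ ξ + duhamel h t ξ

theorem continuous_duhamel_apply {n : ℕ} {h : ℝ → Rn n → ℂ}
    (hh : Continuous (Function.uncurry h)) (ξ : Rn n) : Continuous fun t => duhamel h t ξ := by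
  have h1 : Continuous fun z : ℝ × ℝ => (symbolK1 (z.1 - z.2) ξ : ℂ) * h z.2 ξ :=
    (Complex.continuous_ofReal.comp ((continuous_symbolK1 ξ).comp
      (continuous_fst.sub continuous_snd))).mul (hh.comp (continuous_snd.prodMk continuous_const))
  exact intervalIntegral.continuous_parametric_intervalIntegral_of_continuous
    (f := fun t τ => (symbolK1 (t - τ) ξ : ℂ) * h τ ξ) (a₀ := 0) h1 continuous_id

theorem continuous_mild_apply {n : ℕ} (φ ψ : Rn n → ℂ) {h : ℝ → Rn n → ℂ}
    (hh : Continuous (Function.uncurry h)) (ξ : Rn n) : Continuous fun t => mild φ ψ h t ξ := by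
  refine Continuous.add (Continuous.add ?_ ?_) (continuous_duhamel_apply hh ξ)
  · fun_prop
  · exact (Complex.continuous_ofReal.comp (continuous_symbolK1 ξ)).mul continuous_const

theorem aestronglyMeasurable_mild {n : ℕ} {φ ψ : Rn n → ℂ} (hφ : AEStronglyMeasurable φ volume)
    (hψ : AEStronglyMeasurable ψ volume) {h : ℝ → Rn n → ℂ}
    (hh : Continuous (Function.uncurry h)) (t : ℝ) :
    AEStronglyMeasurable (mild φ ψ h t) volume := by
  have hK : Measurable fun ξ : Rn n => (symbolK1 t ξ : ℂ) :=
    Complex.measurable_ofReal.comp (measurable_symbolK1.comp (measurable_const.prodMk measurable_id))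
  exact ((aestronglyMeasurable_const.mul hφ).add (hK.aestronglyMeasurable.mul hψ)).add
    (stronglyMeasurable_integral_symbolK1_mul hh t 0 t).aestronglyMeasurable

/-- An envelope for `mild φ ψ h s`, `0 ≤ s ≤ T`. -/
noncomputable def mildBound {n : ℕ} (φ ψ : Rn n → ℂ) (h : ℝ → Rn n → ℂ) (T : ℝ) (ξ : Rn n) : ℝ≥0∞ :=
  ‖φ ξ‖ₑ + ENNReal.ofReal (24 / (1 + rad ξ ^ 2)) * ‖ψ ξ‖ₑ +
    ∫⁻ τ in Ioc 0 T, ENNReal.ofReal (24 / (1 + rad ξ ^ 2)) * ‖h τ ξ‖ₑ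

theorem enorm_symbolK1_le {n : ℕ} {t : ℝ} (ht : 0 ≤ t) (ξ : Rn n) :
    ‖(symbolK1 t ξ : ℂ)‖ₑ ≤ ENNReal.ofReal (24 / (1 + rad ξ ^ 2)) := by
  rw [← ofReal_norm, Complex.norm_real, Real.norm_of_nonneg (symbolK1_nonneg ht ξ)]
  exact ENNReal.ofReal_le_ofReal (symbolK1_le_div ht ξ)

theorem enorm_mild_le {n : ℕ} (φ ψ : Rn n → ℂ) (h : ℝ → Rn n → ℂ) {s T : ℝ} (hs : 0 ≤ s)
    (hsT : s ≤ T) (ξ : Rn n) : ‖mild φ ψ h s ξ‖ₑ ≤ mildBound φ ψ h T ξ := by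
  refine (enorm_add_le _ _).trans (add_le_add ((enorm_add_le _ _).trans (add_le_add ?_ ?_)) ?_)
  · rw [enorm_mul]
    refine mul_le_of_le_one_left' ?_
    rw [← ofReal_norm, Complex.norm_real, Real.norm_of_nonneg (Real.exp_pos _).le]
    exact ENNReal.ofReal_le_one.2 (Real.exp_le_one_iff.2 (by linarith))
  · rw [enorm_mul]
    gcongr
    exact enorm_symbolK1_le hs ξ
  · rw [duhamel, intervalIntegral.integral_of_le hs]
    refine (enorm_integral_le_lintegral_enorm _).trans ?_
    refine (setLIntegral_mono' measurableSet_Ioc fun τ hτ => ?_).trans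
      (lintegral_mono_set (Ioc_subset_Ioc_right hsT))
    rw [enorm_mul]
    gcongr
    exact enorm_symbolK1_le (by linarith [hτ.2]) ξ

/-- Each hypothesis puts one term of the envelope in weighted L², Minkowski handling the time
integral. The weights on ψ and h are two orders weaker than the weight on φ: that is the gain from
K₁. -/
theorem eLpNorm_mildBound_lt_top {n : ℕ} {φ ψ : Rn n → ℂ} {h : ℝ → Rn n → ℂ} {w : Rn n → ℝ}
    (hw : Measurable w) (hφ : AEStronglyMeasurable φ volume) (hψ : AEStronglyMeasurable ψ volume)
    (hh : Continuous (Function.uncurry h)) {T : ℝ} (h1 : wNorm w φ < ∞)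
    (h2 : wNorm (fun ξ => w ξ * (24 / (1 + rad ξ ^ 2))) ψ < ∞)
    (h3 : ∫⁻ τ in Ioc 0 T, wNorm (fun ξ => w ξ * (24 / (1 + rad ξ ^ 2))) (h τ) < ∞) :
    eLpNorm (fun ξ => ‖(w ξ : ℂ)‖ₑ * mildBound φ ψ h T ξ) 2 volume < ∞ := by
  have hwm : Measurable fun ξ : Rn n => ‖(w ξ : ℂ)‖ₑ := (Complex.measurable_ofReal.comp hw).enorm
  have hKm : Measurable fun ξ : Rn n => ENNReal.ofReal (24 / (1 + rad ξ ^ 2)) := by fun_prop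
  have hhm : Measurable (Function.uncurry fun (τ : ℝ) (ξ : Rn n) =>
      ‖(w ξ : ℂ)‖ₑ * (ENNReal.ofReal (24 / (1 + rad ξ ^ 2)) * ‖h τ ξ‖ₑ)) :=
    (hwm.comp measurable_snd).mul ((hKm.comp measurable_snd).mul hh.measurable.enorm)
  have heq : (fun ξ => ‖(w ξ : ℂ)‖ₑ * mildBound φ ψ h T ξ) =
      ((fun ξ => ‖(w ξ : ℂ)‖ₑ * ‖φ ξ‖ₑ) +
        (fun ξ => ‖(w ξ : ℂ)‖ₑ * (ENNReal.ofReal (24 / (1 + rad ξ ^ 2)) * ‖ψ ξ‖ₑ))) +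
        fun ξ => ∫⁻ τ in Ioc 0 T,
          ‖(w ξ : ℂ)‖ₑ * (ENNReal.ofReal (24 / (1 + rad ξ ^ 2)) * ‖h τ ξ‖ₑ) := by
    ext ξ
    simp only [mildBound, Pi.add_apply, mul_add]
    congr 1
    exact (lintegral_const_mul' _ _ enorm_ne_top).symm
  have hm1 : AEMeasurable (fun ξ => ‖(w ξ : ℂ)‖ₑ * ‖φ ξ‖ₑ) volume := hwm.aemeasurable.mul hφ.enorm
  have hm2 : AEMeasurable (fun ξ => ‖(w ξ : ℂ)‖ₑ *
      (ENNReal.ofReal (24 / (1 + rad ξ ^ 2)) * ‖ψ ξ‖ₑ)) volume :=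
    hwm.aemeasurable.mul (hKm.aemeasurable.mul hψ.enorm)
  have hm3 : Measurable (fun ξ => ∫⁻ τ in Ioc 0 T,
      ‖(w ξ : ℂ)‖ₑ * (ENNReal.ofReal (24 / (1 + rad ξ ^ 2)) * ‖h τ ξ‖ₑ)) :=
    (hhm.comp measurable_swap).lintegral_prod_right'
  have hen : ∀ (ξ : Rn n) (z : ℂ), ‖(w ξ : ℂ)‖ₑ * (ENNReal.ofReal (24 / (1 + rad ξ ^ 2)) * ‖z‖ₑ) =
      ‖((w ξ * (24 / (1 + rad ξ ^ 2)) : ℝ) : ℂ) * z‖ₑ := fun ξ z => by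
    rw [Complex.ofReal_mul, enorm_mul, enorm_mul, ← ofReal_norm ((24 / (1 + rad ξ ^ 2) : ℝ) : ℂ),
      Complex.norm_real, Real.norm_of_nonneg (by positivity), mul_assoc]
  rw [heq]
  refine (eLpNorm_add_le (hm1.add hm2).aestronglyMeasurable hm3.aestronglyMeasurable
    (by norm_num)).trans_lt (ENNReal.add_lt_top.2 ⟨(eLpNorm_add_le hm1.aestronglyMeasurable
      hm2.aestronglyMeasurable (by norm_num)).trans_lt (ENNReal.add_lt_top.2 ⟨?_, ?_⟩), ?_⟩)
  · have : eLpNorm (fun ξ => ‖(w ξ : ℂ)‖ₑ * ‖φ ξ‖ₑ) 2 volume = wNorm w φ := by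
      simp_rw [← enorm_mul]; exact eLpNorm_enorm _
    rwa [this]
  · simp_rw [hen]
    rw [eLpNorm_enorm]
    exact h2
  · refine (eLpNorm_lintegral_le hhm).trans_lt ?_
    refine lt_of_eq_of_lt ?_ h3
    congr 1
    ext τ
    simp_rw [hen]
    exact eLpNorm_enorm _

theorem wNorm_mild_lt_top {n : ℕ} {φ ψ : Rn n → ℂ} {h : ℝ → Rn n → ℂ} {w : Rn n → ℝ} {T : ℝ}
    (hb : eLpNorm (fun ξ => ‖(w ξ : ℂ)‖ₑ * mildBound φ ψ h T ξ) 2 volume < ∞) {t : ℝ}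
    (ht : 0 ≤ t) (htT : t ≤ T) : wNorm w (mild φ ψ h t) < ∞ := by
  refine lt_of_le_of_lt (eLpNorm_mono_enorm fun ξ => ?_) hb
  rw [enorm_mul, enorm_eq_self]
  gcongr
  exact enorm_mild_le φ ψ h ht htT ξ

/-- Dominated convergence in `L²`. -/
theorem tendsto_eLpNorm_sub_of_dominated {n : ℕ} {G : ℝ → Rn n → ℂ} {t : ℝ} (ht : 0 ≤ t)
    (hG : ∀ s, 0 ≤ s → AEStronglyMeasurable (G s) volume) {b : Rn n → ℝ≥0∞}
    (hb : eLpNorm b 2 volume < ∞) (hle : ∀ s, 0 ≤ s → s ≤ t + 1 → ∀ ξ, ‖G s ξ‖ₑ ≤ b ξ)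
    (hc : ∀ ξ, Tendsto (fun s => G s ξ) (𝓝[Ici 0] t) (𝓝 (G t ξ))) :
    Tendsto (fun s => eLpNorm (fun ξ => G s ξ - G t ξ) 2 volume) (𝓝[Ici 0] t) (𝓝 0) := by
  have hsq : Tendsto (fun s => ∫⁻ ξ, ‖G s ξ - G t ξ‖ₑ ^ 2) (𝓝[Ici 0] t)
      (𝓝 (∫⁻ _ : Rn n, 0)) := by
    refine tendsto_lintegral_filter_of_dominated_convergence'
      (fun ξ => (2 * b ξ) ^ 2) ?_ ?_ ?_ ?_
    · filter_upwards [self_mem_nhdsWithin] with s hs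
      exact ((hG s hs).sub (hG t ht)).enorm.pow_const 2
    · have h1 : ∀ᶠ s in 𝓝[Ici 0] t, s < t + 1 :=
        nhdsWithin_le_nhds (gt_mem_nhds (by linarith))
      filter_upwards [h1, self_mem_nhdsWithin] with s hs hs0
      refine Eventually.of_forall fun ξ => ?_
      gcongr
      rw [two_mul]
      exact (enorm_sub_le).trans (add_le_add (hle s hs0 hs.le ξ) (hle t ht (by linarith) ξ))
    · simp_rw [mul_pow]
      rw [lintegral_const_mul' _ _ (by norm_num)]
      refine (ENNReal.mul_lt_top (by norm_num) ?_).ne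
      have := ENNReal.pow_lt_top hb (n := 2)
      rw [eLpNorm_two_sq] at this
      simpa [mul_pow] using this
    · refine Eventually.of_forall fun ξ => ?_
      have h1 : Tendsto (fun s => G s ξ - G t ξ) (𝓝[Ici 0] t) (𝓝 0) := by
        simpa using (hc ξ).sub_const (G t ξ)
      have h2 := ((ENNReal.continuous_pow 2).comp (continuous_enorm (E := ℂ))).tendsto 0 |>.comp h1
      simpa [Function.comp_def] using h2
  rw [lintegral_zero] at hsq
  have h2 := (ENNReal.continuous_rpow_const (y := (1 / 2 : ℝ))).tendsto 0 |>.comp hsq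
  rw [ENNReal.zero_rpow_of_pos (by norm_num)] at h2
  refine h2.congr fun s => ?_
  simp only [Function.comp_apply]
  rw [← eLpNorm_two_sq, ← ENNReal.rpow_natCast, ← ENNReal.rpow_mul]
  norm_num

/-- Continuity in time of the right-hand side of the integral equation, in weighted norms. -/
theorem tendsto_eLpNorm_mild_sub {n : ℕ} {φ ψ : Rn n → ℂ} {h : ℝ → Rn n → ℂ} {w : ℝ → Rn n → ℝ}
    {v : Rn n → ℝ} {t : ℝ} (hw : ∀ s, Measurable (w s))
    (hwc : ∀ ξ, ContinuousOn (fun s => w s ξ) (Ici 0))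
    (hwv : ∀ s, 0 ≤ s → s ≤ t + 1 → ∀ ξ, |w s ξ| ≤ |v ξ|)
    (hφ : AEStronglyMeasurable φ volume) (hψ : AEStronglyMeasurable ψ volume)
    (hh : Continuous (Function.uncurry h))
    (hb : eLpNorm (fun ξ => ‖(v ξ : ℂ)‖ₑ * mildBound φ ψ h (t + 1) ξ) 2 volume < ∞) (ht : 0 ≤ t) :
    Tendsto (fun s => eLpNorm (fun ξ => (w s ξ : ℂ) * mild φ ψ h s ξ -
      (w t ξ : ℂ) * mild φ ψ h t ξ) 2 volume) (𝓝[Ici 0] t) (𝓝 0) := by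
  refine tendsto_eLpNorm_sub_of_dominated (G := fun s ξ => (w s ξ : ℂ) * mild φ ψ h s ξ) ht
    (fun s _ => ((Complex.measurable_ofReal.comp (hw s)).aestronglyMeasurable).mul
          (aestronglyMeasurable_mild hφ hψ hh s)) hb (fun s hs hs' ξ => ?_) fun ξ => ?_
  · rw [enorm_mul]
    refine mul_le_mul' ?_ (enorm_mild_le φ ψ h hs hs' ξ)
    rw [← ofReal_norm, ← ofReal_norm, Complex.norm_real, Complex.norm_real]
    exact ENNReal.ofReal_le_ofReal (hwv s hs hs' ξ)
  · exact ((Complex.continuous_ofReal.tendsto _).comp (hwc ξ t ht)).mul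
      ((continuous_mild_apply φ ψ hh ξ).tendsto t |>.mono_left nhdsWithin_le_nhds)

/-! ### Uniqueness in C([0,∞); H¹). -/

/-- Continuity bounds the energy locally, and compactness of [0, T] globalises the bound. -/
theorem IsH1Curve.exists_energy_le {n : ℕ} {U F : ℝ → Rn n → ℂ} (h : IsH1Curve U F) (T : ℝ) :
    ∃ A : ℝ, 0 ≤ A ∧ ∀ t ∈ Icc 0 T, energy 1 (F t) ≤ ENNReal.ofReal A := by
  refine (isCompact_Icc (a := (0 : ℝ)) (b := T)).induction_on
    (p := fun s => ∃ A : ℝ, 0 ≤ A ∧ ∀ t ∈ s, energy 1 (F t) ≤ ENNReal.ofReal A) ⟨0, le_rfl, by simp⟩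
    ?_ ?_ ?_
  · rintro s s' hss ⟨A, hA, h'⟩
    exact ⟨A, hA, fun t ht => h' t (hss ht)⟩
  · rintro s s' ⟨A, hA, h1⟩ ⟨B, hB, h2⟩
    refine ⟨max A B, le_max_of_le_left hA, fun t ht => ?_⟩
    rcases ht with ht | ht
    · exact (h1 t ht).trans (ENNReal.ofReal_le_ofReal (le_max_left _ _))
    · exact (h2 t ht).trans (ENNReal.ofReal_le_ofReal (le_max_right _ _))
  · intro t ht
    have hev := (h.tendsto t ht.1).eventually (gt_mem_nhds (show (0 : ℝ≥0∞) < 1 by norm_num))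
    refine ⟨{s | 0 ≤ s ∧ energy 1 (fun ξ => F s ξ - F t ξ) < 1}, ?_, (energy 1 (F t)).toReal + 1,
      by positivity, fun s hs => ?_⟩
    · refine nhdsWithin_mono t (fun x hx => hx.1) ?_
      exact inter_mem self_mem_nhdsWithin hev
    · refine (energy_le_add_energy_sub (h.isL2Fourier s hs.1).memLp_right.1
        (h.isL2Fourier t ht.1).memLp_right.1).trans ?_
      rw [ENNReal.ofReal_add (by positivity) one_pos.le,
        ENNReal.ofReal_toReal (h.energy_lt_top _ ht.1).ne, ENNReal.ofReal_one]
      gcongr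
      exact hs.2.le

/-- The two derivatives gained by K₁ make it bounded from L² to H¹ uniformly in time, with no
singularity at t = 0; hence a Gronwall argument with a constant kernel is enough for uniqueness. -/
theorem energy_one_symbolK1_mul_le {n : ℕ} {t : ℝ} (ht : 0 ≤ t) (g : Rn n → ℂ) :
    energy 1 (fun ξ => (symbolK1 t ξ : ℂ) * g ξ) ≤ ENNReal.ofReal 48 * eLpNorm g 2 volume := by
  rw [← wNorm_one]
  refine wNorm_le_of_ae (Eventually.of_forall fun ξ => ?_)
  have hr := rad_nonneg ξ
  have h1 := symbolK1_le_div ht ξ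
  have h0 := symbolK1_nonneg ht ξ
  rw [norm_mul, Complex.norm_real, Real.norm_of_nonneg h0, Real.sqrt_one, one_mul,
    abs_of_nonneg (by positivity), abs_one, one_mul, ← mul_assoc]
  gcongr
  calc (1 + rad ξ) * symbolK1 t ξ ≤ (1 + rad ξ) * (24 / (1 + rad ξ ^ 2)) := by gcongr
    _ ≤ 48 := by
      rw [← mul_div_assoc, div_le_iff₀ (by positivity)]
      nlinarith [sq_nonneg (rad ξ - 1)]

theorem duhamel_sub {n : ℕ} {h h' : ℝ → Rn n → ℂ} (hh : Continuous (Function.uncurry h))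
    (hh' : Continuous (Function.uncurry h')) (t : ℝ) (ξ : Rn n) :
    duhamel h t ξ - duhamel h' t ξ = duhamel (fun τ ξ => h τ ξ - h' τ ξ) t ξ := by
  rw [duhamel, duhamel, ← intervalIntegral.integral_sub
    ((continuous_symbolK1_mul hh t ξ).intervalIntegrable _ _)
    ((continuous_symbolK1_mul hh' t ξ).intervalIntegrable _ _), duhamel]
  simp_rw [mul_sub]

/-- Uniqueness of mild solutions in `C([0,∞); H¹)`. -/
theorem IsH1Curve.ae_eq_of_mild {n : ℕ} (hn : 0 < n) (hn2 : n ≤ 2) {p : ℝ} (hp : 2 < p)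
    {f : ℝ → ℝ} (hf : IsPowerNonlinearity p f) {U F V G : ℝ → Rn n → ℂ} (h : IsH1Curve U F)
    (h' : IsH1Curve V G) {φ ψ : Rn n → ℂ}
    (hF : ∀ t, 0 ≤ t → F t =ᵐ[volume] mild φ ψ (nonlinHat f U) t)
    (hG : ∀ t, 0 ≤ t → G t =ᵐ[volume] mild φ ψ (nonlinHat f V) t) {T : ℝ} (hT : 0 ≤ T) :
    F T =ᵐ[volume] G T := by
  obtain ⟨C, hC, hN⟩ := exists_fourier_nonlin_sub_le hn hn2 hp hf
  obtain ⟨A1, hA1, hFA⟩ := h.exists_energy_le T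
  obtain ⟨A2, hA2, hGA⟩ := h'.exists_energy_le T
  have hcF := h.continuous_nonlinHat hn hn2 hp hf
  have hcG := h'.continuous_nonlinHat hn hn2 hp hf
  set A := max A1 A2 with hA
  have hA0 : 0 ≤ A := le_max_of_le_left hA1
  set y : ℝ → ℝ≥0∞ := fun t => energy 1 (fun ξ => F t ξ - G t ξ) with hy
  have hFA' : ∀ t ∈ Icc 0 T, energy 1 (F t) ≤ ENNReal.ofReal A := fun t ht =>
    (hFA t ht).trans (ENNReal.ofReal_le_ofReal (le_max_left _ _))
  have hGA' : ∀ t ∈ Icc 0 T, energy 1 (G t) ≤ ENNReal.ofReal A := fun t ht =>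
    (hGA t ht).trans (ENNReal.ofReal_le_ofReal (le_max_right _ _))
  have hyb : ∀ t ∈ Icc 0 T, y t ≤ ENNReal.ofReal (2 * A) := fun t ht => by
    refine (wNorm_sub_le (measurable_energy_weight 1) (h.isL2Fourier t ht.1).memLp_right.1
      (h'.isL2Fourier t ht.1).memLp_right.1).trans ?_
    rw [two_mul, ENNReal.ofReal_add hA0 hA0]
    exact add_le_add (hFA' t ht) (hGA' t ht)
  set L : ℝ := 48 * (C * A ^ (p - 1)) + 1 with hL
  have hL0 : 0 < L := by positivity
  have hint : ∀ t ∈ Icc 0 T, y t ≤ ENNReal.ofReal L * ∫⁻ τ in Ioc 0 t, y τ := by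
    intro t ht
    have e1 : y t = energy 1 (duhamel (fun τ ξ => nonlinHat f U τ ξ - nonlinHat f V τ ξ) t) := by
      refine wNorm_congr ?_
      filter_upwards [hF t ht.1, hG t ht.1] with ξ h1 h2
      rw [h1, h2, ← duhamel_sub hcF hcG, mild, mild]
      ring
    have hcs : Continuous (Function.uncurry fun τ ξ => nonlinHat f U τ ξ - nonlinHat f V τ ξ) :=
      hcF.sub hcG
    rw [e1]
    refine (wNorm_integral_le (measurable_energy_weight 1) (measurable_symbolK1_mul hcs t)
      ht.1).trans ?_
    rw [← lintegral_const_mul' _ _ ENNReal.ofReal_ne_top]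
    refine setLIntegral_mono' measurableSet_Ioc fun τ hτ => ?_
    have hτ' : τ ∈ Icc 0 T := ⟨hτ.1.le, hτ.2.trans ht.2⟩
    refine (energy_one_symbolK1_mul_le (by linarith [hτ.2]) _).trans ?_
    have h3 := (hN _ _ _ _ (h.isL2Fourier τ hτ'.1) (h'.isL2Fourier τ hτ'.1)
      (h.energy_lt_top τ hτ'.1) (h'.energy_lt_top τ hτ'.1) 1 A (y τ).toReal one_pos hA0
      ENNReal.toReal_nonneg (hFA' τ hτ') (hGA' τ hτ')
      (ENNReal.ofReal_toReal ((hyb τ hτ').trans_lt ENNReal.ofReal_lt_top).ne).ge).2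
    rw [Real.one_rpow, mul_one, ENNReal.ofReal_mul (by positivity),
      ENNReal.ofReal_toReal ((hyb τ hτ').trans_lt ENNReal.ofReal_lt_top).ne] at h3
    simp only [nonlinHat, max_eq_left hτ'.1]
    refine (mul_le_mul_right h3 _).trans ?_
    rw [← mul_assoc, ← ENNReal.ofReal_mul (by norm_num)]
    gcongr
    rw [hL]
    linarith
  -- Gronwall through an exponential weight: with rate 2L the integral inequality gives S ≤ S/2, and
  -- since S is finite it vanishes. Only monotonicity is used for the integral of y, so y need not
  -- be measurable.
  set S : ℝ≥0∞ := ⨆ t ∈ Icc 0 T, ENNReal.ofReal (Real.exp (-(2 * L * t))) * y t with hS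
  have hStop : S < ∞ := by
    refine lt_of_le_of_lt (iSup₂_le fun t ht => ?_) (ENNReal.ofReal_lt_top (r := 2 * A))
    refine le_trans ?_ (hyb t ht)
    refine mul_le_of_le_one_left' (ENNReal.ofReal_le_one.2 (Real.exp_le_one_iff.2 ?_))
    have := ht.1
    nlinarith
  have hyS : ∀ t ∈ Icc 0 T, y t ≤ ENNReal.ofReal (Real.exp (2 * L * t)) * S := fun t ht => by
    have h1 : ENNReal.ofReal (Real.exp (-(2 * L * t))) * y t ≤ S :=
      le_iSup₂ (f := fun t _ => ENNReal.ofReal (Real.exp (-(2 * L * t))) * y t) t ht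
    calc y t = ENNReal.ofReal (Real.exp (2 * L * t)) *
          (ENNReal.ofReal (Real.exp (-(2 * L * t))) * y t) := by
          rw [← mul_assoc, ← ENNReal.ofReal_mul (Real.exp_pos _).le, ← Real.exp_add]
          simp
      _ ≤ _ := by gcongr
  have hSS : S ≤ ENNReal.ofReal (1 / 2) * S := by
    refine iSup₂_le fun t ht => ?_
    have h2 : ∫⁻ τ in Ioc 0 t, y τ ≤
        ENNReal.ofReal (Real.exp (2 * L * t) / (2 * L)) * S := by
      calc ∫⁻ τ in Ioc 0 t, y τ ≤ ∫⁻ τ in Ioc 0 t, ENNReal.ofReal (Real.exp (2 * L * τ)) * S :=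
            setLIntegral_mono' measurableSet_Ioc fun τ hτ => hyS τ ⟨hτ.1.le, hτ.2.trans ht.2⟩
        _ = (∫⁻ τ in Ioc 0 t, ENNReal.ofReal (Real.exp (2 * L * τ))) * S :=
            lintegral_mul_const' _ _ hStop.ne
        _ ≤ _ := by
            gcongr
            have hci : Continuous fun τ : ℝ => Real.exp (2 * L * τ) := by fun_prop
            rw [← ofReal_integral_eq_lintegral_ofReal
              (hci.intervalIntegrable 0 t).1 (Eventually.of_forall fun τ => (Real.exp_pos _).le),
              ← intervalIntegral.integral_of_le ht.1]
            apply ENNReal.ofReal_le_ofReal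
            rw [intervalIntegral.integral_comp_mul_left (fun x => Real.exp x) (by positivity),
              integral_exp, smul_eq_mul, div_eq_inv_mul]
            gcongr
            linarith [Real.exp_pos (2 * L * 0)]
    calc _ ≤ ENNReal.ofReal (Real.exp (-(2 * L * t))) * (ENNReal.ofReal L *
          (ENNReal.ofReal (Real.exp (2 * L * t) / (2 * L)) * S)) := by
          gcongr
          exact (hint t ht).trans (by gcongr)
      _ = _ := by
          rw [← mul_assoc, ← mul_assoc, ← ENNReal.ofReal_mul (by positivity),
            ← ENNReal.ofReal_mul (by positivity)]
          congr 2
          rw [Real.exp_neg]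
          have := Real.exp_pos (2 * L * t)
          field_simp
  have hS0 : S = 0 := by
    by_contra hne
    have h3 : ENNReal.ofReal (1 / 2) * S < 1 * S :=
      ENNReal.mul_lt_mul_left hne hStop.ne (by rw [ENNReal.ofReal_lt_one]; norm_num)
    rw [one_mul] at h3
    exact absurd hSS (not_le.2 h3)
  have hyT : y T = 0 := by
    have := hyS T ⟨hT, le_rfl⟩
    rw [hS0, mul_zero] at this
    exact le_antisymm this zero_le
  have hsub := ((h.isL2Fourier T hT).sub (h'.isL2Fourier T hT)).memLp_right
  have hz : eLpNorm (fun ξ => F T ξ - G T ξ) 2 volume = 0 := by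
    refine le_antisymm ?_ zero_le
    rw [← hyT, ← wNorm_one]
    refine (wNorm_mono _ (c := 1) fun ξ => ?_).trans_eq (by rw [ENNReal.ofReal_one, one_mul])
    have := rad_nonneg ξ
    rw [abs_one, abs_of_nonneg (by positivity), Real.sqrt_one]
    linarith
  rw [eLpNorm_eq_zero_iff hsub.1 (by norm_num)] at hz
  filter_upwards [hz] with ξ hξ using sub_eq_zero.1 hξ


/-! ### Decay in the scaled energy. -/

theorem energy_le_homNorm {n : ℕ} {T : ℝ} {G : Rn n → ℂ} (hG : AEStronglyMeasurable G volume) :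
    energy T G ≤ homNorm 0 G + ENNReal.ofReal (Real.sqrt T) * homNorm 1 G := by
  have h1 : Measurable fun ξ : Rn n => Real.sqrt T * rad ξ := by fun_prop
  refine (wNorm_add_weight_le measurable_const h1 hG).trans (add_le_add ?_ ?_)
  · rw [wNorm_one, homNorm_zero_eq]
  · rw [homNorm_eq_wNorm]
    refine wNorm_mono G fun ξ => ?_
    rw [Real.rpow_one, abs_mul, abs_of_nonneg (Real.sqrt_nonneg T)]

/-- The factor √(1+t) in the energy compensates exactly the extra half power in the decay of the
first derivative. -/
theorem energy_le_of_homNorm_le {n : ℕ} {t B : ℝ} (ht : 0 ≤ t) (hB : 0 ≤ B) {G : Rn n → ℂ}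
    (hG : AEStronglyMeasurable G volume)
    (h0 : homNorm 0 G ≤ ENNReal.ofReal (B * (1 + t) ^ (-((n : ℝ) / 4))))
    (h1 : homNorm 1 G ≤ ENNReal.ofReal (B * (1 + t) ^ (-((n : ℝ) / 4 + 1 / 2)))) :
    energy (1 + t) G ≤ ENNReal.ofReal (2 * B * (1 + t) ^ (-((n : ℝ) / 4))) := by
  have ht1 : 0 < 1 + t := by linarith
  calc energy (1 + t) G ≤ homNorm 0 G + ENNReal.ofReal (Real.sqrt (1 + t)) * homNorm 1 G :=
        energy_le_homNorm hG
    _ ≤ ENNReal.ofReal (B * (1 + t) ^ (-((n : ℝ) / 4))) + ENNReal.ofReal (Real.sqrt (1 + t)) *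
        ENNReal.ofReal (B * (1 + t) ^ (-((n : ℝ) / 4 + 1 / 2))) := by gcongr
    _ = _ := by
        rw [← ENNReal.ofReal_mul (by positivity), ← ENNReal.ofReal_add (by positivity)
          (by positivity)]
        congr 1
        have : Real.sqrt (1 + t) * (1 + t) ^ (-((n : ℝ) / 4 + 1 / 2)) =
            (1 + t) ^ (-((n : ℝ) / 4)) := by
          rw [Real.sqrt_eq_rpow, ← Real.rpow_add ht1]; congr 1; ring
        calc _ = B * (1 + t) ^ (-((n : ℝ) / 4)) +
              B * (Real.sqrt (1 + t) * (1 + t) ^ (-((n : ℝ) / 4 + 1 / 2))) := by ring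
          _ = _ := by rw [this]; ring

/-- Decay of the Duhamel term in the scaled `H¹` norm. -/
theorem exists_energy_duhamel_le {n : ℕ} {α : ℝ} (hα : 1 < α) :
    ∃ C : ℝ, 0 < C ∧ ∀ h : ℝ → Rn n → ℂ, Continuous (Function.uncurry h) →
      ∀ A : ℝ, 0 ≤ A → (∀ τ, 0 ≤ τ → ∀ ξ, ‖h τ ξ‖ ≤ A * (1 + τ) ^ (-α)) →
      (∀ τ, 0 ≤ τ → eLpNorm (h τ) 2 volume ≤ ENNReal.ofReal (A * (1 + τ) ^ (-(α + n / 4)))) →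
      ∀ t, 0 ≤ t → energy (1 + t) (duhamel h t) ≤
          ENNReal.ofReal (C * A * (1 + t) ^ (-((n : ℝ) / 4))) := by
  obtain ⟨C0, hC0, h0⟩ := exists_homNorm_duhamel_le (n := n) hα le_rfl le_rfl (κ := 0) (by norm_num)
  obtain ⟨C1, hC1, h1⟩ := exists_homNorm_duhamel_le (n := n) hα le_rfl (κ := 1) (by norm_num)
    (by norm_num)
  refine ⟨2 * max C0 C1, by positivity, fun h hh A hA hb hA2 t ht => ?_⟩
  have hA2' : ∀ τ, 0 ≤ τ → homNorm 0 (h τ) ≤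
      ENNReal.ofReal (A * (1 + τ) ^ (-(α + n / 4 + 0 / 2))) := fun τ hτ => by
    rw [homNorm_zero_eq]; simpa using hA2 τ hτ
  have e0 := h0 h hh A hA hb hA2' t ht
  have e1 := h1 h hh A hA hb hA2' t ht
  have hm : AEStronglyMeasurable (duhamel h t) volume :=
    (stronglyMeasurable_integral_symbolK1_mul hh t 0 t).aestronglyMeasurable
  refine (energy_le_of_homNorm_le ht (B := max C0 C1 * A) (by positivity) hm ?_ ?_).trans_eq ?_
  · rw [add_zero] at e0
    refine e0.trans (ENNReal.ofReal_le_ofReal ?_)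
    rw [zero_div, add_zero]
    gcongr
    exact le_max_left _ _
  · rw [zero_add] at e1
    refine e1.trans (ENNReal.ofReal_le_ofReal ?_)
    gcongr
    exact le_max_right _ _
  · congr 1; ring

theorem homNorm_add_le {n : ℕ} (k : ℝ) {F G : Rn n → ℂ}
    (hF : AEStronglyMeasurable F volume) (hG : AEStronglyMeasurable G volume) :
    homNorm k (fun ξ => F ξ + G ξ) ≤ homNorm k F + homNorm k G :=
  wNorm_add_le (measurable_rad_rpow k) hF hG

/-- Decay of the linear part of the solution. -/
theorem exists_homNorm_linear_le {n : ℕ} {k : ℝ} (h0 : 0 ≤ k) (h2 : k ≤ 2) :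
    ∃ C : ℝ, 0 < C ∧ ∀ φ ψ : Rn n → ℂ, AEStronglyMeasurable φ volume →
      AEStronglyMeasurable ψ volume → ∀ δ : ℝ, 0 ≤ δ → homNorm k φ ≤ ENNReal.ofReal δ →
      (∀ ξ, ‖ψ ξ‖ ≤ δ) → eLpNorm ψ 2 volume ≤ ENNReal.ofReal δ → ∀ t, 0 ≤ t →
      homNorm k (fun ξ => (Real.exp (-t) : ℂ) * φ ξ + (symbolK1 t ξ : ℂ) * ψ ξ) ≤
        ENNReal.ofReal (C * δ * (1 + t) ^ (-((n : ℝ) / 4 + k / 2))) := by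
  obtain ⟨C, hC, h⟩ := exists_homNorm_symbolK1_mul_le (n := n) (le_refl 0) h0 h2
  obtain ⟨C2, hC2, he⟩ := exists_exp_neg_le_rpow (c := 1 / 4) (γ := (n : ℝ) / 4 + k / 2)
    (by norm_num) (by positivity)
  refine ⟨C2 + C + C * C2, by positivity, fun φ ψ hφ hψ δ hδ hφδ hψb hψδ t ht => ?_⟩
  have hT : 0 < (1 + t) ^ (-((n : ℝ) / 4 + k / 2)) := by positivity
  have het := he t ht
  have hK : Measurable fun ξ : Rn n => (symbolK1 t ξ : ℂ) :=
    Complex.measurable_ofReal.comp (measurable_symbolK1.comp (measurable_const.prodMk measurable_id))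
  have e1 : homNorm k (fun ξ => (Real.exp (-t) : ℂ) * φ ξ) ≤
      ENNReal.ofReal (C2 * δ * (1 + t) ^ (-((n : ℝ) / 4 + k / 2))) := by
    calc homNorm k (fun ξ => (Real.exp (-t) : ℂ) * φ ξ) ≤
          ENNReal.ofReal (Real.exp (-t)) * homNorm k φ := by
          refine wNorm_le_of_ae (Eventually.of_forall fun ξ => ?_)
          rw [norm_mul, Complex.norm_real, Real.norm_of_nonneg (Real.exp_pos _).le]
          exact le_of_eq (by ring)
      _ ≤ ENNReal.ofReal (C2 * (1 + t) ^ (-((n : ℝ) / 4 + k / 2))) * ENNReal.ofReal δ := by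
          gcongr
          refine le_trans (Real.exp_le_exp.2 ?_) het
          linarith
      _ = _ := by
          rw [← ENNReal.ofReal_mul (by positivity)]; congr 1; ring
  have e2 := h t ht ψ hψ δ hδ hψb
  rw [zero_add, homNorm_zero_eq] at e2
  calc _ ≤ _ := homNorm_add_le k (aestronglyMeasurable_const.mul hφ)
        (hK.aestronglyMeasurable.mul hψ)
    _ ≤ ENNReal.ofReal (C2 * δ * (1 + t) ^ (-((n : ℝ) / 4 + k / 2))) +
        (ENNReal.ofReal (C * δ * (1 + t) ^ (-((n : ℝ) / 4 + k / 2))) +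
          ENNReal.ofReal (C * (C2 * (1 + t) ^ (-((n : ℝ) / 4 + k / 2)))) * ENNReal.ofReal δ) := by
        refine add_le_add e1 (e2.trans ?_)
        gcongr
        refine le_trans (Real.exp_le_exp.2 ?_) het
        linarith
    _ = _ := by
        rw [← ENNReal.ofReal_mul (by positivity), ← ENNReal.ofReal_add (by positivity)
          (by positivity), ← ENNReal.ofReal_add (by positivity) (by positivity)]
        congr 1
        ring

theorem exists_energy_linear_le {n : ℕ} :
    ∃ C : ℝ, 0 < C ∧ ∀ φ ψ : Rn n → ℂ, AEStronglyMeasurable φ volume →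
      AEStronglyMeasurable ψ volume → ∀ δ : ℝ, 0 ≤ δ → energy 1 φ ≤ ENNReal.ofReal δ →
      (∀ ξ, ‖ψ ξ‖ ≤ δ) → eLpNorm ψ 2 volume ≤ ENNReal.ofReal δ → ∀ t, 0 ≤ t →
      energy (1 + t) (fun ξ => (Real.exp (-t) : ℂ) * φ ξ + (symbolK1 t ξ : ℂ) * ψ ξ) ≤
        ENNReal.ofReal (C * δ * (1 + t) ^ (-((n : ℝ) / 4))) := by
  obtain ⟨C0, hC0, h0⟩ := exists_homNorm_linear_le (n := n) (k := 0) le_rfl (by norm_num)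
  obtain ⟨C1, hC1, h1⟩ := exists_homNorm_linear_le (n := n) (k := 1) (by norm_num) (by norm_num)
  refine ⟨2 * max C0 C1, by positivity, fun φ ψ hφ hψ δ hδ hφδ hψb hψδ t ht => ?_⟩
  have hφk : ∀ k : ℝ, 0 ≤ k → k ≤ 1 → homNorm k φ ≤ ENNReal.ofReal δ := fun k hk hk1 => by
    have := homNorm_le_energy hk hk1 one_pos φ
    rw [Real.one_rpow, ENNReal.ofReal_one, one_mul] at this
    exact this.trans hφδ
  have e0 := h0 φ ψ hφ hψ δ hδ (hφk 0 le_rfl zero_le_one) hψb hψδ t ht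
  have e1 := h1 φ ψ hφ hψ δ hδ (hφk 1 zero_le_one le_rfl) hψb hψδ t ht
  have hK : Measurable fun ξ : Rn n => (symbolK1 t ξ : ℂ) :=
    Complex.measurable_ofReal.comp (measurable_symbolK1.comp (measurable_const.prodMk measurable_id))
  refine (energy_le_of_homNorm_le ht (B := max C0 C1 * δ) (by positivity)
    ((aestronglyMeasurable_const.mul hφ).add (hK.aestronglyMeasurable.mul hψ)) ?_ ?_).trans_eq ?_
  · refine e0.trans (ENNReal.ofReal_le_ofReal ?_)
    rw [zero_div, add_zero]
    gcongr
    exact le_max_left _ _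
  · refine e1.trans (ENNReal.ofReal_le_ofReal ?_)
    gcongr
    exact le_max_right _ _
  · congr 1; ring

/-- Bookkeeping of rates: p factors of size T^{-n/4} multiply T^{-a}. It is used with a = n(p-2)/4
for the L¹ bound and a = n(p-1)/4 for the L² bound, giving n(p-1)/2 and n(p-1)/2 + n/4. -/
theorem mul_rpow_pow_eq {n : ℕ} {p T R B c a β : ℝ} (hT : 0 < T) (hR : 0 ≤ R)
    (hβ : a + n * p / 4 = β) :
    c * T ^ (-a) * (R * T ^ (-((n : ℝ) / 4))) ^ (p - 1) * (B * T ^ (-((n : ℝ) / 4))) =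
      c * R ^ (p - 1) * B * T ^ (-β) := by
  rw [Real.mul_rpow hR (by positivity), ← Real.rpow_mul hT.le,
    show -β = -a + (-((n : ℝ) / 4)) * (p - 1) + -((n : ℝ) / 4) by rw [← hβ]; ring,
    Real.rpow_add hT, Real.rpow_add hT]
  ring

/-- Time decay of the difference of the nonlinear terms along decaying curves. -/
theorem exists_nonlinHat_sub_le {n : ℕ} (hn : 0 < n) (hn2 : n ≤ 2) {p : ℝ} (hp : 2 < p)
    {f : ℝ → ℝ} (hf : IsPowerNonlinearity p f) :
    ∃ C : ℝ, 0 < C ∧ ∀ U F V G : ℝ → Rn n → ℂ, IsH1Curve U F → IsH1Curve V G →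
      ∀ R B : ℝ, 0 ≤ R → 0 ≤ B →
      (∀ t, 0 ≤ t → energy (1 + t) (F t) ≤ ENNReal.ofReal (R * (1 + t) ^ (-((n : ℝ) / 4)))) →
      (∀ t, 0 ≤ t → energy (1 + t) (G t) ≤ ENNReal.ofReal (R * (1 + t) ^ (-((n : ℝ) / 4)))) →
      (∀ t, 0 ≤ t → energy (1 + t) (fun ξ => F t ξ - G t ξ) ≤
        ENNReal.ofReal (B * (1 + t) ^ (-((n : ℝ) / 4)))) →
      (∀ τ, 0 ≤ τ → ∀ ξ, ‖nonlinHat f U τ ξ - nonlinHat f V τ ξ‖ ≤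
        C * R ^ (p - 1) * B * (1 + τ) ^ (-(n * (p - 1) / 2))) ∧
      (∀ τ, 0 ≤ τ → eLpNorm (fun ξ => nonlinHat f U τ ξ - nonlinHat f V τ ξ) 2 volume ≤
        ENNReal.ofReal (C * R ^ (p - 1) * B * (1 + τ) ^ (-(n * (p - 1) / 2 + n / 4)))) := by
  obtain ⟨C, hC, h⟩ := exists_fourier_nonlin_sub_le hn hn2 hp hf
  refine ⟨C, hC, fun U F V G hU hV R B hR hB hF hG hFG => ?_⟩
  have key : ∀ τ : ℝ, 0 ≤ τ → _ := fun τ hτ =>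
    have hτ1 : 0 < 1 + τ := by linarith
    h _ _ _ _ (hU.isL2Fourier τ hτ) (hV.isL2Fourier τ hτ) (hU.energy_lt_top τ hτ)
      (hV.energy_lt_top τ hτ) (1 + τ) (R * (1 + τ) ^ (-((n : ℝ) / 4)))
      (B * (1 + τ) ^ (-((n : ℝ) / 4))) hτ1 (by positivity) (by positivity) (hF τ hτ) (hG τ hτ)
      (hFG τ hτ)
  constructor
  · intro τ hτ ξ
    have := (key τ hτ).1 ξ
    rw [mul_rpow_pow_eq (by linarith) hR (β := n * (p - 1) / 2) (by ring)] at this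
    simpa only [nonlinHat, max_eq_left hτ] using this
  · intro τ hτ
    have := (key τ hτ).2
    rw [mul_rpow_pow_eq (by linarith) hR (β := n * (p - 1) / 2 + n / 4) (by ring)] at this
    simpa only [nonlinHat, max_eq_left hτ] using this

theorem isH1Curve_zero {n : ℕ} : IsH1Curve (fun _ (_ : Rn n) => (0 : ℂ)) (fun _ _ => 0) where
  isL2Fourier _ _ := isL2Fourier_zero
  energy_lt_top _ _ := by simp [wNorm]
  tendsto _ _ := by simpa [wNorm] using tendsto_const_nhds

theorem fourier_zero_fun {n : ℕ} : 𝓕 (fun _ : Rn n => (0 : ℂ)) = fun _ => 0 := by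
  ext ξ
  simp [Real.fourier_eq]

theorem exists_nonlinHat_le {n : ℕ} (hn : 0 < n) (hn2 : n ≤ 2) {p : ℝ} (hp : 2 < p)
    {f : ℝ → ℝ} (hf : IsPowerNonlinearity p f) :
    ∃ C : ℝ, 0 < C ∧ ∀ U F : ℝ → Rn n → ℂ, IsH1Curve U F → ∀ R : ℝ, 0 ≤ R →
      (∀ t, 0 ≤ t → energy (1 + t) (F t) ≤ ENNReal.ofReal (R * (1 + t) ^ (-((n : ℝ) / 4)))) →
      (∀ τ, 0 ≤ τ → ∀ ξ, ‖nonlinHat f U τ ξ‖ ≤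
        C * R ^ (p - 1) * R * (1 + τ) ^ (-(n * (p - 1) / 2))) ∧
      (∀ τ, 0 ≤ τ → eLpNorm (nonlinHat f U τ) 2 volume ≤
        ENNReal.ofReal (C * R ^ (p - 1) * R * (1 + τ) ^ (-(n * (p - 1) / 2 + n / 4)))) := by
  obtain ⟨C, hC, h⟩ := exists_nonlinHat_sub_le hn hn2 hp hf
  refine ⟨C, hC, fun U F hU R hR hF => ?_⟩
  have := h U F _ _ hU isH1Curve_zero R R hR hR hF (fun t ht => by simp [wNorm])
    (fun t ht => by simpa using hF t ht)
  have hz : ∀ τ, nonlinHat f (fun _ (_ : Rn n) => (0 : ℂ)) τ = fun _ => 0 := fun τ => by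
    rw [nonlinHat, nonlin_zero (by linarith) hf, fourier_zero_fun]
  simpa only [hz, sub_zero] using this


/-! ### The weighted space in which the equation is solved. -/

/-- The weight of the energy space at time `t`, including the expected rate of decay. -/
noncomputable def decayWeight (n : ℕ) (t : ℝ) (ξ : Rn n) : ℝ :=
  (1 + max t 0) ^ ((n : ℝ) / 4) * (1 + Real.sqrt (1 + max t 0) * rad ξ)

theorem decayWeight_pos {n : ℕ} (t : ℝ) (ξ : Rn n) : 0 < decayWeight n t ξ := by
  have h : 0 ≤ max t 0 := le_max_right _ _
  have := rad_nonneg ξ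
  unfold decayWeight
  positivity

theorem measurable_decayWeight {n : ℕ} (t : ℝ) : Measurable (decayWeight n t) := by
  unfold decayWeight; fun_prop

theorem continuous_decayWeight {n : ℕ} (ξ : Rn n) : Continuous fun t => decayWeight n t ξ := by
  unfold decayWeight
  refine Continuous.mul (Continuous.rpow_const (by fun_prop) fun t => Or.inl ?_) (by fun_prop)
  have h : 0 ≤ max t 0 := le_max_right _ _
  positivity

theorem decayWeight_mono {n : ℕ} {s t : ℝ} (h : s ≤ t) (ξ : Rn n) :
    decayWeight n s ξ ≤ decayWeight n t ξ := by
  have h1 : 0 ≤ max s 0 := le_max_right _ _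
  have h2 : max s 0 ≤ max t 0 := max_le_max_right _ h
  have := rad_nonneg ξ
  unfold decayWeight
  gcongr

theorem one_add_rad_le_decayWeight {n : ℕ} (t : ℝ) (ξ : Rn n) :
    1 + rad ξ ≤ decayWeight n t ξ := by
  have h1 : 0 ≤ max t 0 := le_max_right _ _
  have h2 : 1 ≤ (1 + max t 0) ^ ((n : ℝ) / 4) := Real.one_le_rpow (by linarith) (by positivity)
  have h3 : 1 ≤ Real.sqrt (1 + max t 0) := Real.one_le_sqrt.2 (by linarith)
  have := rad_nonneg ξ
  calc 1 + rad ξ = 1 * (1 + 1 * rad ξ) := by ring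
    _ ≤ _ := by unfold decayWeight; gcongr

theorem wNorm_decayWeight_le {n : ℕ} (t : ℝ) (G : Rn n → ℂ) :
    wNorm (decayWeight n t) G ≤
      ENNReal.ofReal ((1 + max t 0) ^ ((n : ℝ) / 4)) * energy (1 + max t 0) G := by
  have h1 : 0 ≤ max t 0 := le_max_right _ _
  refine wNorm_mono G fun ξ => ?_
  rw [decayWeight, abs_mul, abs_of_nonneg (a := (1 + max t 0) ^ ((n : ℝ) / 4)) (by positivity)]

theorem energy_le_wNorm_decayWeight {n : ℕ} {t : ℝ} (ht : 0 ≤ t) (G : Rn n → ℂ) :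
    energy (1 + t) G ≤ ENNReal.ofReal ((1 + t) ^ (-((n : ℝ) / 4))) * wNorm (decayWeight n t) G := by
  refine wNorm_mono G fun ξ => ?_
  have e : (1 + t) ^ (-((n : ℝ) / 4)) * (1 + t) ^ ((n : ℝ) / 4) = 1 := by
    rw [← Real.rpow_add (by positivity), neg_add_cancel, Real.rpow_zero]
  rw [decayWeight, max_eq_left ht, abs_mul, abs_of_nonneg (a := (1 + t) ^ ((n : ℝ) / 4))
    (by positivity), ← mul_assoc ((1 + t) ^ (-((n : ℝ) / 4))), e, one_mul]

theorem energy_one_le_wNorm_decayWeight {n : ℕ} (t : ℝ) (G : Rn n → ℂ) :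
    energy 1 G ≤ wNorm (decayWeight n t) G := by
  rw [← one_mul (wNorm (decayWeight n t) G), ← ENNReal.ofReal_one]
  refine wNorm_mono G fun ξ => ?_
  have := rad_nonneg ξ
  rw [one_mul, Real.sqrt_one, one_mul, abs_of_nonneg (by positivity),
    abs_of_pos (decayWeight_pos t ξ)]
  exact one_add_rad_le_decayWeight t ξ

/-- The curve in `H¹` (on the Fourier side) with weighted profile `V`. -/
noncomputable def unweight {n : ℕ} (V : ℝ → Lp ℂ 2 (volume : Measure (Rn n))) (t : ℝ)
    (ξ : Rn n) : ℂ := ((decayWeight n t ξ)⁻¹ : ℂ) * V t ξ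

theorem aestronglyMeasurable_unweight {n : ℕ} (V : ℝ → Lp ℂ 2 (volume : Measure (Rn n))) (t : ℝ) :
    AEStronglyMeasurable (unweight V t) volume :=
  (Complex.measurable_ofReal.comp (measurable_decayWeight t)).inv.aestronglyMeasurable.mul
    (Lp.aestronglyMeasurable _)

theorem decayWeight_mul_unweight {n : ℕ} (V : ℝ → Lp ℂ 2 (volume : Measure (Rn n))) (t : ℝ)
    (ξ : Rn n) : (decayWeight n t ξ : ℂ) * unweight V t ξ = V t ξ := by
  have : (decayWeight n t ξ : ℂ) ≠ 0 := Complex.ofReal_ne_zero.2 (decayWeight_pos t ξ).ne'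
  rw [unweight, ← mul_assoc, mul_inv_cancel₀ this, one_mul]

theorem wNorm_unweight {n : ℕ} (V : ℝ → Lp ℂ 2 (volume : Measure (Rn n))) (t : ℝ) :
    wNorm (decayWeight n t) (unweight V t) = ENNReal.ofReal ‖V t‖ := by
  rw [ofReal_norm, Lp.enorm_def, wNorm]
  simp_rw [decayWeight_mul_unweight]

theorem wNorm_unweight_sub {n : ℕ} (V W : ℝ → Lp ℂ 2 (volume : Measure (Rn n))) (t : ℝ) :
    wNorm (decayWeight n t) (fun ξ => unweight V t ξ - unweight W t ξ) =
      ENNReal.ofReal ‖V t - W t‖ := by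
  rw [ofReal_norm, Lp.enorm_def, wNorm]
  simp_rw [mul_sub, decayWeight_mul_unweight]
  exact eLpNorm_congr_ae (Lp.coeFn_sub _ _).symm

theorem energy_one_unweight_lt_top {n : ℕ} (V : ℝ → Lp ℂ 2 (volume : Measure (Rn n))) (t : ℝ) :
    energy 1 (unweight V t) < ∞ :=
  (energy_one_le_wNorm_decayWeight t _).trans_lt
    ((wNorm_unweight V t).trans_lt ENNReal.ofReal_lt_top)

theorem memLp_of_energy_lt_top {n : ℕ} {F : Rn n → ℂ} (hF : AEStronglyMeasurable F volume)
    (h : energy 1 F < ∞) : MemLp F 2 := by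
  refine ⟨hF, ?_⟩
  have := homNorm_le_energy le_rfl zero_le_one one_pos F
  rw [homNorm_zero_eq, Real.one_rpow, ENNReal.ofReal_one, one_mul] at this
  exact this.trans_lt h

/-- The weight depends on time, so the difference has two parts: the change of V under the weight at
time s, bounded because 1 + r ≤ `decayWeight`, and the change of the weight acting on V t, which
tends to 0 by dominated convergence. -/
theorem tendsto_energy_unweight {n : ℕ} {V : ℝ → Lp ℂ 2 (volume : Measure (Rn n))}
    (hV : Continuous V) {t : ℝ} (ht : 0 ≤ t) :
    Tendsto (fun s => energy 1 (fun ξ => unweight V s ξ - unweight V t ξ)) (𝓝[Ici 0] t) (𝓝 0) := by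
  set a : ℝ → Rn n → ℂ := fun s ξ =>
    (((1 + Real.sqrt 1 * rad ξ : ℝ) : ℂ) * (decayWeight n s ξ : ℂ)⁻¹) * V t ξ with ha
  have hw (s : ℝ) (ξ : Rn n) :
      ‖((1 + Real.sqrt 1 * rad ξ : ℝ) : ℂ) * (decayWeight n s ξ : ℂ)⁻¹‖ ≤ 1 := by
    have := rad_nonneg ξ
    rw [norm_mul, norm_inv, Complex.norm_real, Complex.norm_real, Real.sqrt_one, one_mul,
      Real.norm_of_nonneg (by positivity), Real.norm_of_nonneg (decayWeight_pos s ξ).le,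
      ← div_eq_mul_inv]
    exact div_le_one_of_le₀ (one_add_rad_le_decayWeight s ξ) (decayWeight_pos s ξ).le
  have hmW (s : ℝ) : Measurable fun ξ : Rn n =>
      ((1 + Real.sqrt 1 * rad ξ : ℝ) : ℂ) * (decayWeight n s ξ : ℂ)⁻¹ :=
    (Complex.measurable_ofReal.comp (measurable_energy_weight 1)).mul
      (Complex.measurable_ofReal.comp (measurable_decayWeight s)).inv
  have h1 : Tendsto (fun s => eLpNorm (fun ξ => a s ξ - a t ξ) 2 volume) (𝓝[Ici 0] t) (𝓝 0) := by
    refine tendsto_eLpNorm_sub_of_dominated ht (b := fun ξ => ‖V t ξ‖ₑ) (fun s _ => ?_) ?_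
      (fun s _ _ ξ => ?_) fun ξ => ?_
    · exact (hmW s).aestronglyMeasurable.mul (Lp.aestronglyMeasurable _)
    · simpa using (Lp.eLpNorm_lt_top (V t))
    · rw [ha, enorm_mul]
      refine mul_le_of_le_one_left' ?_
      rw [← ofReal_norm]
      exact ENNReal.ofReal_le_one.2 (hw s ξ)
    · refine Tendsto.mono_left ?_ nhdsWithin_le_nhds
      refine Continuous.tendsto (f := fun s => a s ξ) ?_ t
      exact (continuous_const.mul ((Complex.continuous_ofReal.comp
        (continuous_decayWeight ξ)).inv₀ fun s =>
          Complex.ofReal_ne_zero.2 (decayWeight_pos s ξ).ne')).mul continuous_const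
  have h2 : Tendsto (fun s => ENNReal.ofReal ‖V s - V t‖) (𝓝[Ici 0] t) (𝓝 0) := by
    have : Continuous fun s => ENNReal.ofReal ‖V s - V t‖ :=
      ENNReal.continuous_ofReal.comp (by fun_prop)
    simpa using (this.tendsto t).mono_left nhdsWithin_le_nhds
  have h3 := h2.add h1
  rw [add_zero] at h3
  refine tendsto_of_tendsto_of_tendsto_of_le_of_le tendsto_const_nhds h3 (fun _ => zero_le) ?_
  intro s
  have hVs : ∀ᵐ ξ, (V s - V t : Lp ℂ 2 (volume : Measure (Rn n))) ξ = V s ξ - V t ξ :=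
    Lp.coeFn_sub _ _
  have hle : energy 1 (fun ξ => unweight V s ξ - unweight V t ξ) ≤
      eLpNorm ((fun ξ => (((1 + Real.sqrt 1 * rad ξ : ℝ) : ℂ) * (decayWeight n s ξ : ℂ)⁻¹) *
        (V s - V t : Lp ℂ 2 (volume : Measure (Rn n))) ξ) + fun ξ => (a s ξ - a t ξ)) 2 volume := by
    refine (eLpNorm_congr_ae ?_).le
    filter_upwards [hVs] with ξ hξ
    simp only [Pi.add_apply, hξ, ha, unweight]
    ring
  refine hle.trans ((eLpNorm_add_le ((hmW s).aestronglyMeasurable.mul (Lp.aestronglyMeasurable _))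
    (((hmW s).aestronglyMeasurable.mul (Lp.aestronglyMeasurable _)).sub
      ((hmW t).aestronglyMeasurable.mul (Lp.aestronglyMeasurable _))) (by norm_num)).trans ?_)
  refine add_le_add ?_ le_rfl
  rw [ofReal_norm, Lp.enorm_def]
  refine eLpNorm_mono fun ξ => ?_
  rw [Pi.mul_apply, norm_mul]
  exact mul_le_of_le_one_left (norm_nonneg _) (hw s ξ)

theorem exists_isH1Curve_unweight {n : ℕ} {V : ℝ → Lp ℂ 2 (volume : Measure (Rn n))}
    (hV : Continuous V) : ∃ U : ℝ → Rn n → ℂ, IsH1Curve U (unweight V) := by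
  choose U hU using fun t => IsL2Fourier.exists_left
    (memLp_of_energy_lt_top (aestronglyMeasurable_unweight V t) (energy_one_unweight_lt_top V t))
  exact ⟨U, fun t _ => hU t, fun t _ => energy_one_unweight_lt_top V t,
    fun t ht => tendsto_energy_unweight hV ht⟩

/-- The weight grows only linearly in r, so the two derivatives gained by K₁ absorb it; ψ and h are
then needed only in L². -/
theorem decayWeight_mul_div_le {n : ℕ} (t : ℝ) (ξ : Rn n) :
    decayWeight n t ξ * (24 / (1 + rad ξ ^ 2)) ≤
      48 * ((1 + max t 0) ^ ((n : ℝ) / 4) * Real.sqrt (1 + max t 0)) := by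
  have h1 : 0 ≤ max t 0 := le_max_right _ _
  have h3 : 1 ≤ Real.sqrt (1 + max t 0) := Real.one_le_sqrt.2 (by linarith)
  have h4 := rad_nonneg ξ
  have h5 : decayWeight n t ξ ≤
      (1 + max t 0) ^ ((n : ℝ) / 4) * Real.sqrt (1 + max t 0) * (1 + rad ξ) := by
    rw [decayWeight, mul_assoc]
    gcongr
    nlinarith
  have h6 : (1 + rad ξ) * (24 / (1 + rad ξ ^ 2)) ≤ 48 := by
    rw [← mul_div_assoc, div_le_iff₀ (by positivity)]
    nlinarith [sq_nonneg (rad ξ - 1 / 2), sq_nonneg (rad ξ)]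
  calc _ ≤ (1 + max t 0) ^ ((n : ℝ) / 4) * Real.sqrt (1 + max t 0) * (1 + rad ξ) *
        (24 / (1 + rad ξ ^ 2)) := by gcongr
    _ = (1 + max t 0) ^ ((n : ℝ) / 4) * Real.sqrt (1 + max t 0) *
        ((1 + rad ξ) * (24 / (1 + rad ξ ^ 2))) := by ring
    _ ≤ (1 + max t 0) ^ ((n : ℝ) / 4) * Real.sqrt (1 + max t 0) * 48 := by gcongr
    _ = _ := by ring

/-- The right-hand side of the integral equation, as a curve in the weighted energy space. -/
theorem exists_weighted_mild {n : ℕ} {φ ψ : Rn n → ℂ} {h : ℝ → Rn n → ℂ}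
    (hφ : AEStronglyMeasurable φ volume) (hψ : AEStronglyMeasurable ψ volume)
    (hh : Continuous (Function.uncurry h)) (hφe : energy 1 φ < ∞) (hψ2 : eLpNorm ψ 2 volume < ∞)
    {A B : ℝ} (hh2 : ∀ τ, 0 ≤ τ → eLpNorm (h τ) 2 volume ≤ ENNReal.ofReal A)
    (hB : ∀ t, 0 ≤ t → wNorm (decayWeight n t) (mild φ ψ h t) ≤ ENNReal.ofReal B) :
    ∃ W : BoundedContinuousFunction ℝ (Lp ℂ 2 (volume : Measure (Rn n))),
      ∀ t, W t =ᵐ[volume] fun ξ => (decayWeight n t ξ : ℂ) * mild φ ψ h (max t 0) ξ := by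
  set G : ℝ → Rn n → ℂ := fun t ξ => (decayWeight n t ξ : ℂ) * mild φ ψ h t ξ with hG
  have hGm (t : ℝ) : AEStronglyMeasurable (G t) volume :=
    (Complex.measurable_ofReal.comp (measurable_decayWeight t)).aestronglyMeasurable.mul
      (aestronglyMeasurable_mild hφ hψ hh t)
  have hGB : ∀ t, 0 ≤ t → eLpNorm (G t) 2 volume ≤ ENNReal.ofReal B := hB
  have hGL (t : ℝ) : MemLp (G (max t 0)) 2 :=
    ⟨hGm _, (hGB _ (le_max_right _ _)).trans_lt ENNReal.ofReal_lt_top⟩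
  have hweq (t : ℝ) : decayWeight n (max t 0) = decayWeight n t := by
    ext ξ; simp [decayWeight]
  have hcont : ∀ t, 0 ≤ t →
      Tendsto (fun s => eLpNorm (fun ξ => G s ξ - G t ξ) 2 volume) (𝓝[Ici 0] t) (𝓝 0) := by
    intro t ht
    -- The weight is nondecreasing in time, so its value at t + 1 dominates the weights at all times
    -- up to t + 1, as dominated convergence at t requires.
    set c : ℝ := 48 * ((1 + max (t + 1) 0) ^ ((n : ℝ) / 4) * Real.sqrt (1 + max (t + 1) 0))
    have hv (F : Rn n → ℂ) : wNorm (fun ξ => decayWeight n (t + 1) ξ * (24 / (1 + rad ξ ^ 2))) F ≤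
        ENNReal.ofReal c * eLpNorm F 2 volume := by
      rw [← wNorm_one]
      refine wNorm_mono F fun ξ => ?_
      have := decayWeight_pos (t + 1) ξ
      rw [abs_of_nonneg (by positivity), abs_one, mul_one]
      exact decayWeight_mul_div_le (t + 1) ξ
    refine tendsto_eLpNorm_mild_sub (v := decayWeight n (t + 1)) measurable_decayWeight
      (fun ξ => (continuous_decayWeight ξ).continuousOn) (fun s _ hs ξ => ?_) hφ hψ hh
      (eLpNorm_mildBound_lt_top (measurable_decayWeight _) hφ hψ hh ?_ ?_ ?_) ht
    · rw [abs_of_pos (decayWeight_pos _ _), abs_of_pos (decayWeight_pos _ _)]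
      exact decayWeight_mono hs ξ
    · have h0 : 0 ≤ max (t + 1) 0 := le_max_right _ _
      refine lt_of_le_of_lt (b := ENNReal.ofReal ((1 + max (t + 1) 0) ^ ((n : ℝ) / 4) *
        Real.sqrt (1 + max (t + 1) 0)) * energy 1 φ) (wNorm_mono φ fun ξ => ?_)
        (ENNReal.mul_lt_top ENNReal.ofReal_lt_top hφe)
      have h3 : 1 ≤ Real.sqrt (1 + max (t + 1) 0) := Real.one_le_sqrt.2 (by linarith)
      have h4 := rad_nonneg ξ
      rw [abs_of_pos (decayWeight_pos _ _), Real.sqrt_one, one_mul, abs_of_nonneg (by positivity),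
        decayWeight, mul_assoc]
      gcongr
      nlinarith
    · exact (hv ψ).trans_lt (ENNReal.mul_lt_top ENNReal.ofReal_lt_top hψ2)
    · refine lt_of_le_of_lt (setLIntegral_mono' (g := fun _ => ENNReal.ofReal c *
        ENNReal.ofReal A) measurableSet_Ioc fun τ hτ => ?_) ?_
      · exact (hv (h τ)).trans (mul_le_mul_right (hh2 τ hτ.1.le) _)
      · rw [setLIntegral_const, Real.volume_Ioc]
        exact ENNReal.mul_lt_top (ENNReal.mul_lt_top ENNReal.ofReal_lt_top ENNReal.ofReal_lt_top)
          ENNReal.ofReal_lt_top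
  have hC : Continuous fun t => (hGL t).toLp (G (max t 0)) := by
    refine continuous_iff_continuousAt.2 fun t => ?_
    rw [ContinuousAt, tendsto_iff_edist_tendsto_0]
    have hmax : Tendsto (fun s : ℝ => max s 0) (𝓝 t) (𝓝[Ici 0] (max t 0)) :=
      tendsto_nhdsWithin_iff.2 ⟨(continuous_id.max continuous_const).tendsto t,
        Eventually.of_forall fun s => le_max_right s 0⟩
    refine ((hcont _ (le_max_right t 0)).comp hmax).congr fun s => ?_
    rw [Lp.edist_toLp_toLp]
    rfl
  refine ⟨BoundedContinuousFunction.ofNormedAddCommGroup _ hC (max B 0) fun t => ?_, fun t => ?_⟩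
  · rw [Lp.norm_toLp]
    refine ENNReal.toReal_le_of_le_ofReal (le_max_right _ _) ?_
    exact (hGB _ (le_max_right _ _)).trans (ENNReal.ofReal_le_ofReal (le_max_left _ _))
  · refine (MemLp.coeFn_toLp (hGL t)).trans (Eventually.of_forall fun ξ => ?_)
    simp only [hG, hweq]


/-! ### The contraction argument. -/

theorem energy_unweight_le {n : ℕ} (V : BoundedContinuousFunction ℝ (Lp ℂ 2 (volume : Measure (Rn n))))
    {R : ℝ} (hR : ‖V‖ ≤ R) {t : ℝ} (ht : 0 ≤ t) :
    energy (1 + t) (unweight V t) ≤ ENNReal.ofReal (R * (1 + t) ^ (-((n : ℝ) / 4))) := by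
  refine (energy_le_wNorm_decayWeight ht _).trans ?_
  rw [wNorm_unweight, ← ENNReal.ofReal_mul (by positivity), mul_comm]
  refine ENNReal.ofReal_le_ofReal ?_
  gcongr
  exact (V.norm_coe_le_norm t).trans hR

theorem energy_unweight_sub_le {n : ℕ}
    (V W : BoundedContinuousFunction ℝ (Lp ℂ 2 (volume : Measure (Rn n)))) {t : ℝ} (ht : 0 ≤ t) :
    energy (1 + t) (fun ξ => unweight V t ξ - unweight W t ξ) ≤
      ENNReal.ofReal (dist V W * (1 + t) ^ (-((n : ℝ) / 4))) := by
  refine (energy_le_wNorm_decayWeight ht _).trans ?_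
  rw [wNorm_unweight_sub, ← ENNReal.ofReal_mul (by positivity), mul_comm]
  refine ENNReal.ofReal_le_ofReal ?_
  gcongr
  rw [← dist_eq_norm]
  exact V.dist_coe_le_dist t

theorem wNorm_decayWeight_le_of_energy {n : ℕ} {t B : ℝ} (ht : 0 ≤ t) {G : Rn n → ℂ}
    (h : energy (1 + t) G ≤ ENNReal.ofReal (B * (1 + t) ^ (-((n : ℝ) / 4)))) :
    wNorm (decayWeight n t) G ≤ ENNReal.ofReal B := by
  refine (wNorm_decayWeight_le t G).trans ?_
  rw [max_eq_left ht]
  refine (mul_le_mul_right h _).trans_eq ?_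
  have e : (1 + t) ^ ((n : ℝ) / 4) * (1 + t) ^ (-((n : ℝ) / 4)) = 1 := by
    rw [← Real.rpow_add (by positivity), add_neg_cancel, Real.rpow_zero]
  rw [← ENNReal.ofReal_mul (by positivity), mul_left_comm, e, mul_one]

theorem exists_energy_mild_le {n : ℕ} {α : ℝ} (hα : 1 < α) :
    ∃ C : ℝ, 0 < C ∧ ∀ φ ψ : Rn n → ℂ, AEStronglyMeasurable φ volume →
      AEStronglyMeasurable ψ volume → ∀ δ : ℝ, 0 ≤ δ → energy 1 φ ≤ ENNReal.ofReal δ →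
      (∀ ξ, ‖ψ ξ‖ ≤ δ) → eLpNorm ψ 2 volume ≤ ENNReal.ofReal δ →
      ∀ h : ℝ → Rn n → ℂ, Continuous (Function.uncurry h) →
      ∀ A : ℝ, 0 ≤ A → (∀ τ, 0 ≤ τ → ∀ ξ, ‖h τ ξ‖ ≤ A * (1 + τ) ^ (-α)) →
      (∀ τ, 0 ≤ τ → eLpNorm (h τ) 2 volume ≤ ENNReal.ofReal (A * (1 + τ) ^ (-(α + n / 4)))) →
      ∀ t, 0 ≤ t → energy (1 + t) (mild φ ψ h t) ≤
          ENNReal.ofReal (C * (δ + A) * (1 + t) ^ (-((n : ℝ) / 4))) := by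
  obtain ⟨C1, hC1, h1⟩ := exists_energy_linear_le (n := n)
  obtain ⟨C2, hC2, h2⟩ := exists_energy_duhamel_le (n := n) hα
  refine ⟨C1 + C2, by positivity, fun φ ψ hφ hψ δ hδ hφδ hψb hψδ h hh A hA hb hb2 t ht => ?_⟩
  have hK : Measurable fun ξ : Rn n => (symbolK1 t ξ : ℂ) :=
    Complex.measurable_ofReal.comp (measurable_symbolK1.comp (measurable_const.prodMk measurable_id))
  refine (wNorm_add_le (measurable_energy_weight _)
    ((aestronglyMeasurable_const.mul hφ).add (hK.aestronglyMeasurable.mul hψ))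
    (stronglyMeasurable_integral_symbolK1_mul hh t 0 t).aestronglyMeasurable).trans ?_
  refine (add_le_add (h1 φ ψ hφ hψ δ hδ hφδ hψb hψδ t ht) (h2 h hh A hA hb hb2 t ht)).trans ?_
  rw [← ENNReal.ofReal_add (by positivity) (by positivity)]
  refine ENNReal.ofReal_le_ofReal ?_
  have hT : 0 ≤ (1 + t) ^ (-((n : ℝ) / 4)) := by positivity
  rw [← add_mul]
  refine mul_le_mul_of_nonneg_right ?_ hT
  nlinarith [mul_nonneg hC1.le hA, mul_nonneg hC2.le hδ]

theorem mild_sub {n : ℕ} {φ ψ : Rn n → ℂ} {h h' : ℝ → Rn n → ℂ}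
    (hh : Continuous (Function.uncurry h)) (hh' : Continuous (Function.uncurry h')) (t : ℝ) (ξ : Rn n) :
    mild φ ψ h t ξ - mild φ ψ h' t ξ = duhamel (fun τ ξ => h τ ξ - h' τ ξ) t ξ := by
  rw [← duhamel_sub hh hh', mild, mild]
  ring

/-- Global existence for small data in the energy space, with decay of the energy. -/
theorem exists_mild_solution {n : ℕ} (hn : 0 < n) (hn2 : n ≤ 2) {p : ℝ} (hp : 2 < p)
    (hα : 1 < n * (p - 1) / 2) {f : ℝ → ℝ} (hf : IsPowerNonlinearity p f) :
    ∃ δ ρ : ℝ, 0 < δ ∧ 0 < ρ ∧ ∀ φ ψ : Rn n → ℂ, AEStronglyMeasurable φ volume →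
      AEStronglyMeasurable ψ volume → energy 1 φ ≤ ENNReal.ofReal δ →
      (∀ ξ, ‖ψ ξ‖ ≤ δ) → eLpNorm ψ 2 volume ≤ ENNReal.ofReal δ →
      ∃ U F : ℝ → Rn n → ℂ, IsH1Curve U F ∧
        (∀ t, 0 ≤ t → F t =ᵐ[volume] mild φ ψ (nonlinHat f U) t) ∧
        ∀ t, 0 ≤ t → energy (1 + t) (F t) ≤ ENNReal.ofReal (ρ * (1 + t) ^ (-((n : ℝ) / 4))) := by
  obtain ⟨C1, hC1, h1⟩ := exists_energy_mild_le (n := n) hα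
  obtain ⟨C2, hC2, h2⟩ := exists_energy_duhamel_le (n := n) hα
  obtain ⟨C3, hC3, h3⟩ := exists_nonlinHat_sub_le hn hn2 hp hf
  obtain ⟨C4, hC4, h4⟩ := exists_nonlinHat_le hn hn2 hp hf
  -- The radius ρ satisfies ρ^{p-1} = 1/D and the data have size δ = ρ/(2C₁). Then C₁δ = ρ/2 and
  -- C₁C₄ρ^p ≤ ρ/2, so the ball is mapped to itself, and C₂C₃ρ^{p-1} ≤ 1/2 is the contraction
  -- factor.
  set D := 2 * (C1 * C4 + C2 * C3) with hD
  have hDpos : 0 < D := by positivity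
  set ρ : ℝ := D⁻¹ ^ (p - 1)⁻¹ with hρ
  have hρ0 : 0 < ρ := by positivity
  have hρp : ρ ^ (p - 1) = D⁻¹ := by
    rw [hρ, ← Real.rpow_mul (by positivity), inv_mul_cancel₀ (by linarith), Real.rpow_one]
  refine ⟨ρ / (2 * C1), ρ, by positivity, hρ0, fun φ ψ hφ hψ hφδ hψb hψδ => ?_⟩
  set δ := ρ / (2 * C1)
  have hδ : 0 ≤ δ := by positivity
  set X := BoundedContinuousFunction ℝ (Lp ℂ 2 (volume : Measure (Rn n)))
  choose U hU using fun V : X => exists_isH1Curve_unweight V.continuous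
  have hc (V : X) := (hU V).continuous_nonlinHat hn hn2 hp hf
  have hbd (V : X) := h4 (U V) (unweight V) (hU V) ‖V‖ (norm_nonneg _)
    (fun t ht => energy_unweight_le V le_rfl ht)
  have hA (V : X) : 0 ≤ C4 * ‖V‖ ^ (p - 1) * ‖V‖ := by positivity
  have hmild (V : X) (t : ℝ) (ht : 0 ≤ t) := wNorm_decayWeight_le_of_energy ht
    (h1 φ ψ hφ hψ δ hδ hφδ hψb hψδ _ (hc V) _ (hA V) (hbd V).1 (hbd V).2 t ht)
  have hΦ (V : X) : ∃ W : X, ∀ t, W t =ᵐ[volume] fun ξ =>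
      (decayWeight n t ξ : ℂ) * mild φ ψ (nonlinHat f (U V)) (max t 0) ξ := by
    refine exists_weighted_mild (A := C4 * ‖V‖ ^ (p - 1) * ‖V‖) hφ hψ (hc V)
      (hφδ.trans_lt ENNReal.ofReal_lt_top) (hψδ.trans_lt ENNReal.ofReal_lt_top)
      (fun τ hτ => ((hbd V).2 τ hτ).trans (ENNReal.ofReal_le_ofReal ?_)) (hmild V)
    refine mul_le_of_le_one_right (hA V) ?_
    refine Real.rpow_le_one_of_one_le_of_nonpos (by linarith) ?_
    have : (0 : ℝ) ≤ n / 4 := by positivity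
    linarith
  choose Φ hΦ using hΦ
  have hweq (t : ℝ) : decayWeight n (max t 0) = decayWeight n t := by
    ext ξ; simp [decayWeight]
  have hmaps : MapsTo Φ (Metric.closedBall 0 ρ) (Metric.closedBall 0 ρ) := by
    intro V hV
    rw [mem_closedBall_zero_iff] at hV ⊢
    refine (BoundedContinuousFunction.norm_le hρ0.le).2 fun t => ?_
    have e := hmild V (max t 0) (le_max_right _ _)
    rw [hweq, wNorm, ← eLpNorm_congr_ae (hΦ V t), ← Lp.enorm_def, ← ofReal_norm] at e
    have hnn : 0 ≤ C1 * (δ + C4 * ‖V‖ ^ (p - 1) * ‖V‖) := by positivity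
    refine ((ENNReal.ofReal_le_ofReal_iff hnn).1 e).trans ?_
    calc C1 * (δ + C4 * ‖V‖ ^ (p - 1) * ‖V‖) ≤ C1 * (δ + C4 * ρ ^ (p - 1) * ρ) := by gcongr; linarith
      _ = ρ / 2 + C1 * C4 / D * ρ := by
        rw [hρp]
        simp only [δ]
        field_simp
      _ ≤ ρ / 2 + 1 / 2 * ρ := by
        refine add_le_add le_rfl (mul_le_mul_of_nonneg_right ?_ hρ0.le)
        rw [div_le_div_iff₀ hDpos (by norm_num), hD]
        nlinarith [mul_pos hC2 hC3]
      _ = ρ := by ring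
  have hcontr : ∀ V ∈ Metric.closedBall (0 : X) ρ, ∀ W ∈ Metric.closedBall (0 : X) ρ,
      dist (Φ V) (Φ W) ≤ 1 / 2 * dist V W := by
    intro V hV W hW
    rw [mem_closedBall_zero_iff] at hV hW
    refine (BoundedContinuousFunction.dist_le (by positivity)).2 fun t => ?_
    have ht : 0 ≤ max t 0 := le_max_right _ _
    have hd := h3 (U V) (unweight V) (U W) (unweight W) (hU V) (hU W) ρ (dist V W) hρ0.le
      dist_nonneg (fun t ht => energy_unweight_le V hV ht) (fun t ht => energy_unweight_le W hW ht)
      (fun t ht => energy_unweight_sub_le V W ht)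
    have hcs : Continuous (Function.uncurry fun τ ξ =>
      nonlinHat f (U V) τ ξ - nonlinHat f (U W) τ ξ) := (hc V).sub (hc W)
    have hAn : 0 ≤ C3 * ρ ^ (p - 1) * dist V W := by positivity
    have e := wNorm_decayWeight_le_of_energy ht (h2 _ hcs _ hAn hd.1 hd.2 _ ht)
    have hsub : (Φ V t - Φ W t : Lp ℂ 2 (volume : Measure (Rn n))) =ᵐ[volume] fun ξ =>
        (decayWeight n t ξ : ℂ) * duhamel (fun τ ξ =>
          nonlinHat f (U V) τ ξ - nonlinHat f (U W) τ ξ) (max t 0) ξ := by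
      filter_upwards [Lp.coeFn_sub (Φ V t) (Φ W t), hΦ V t, hΦ W t] with ξ a b c
      rw [a, Pi.sub_apply, b, c, ← mul_sub, mild_sub (hc V) (hc W)]
    rw [hweq, wNorm, ← eLpNorm_congr_ae hsub, ← Lp.enorm_def, ← ofReal_norm, ← dist_eq_norm] at e
    have hnn : 0 ≤ C2 * (C3 * ρ ^ (p - 1) * dist V W) := by positivity
    refine ((ENNReal.ofReal_le_ofReal_iff hnn).1 e).trans ?_
    calc C2 * (C3 * ρ ^ (p - 1) * dist V W) = C2 * C3 / D * dist V W := by rw [hρp]; ring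
      _ ≤ 1 / 2 * dist V W := by
        refine mul_le_mul_of_nonneg_right ?_ dist_nonneg
        rw [div_le_div_iff₀ hDpos (by norm_num), hD]
        nlinarith [mul_pos hC1 hC4]
  have hC : ContractingWith (1 / 2 : NNReal) (hmaps.restrict Φ _ _) := by
    refine ⟨by rw [← NNReal.coe_lt_coe]; norm_num, LipschitzWith.of_dist_le_mul fun V W => ?_⟩
    have := hcontr V V.2 W W.2
    simpa [Subtype.dist_eq] using this
  obtain ⟨V, hVm, hfix, -⟩ := ContractingWith.exists_fixedPoint' Metric.isClosed_closedBall.isComplete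
    hmaps hC (x := 0) (Metric.mem_closedBall_self hρ0.le) (edist_ne_top _ _)
  refine ⟨U V, unweight V, hU V, fun t ht => ?_, fun t ht => energy_unweight_le V
    (mem_closedBall_zero_iff.1 hVm) ht⟩
  have := hΦ V t
  rw [hfix.eq, max_eq_left ht] at this
  filter_upwards [this] with ξ hξ
  have h0 : (decayWeight n t ξ : ℂ) ≠ 0 := Complex.ofReal_ne_zero.2 (decayWeight_pos t ξ).ne'
  rw [unweight, hξ, ← mul_assoc, inv_mul_cancel₀ h0, one_mul]


/-! ### Passage between real-valued solutions and their transforms. -/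

theorem fourier_neg_of_conj_eq {n : ℕ} {U : Rn n → ℂ} (hU : ∀ x, (starRingEnd ℂ) (U x) = U x)
    (ξ : Rn n) : 𝓕 U (-ξ) = (starRingEnd ℂ) (𝓕 U ξ) := by
  rw [Real.fourier_eq', Real.fourier_eq', ← integral_conj]
  refine integral_congr_ae (Eventually.of_forall fun x => ?_)
  simp [← Complex.exp_conj, hU x, map_ofNat]

theorem fourier_toC_neg {n : ℕ} (g : Rn n → ℝ) (ξ : Rn n) :
    𝓕 (toC g) (-ξ) = (starRingEnd ℂ) (𝓕 (toC g) ξ) :=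
  fourier_neg_of_conj_eq (fun _ => Complex.conj_ofReal _) ξ

theorem nonlinHat_neg {n : ℕ} (f : ℝ → ℝ) (U : ℝ → Rn n → ℂ) (τ : ℝ) (ξ : Rn n) :
    nonlinHat f U τ (-ξ) = (starRingEnd ℂ) (nonlinHat f U τ ξ) :=
  fourier_toC_neg _ ξ

theorem symbolK1_neg {n : ℕ} (t : ℝ) (ξ : Rn n) : symbolK1 t (-ξ) = symbolK1 t ξ := by
  simp [symbolK1]

/-- The symbols are real and even, so the Hermitian symmetry of the data and of the nonlinear term
passes to the solution. This is the source of its real-valuedness. -/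
theorem mild_neg {n : ℕ} {φ ψ : Rn n → ℂ} {h : ℝ → Rn n → ℂ}
    (hφ : ∀ ξ, φ (-ξ) = (starRingEnd ℂ) (φ ξ)) (hψ : ∀ ξ, ψ (-ξ) = (starRingEnd ℂ) (ψ ξ))
    (hh : ∀ τ ξ, h τ (-ξ) = (starRingEnd ℂ) (h τ ξ)) {t : ℝ} (ht : 0 ≤ t) (ξ : Rn n) :
    mild φ ψ h t (-ξ) = (starRingEnd ℂ) (mild φ ψ h t ξ) := by
  have h1 : duhamel h t (-ξ) = (starRingEnd ℂ) (duhamel h t ξ) := by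
    rw [duhamel, duhamel, intervalIntegral.integral_of_le ht, intervalIntegral.integral_of_le ht,
      ← integral_conj]
    refine integral_congr_ae (Eventually.of_forall fun τ => ?_)
    simp [hh, symbolK1_neg]
  simp [mild, h1, hφ, hψ, symbolK1_neg, ← Complex.exp_conj]

theorem IsL2Fourier.memLp_real {n : ℕ} {g : Rn n → ℝ} {F : Rn n → ℂ}
    (h : IsL2Fourier (toC g) F) : MemLp g 2 := by
  have := h.memLp_left.re
  simpa [toC] using this

theorem gradNorm_eq_homNorm {n : ℕ} {g : Rn n → ℝ} {F : Rn n → ℂ} (h : IsL2Fourier (toC g) F)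
    (k : ℝ) : gradNorm k g = homNorm k F := by
  have hg := h.memLp_real
  rw [gradNorm, dif_pos hg]
  exact wNorm_congr (w := fun ξ => rad ξ ^ k) ((isL2Fourier_toC hg).ae_eq_right h)

theorem eLpNorm_toC {n : ℕ} (g : Rn n → ℝ) (p : ℝ≥0∞) :
    eLpNorm (toC g) p volume = eLpNorm g p volume :=
  eLpNorm_congr_norm_ae (Eventually.of_forall fun x => by simp [toC])

theorem eLpNorm_le_sobolevNorm {n : ℕ} (k : ℝ) (g : Rn n → ℝ) :
    eLpNorm g 2 volume ≤ sobolevNorm k g := by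
  rw [sobolevNorm, one_div, ← ENNReal.rpow_inv_le_iff (by norm_num)]
  norm_num

theorem gradNorm_le_sobolevNorm {n : ℕ} (k : ℝ) (g : Rn n → ℝ) :
    gradNorm k g ≤ sobolevNorm k g := by
  rw [sobolevNorm, one_div, ← ENNReal.rpow_inv_le_iff (by norm_num)]
  norm_num

/-- For k ≥ 1 one has 1 + r ≤ 2 + r^k; the two terms contribute 2 and 1 to the constant. -/
theorem energy_one_le_sobolevNorm {n : ℕ} {k : ℝ} (hk : 1 ≤ k) {g : Rn n → ℝ} {F : Rn n → ℂ}
    (h : IsL2Fourier (toC g) F) : energy 1 F ≤ 3 * sobolevNorm k g := by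
  have h1 : energy 1 F ≤ ENNReal.ofReal 1 * wNorm (fun ξ => 2 + rad ξ ^ k) F := by
    refine wNorm_mono F fun ξ => ?_
    have hr := rad_nonneg ξ
    rw [Real.sqrt_one, one_mul, one_mul, abs_of_nonneg (by positivity), abs_of_nonneg (by positivity)]
    rcases le_total (rad ξ) 1 with h | h
    · linarith [Real.rpow_nonneg hr k]
    · linarith [Real.self_le_rpow_of_one_le h hk]
  have h2 : wNorm (fun _ : Rn n => (2 : ℝ)) F ≤ ENNReal.ofReal 2 * wNorm (fun _ => 1) F :=
    wNorm_mono F fun ξ => by norm_num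
  rw [wNorm_one, ← h.eLpNorm_eq, eLpNorm_toC] at h2
  have h3 := wNorm_add_weight_le (w := fun _ : Rn n => (2 : ℝ)) measurable_const
    (measurable_rad_rpow k) h.memLp_right.1
  rw [ENNReal.ofReal_one, one_mul] at h1
  refine (h1.trans h3).trans ((add_le_add h2 (gradNorm_eq_homNorm h k).ge).trans ?_)
  refine (add_le_add (mul_le_mul_right (eLpNorm_le_sobolevNorm k g) _)
    (gradNorm_le_sobolevNorm k g)).trans_eq ?_
  rw [ENNReal.ofReal_ofNat, ← add_one_mul]
  norm_num

theorem sobolevNorm_le_add {n : ℕ} (k : ℝ) (g : Rn n → ℝ) :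
    sobolevNorm k g ≤ eLpNorm g 2 volume + gradNorm k g := by
  rw [sobolevNorm, one_div, ENNReal.rpow_inv_le_iff (by norm_num)]
  rw [ENNReal.rpow_two, add_sq]
  exact add_le_add (le_self_add) le_rfl

theorem tendsto_eLpNorm_of_energy {n : ℕ} {F : ℝ → Rn n → ℂ} {t : ℝ}
    (h : Tendsto (fun s => energy 1 (fun ξ => F s ξ - F t ξ)) (𝓝[Ici 0] t) (𝓝 0)) :
    Tendsto (fun s => eLpNorm (fun ξ => F s ξ - F t ξ) 2 volume) (𝓝[Ici 0] t) (𝓝 0) := by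
  refine tendsto_of_tendsto_of_tendsto_of_le_of_le tendsto_const_nhds h (fun _ => zero_le)
    fun s => ?_
  have := homNorm_le_energy le_rfl zero_le_one one_pos (fun ξ => F s ξ - F t ξ)
  rwa [homNorm_zero_eq, Real.one_rpow, ENNReal.ofReal_one, one_mul] at this

theorem measurable_rad_rpow_div {n : ℕ} (k : ℝ) :
    Measurable fun ξ : Rn n => rad ξ ^ k * (24 / (1 + rad ξ ^ 2)) := by
  have := measurable_rad_rpow (n := n) k
  fun_prop

/-- Solutions of the integral equation inherit additional regularity. -/
theorem homNorm_mild_regular {n : ℕ} {φ ψ : Rn n → ℂ} {h : ℝ → Rn n → ℂ} {k : ℝ}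
    (hφ : AEStronglyMeasurable φ volume) (hψ : AEStronglyMeasurable ψ volume)
    (hh : Continuous (Function.uncurry h)) (h1 : homNorm k φ < ∞)
    (h2 : wNorm (fun ξ => rad ξ ^ k * (24 / (1 + rad ξ ^ 2))) ψ < ∞)
    (h3 : ∀ T : ℝ, 0 ≤ T → ∃ B : ℝ, ∀ τ ∈ Ioc 0 T,
      wNorm (fun ξ => rad ξ ^ k * (24 / (1 + rad ξ ^ 2))) (h τ) ≤ ENNReal.ofReal B) {t : ℝ}
    (ht : 0 ≤ t) : homNorm k (mild φ ψ h t) < ∞ ∧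
      Tendsto (fun s => homNorm k (fun ξ => mild φ ψ h s ξ - mild φ ψ h t ξ))
        (𝓝[Ici 0] t) (𝓝 0) := by
  have hb : eLpNorm (fun ξ => ‖((rad ξ ^ k : ℝ) : ℂ)‖ₑ * mildBound φ ψ h (t + 1) ξ) 2 volume < ∞ := by
    refine eLpNorm_mildBound_lt_top (measurable_rad_rpow k) hφ hψ hh h1 h2 ?_
    obtain ⟨B, hB⟩ := h3 (t + 1) (by linarith)
    refine (setLIntegral_mono' measurableSet_Ioc hB).trans_lt ?_
    rw [setLIntegral_const, Real.volume_Ioc]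
    exact ENNReal.mul_lt_top ENNReal.ofReal_lt_top ENNReal.ofReal_lt_top
  refine ⟨wNorm_mild_lt_top hb ht (by linarith), ?_⟩
  have := tendsto_eLpNorm_mild_sub (w := fun _ ξ => rad ξ ^ k) (fun _ => measurable_rad_rpow k)
    (fun ξ => continuousOn_const) (fun s _ _ ξ => le_rfl) hφ hψ hh hb ht
  refine this.congr fun s => ?_
  simp_rw [← mul_sub]
  rfl

/-- The source term of the integral equation on the Fourier side: `û₀ + û₁`. -/
noncomputable def sourceHat {n : ℕ} (u₀ u₁ : Rn n → ℝ) (ξ : Rn n) : ℂ :=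
  𝓕 (toC u₀) ξ + 𝓕 (toC u₁) ξ

theorem mild_eq_ae {n : ℕ} (hn : 0 < n) (f : ℝ → ℝ) (u₀ u₁ : Rn n → ℝ) (u : ℝ → Rn n → ℝ)
    {t : ℝ} (ht : 0 ≤ t) :
    mild (𝓕 (toC u₀)) (sourceHat u₀ u₁) (nonlinHat f fun t => toC (u t)) t =ᵐ[volume] fun ξ =>
      (symbolK0 t ξ : ℂ) * 𝓕 (toC u₀) ξ + (symbolK1 t ξ : ℂ) * 𝓕 (toC u₁) ξ
        + ∫ τ in (0 : ℝ)..t, (symbolK1 (t - τ) ξ : ℂ) * 𝓕 (toC fun x => f (u τ x)) ξ := by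
  filter_upwards [ae_rad_ne_one hn] with ξ hξ
  have h1 : duhamel (nonlinHat f fun t => toC (u t)) t ξ =
      ∫ τ in (0 : ℝ)..t, (symbolK1 (t - τ) ξ : ℂ) * 𝓕 (toC fun x => f (u τ x)) ξ := by
    refine intervalIntegral.integral_congr fun τ hτ => ?_
    rw [uIcc_of_le ht] at hτ
    simp only [nonlinHat, max_eq_left hτ.1]
    rfl
  rw [mild, h1, sourceHat, symbolK0_eq t hξ]
  push_cast
  ring

theorem nonlinHat_congr {n : ℕ} (f : ℝ → ℝ) {U V : ℝ → Rn n → ℂ}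
    (h : ∀ t, 0 ≤ t → U t =ᵐ[volume] V t) : nonlinHat f U = nonlinHat f V := by
  ext τ ξ
  have : nonlin f (U (max τ 0)) =ᵐ[volume] nonlin f (V (max τ 0)) := by
    filter_upwards [h _ (le_max_right τ 0)] with x hx
    rw [nonlin, nonlin, hx]
  rw [nonlinHat, nonlinHat, Real.fourier_congr_ae this]

/-- A curve in `H¹` that solves the integral equation and is continuous in `H^k` is a global
solution. -/
theorem IsH1Curve.exists_isGlobalSolution {n : ℕ} (hn : 0 < n) {f : ℝ → ℝ} {k : ℝ}
    {u₀ u₁ : Rn n → ℝ} {U F : ℝ → Rn n → ℂ} (hU : IsH1Curve U F)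
    (hF : ∀ t, 0 ≤ t → F t =ᵐ[volume] mild (𝓕 (toC u₀)) (sourceHat u₀ u₁) (nonlinHat f U) t)
    (hk : ∀ t, 0 ≤ t → homNorm k (F t) < ∞)
    (hkc : ∀ t, 0 ≤ t →
      Tendsto (fun s => homNorm k (fun ξ => F s ξ - F t ξ)) (𝓝[Ici 0] t) (𝓝 0)) :
    ∃ u : ℝ → Rn n → ℝ, IsGlobalSolution f k u₀ u₁ u := by
  -- Nothing in the notion of a curve asks U to be real; it agrees almost everywhere with its real
  -- part because F inherits Hermitian symmetry from the equation.
  have hreal : ∀ t, 0 ≤ t → toC (fun x => (U t x).re) =ᵐ[volume] U t := by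
    intro t ht
    have hherm : ∀ᵐ ξ, F t (-ξ) = (starRingEnd ℂ) (F t ξ) := by
      have h1 := (Measure.measurePreserving_neg (volume : Measure (Rn n))).quasiMeasurePreserving.ae_eq_comp
        (hF t ht)
      filter_upwards [hF t ht, h1] with ξ h2 h3
      simp only [Function.comp_apply] at h3
      rw [h3, h2]
      refine mild_neg (fourier_toC_neg u₀) (fun ξ => ?_) (nonlinHat_neg f U) ht ξ
      rw [sourceHat, sourceHat, fourier_toC_neg, fourier_toC_neg, map_add]
    filter_upwards [(hU.isL2Fourier t ht).ae_conj_eq hherm] with x hx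
    exact Complex.conj_eq_iff_re.1 hx
  have hL : ∀ t, 0 ≤ t → IsL2Fourier (toC fun x => (U t x).re) (F t) := fun t ht =>
    (hU.isL2Fourier t ht).congr (hreal t ht) EventuallyEq.rfl
  have hN : nonlinHat f U = nonlinHat f (fun t => toC fun x => (U t x).re) :=
    nonlinHat_congr f fun t ht => (hreal t ht).symm
  refine ⟨fun t x => (U t x).re, fun t ht => ⟨(hL t ht).memLp_real, ?_⟩, fun t ht => ?_,
    fun t ht => ?_⟩
  · rw [gradNorm_eq_homNorm (hL t ht)]
    exact hk t ht
  · have h1 := (tendsto_eLpNorm_of_energy (hU.tendsto t ht)).add (hkc t ht)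
    rw [add_zero] at h1
    refine tendsto_of_tendsto_of_tendsto_of_le_of_le' tendsto_const_nhds h1
      (Eventually.of_forall fun _ => zero_le) ?_
    filter_upwards [self_mem_nhdsWithin] with s hs
    have hd : IsL2Fourier (toC fun x => (U s x).re - (U t x).re) (fun ξ => F s ξ - F t ξ) := by
      have := (hL s hs).sub (hL t ht)
      refine this.congr (Eventually.of_forall fun x => ?_) EventuallyEq.rfl
      simp [toC]
    refine (sobolevNorm_le_add k _).trans_eq ?_
    rw [gradNorm_eq_homNorm hd, ← hd.eLpNorm_eq, eLpNorm_toC]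
  · have h1 := (isL2Fourier_toC (hL t ht).memLp_real).ae_eq_right (hL t ht)
    have h2 := mild_eq_ae hn f u₀ u₁ (fun t x => (U t x).re) ht
    rw [← hN] at h2
    exact h1.trans ((hF t ht).trans h2)

open Classical in
/-- A global solution is a curve in `H¹` that solves the integral equation. -/
theorem IsGlobalSolution.exists_isH1Curve {n : ℕ} (hn : 0 < n) {f : ℝ → ℝ} {k : ℝ} (hk : 1 ≤ k)
    {u₀ u₁ : Rn n → ℝ} {u : ℝ → Rn n → ℝ} (hu : IsGlobalSolution f k u₀ u₁ u) :
    ∃ F : ℝ → Rn n → ℂ, IsH1Curve (fun t => toC (u t)) F ∧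
      ∀ t, 0 ≤ t → F t =ᵐ[volume] mild (𝓕 (toC u₀)) (sourceHat u₀ u₁)
        (nonlinHat f fun t => toC (u t)) t := by
  -- Square integrability is known only for t ≥ 0; the value 0 at negative times plays no role.
  set F : ℝ → Rn n → ℂ := fun t => if ht : 0 ≤ t then l2Fourier (u t) (hu.mem t ht).1 else 0
    with hFdef
  have hF : ∀ t, ∀ ht : 0 ≤ t, F t = l2Fourier (u t) (hu.mem t ht).1 := fun t ht => dif_pos ht
  have hL : ∀ t, 0 ≤ t → IsL2Fourier (toC (u t)) (F t) := fun t ht => by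
    rw [hF t ht]; exact isL2Fourier_toC _
  refine ⟨F, ⟨hL, fun t ht => ?_, fun t ht => ?_⟩, fun t ht => ?_⟩
  · refine (energy_one_le_sobolevNorm hk (hL t ht)).trans_lt (ENNReal.mul_lt_top (by simp) ?_)
    exact (sobolevNorm_le_add k _).trans_lt
      (ENNReal.add_lt_top.2 ⟨(hu.mem t ht).1.2, (hu.mem t ht).2⟩)
  · have h1 := ENNReal.Tendsto.const_mul (a := 3) (hu.continuous t ht) (Or.inr (by norm_num))
    rw [mul_zero] at h1
    refine tendsto_of_tendsto_of_tendsto_of_le_of_le' tendsto_const_nhds h1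
      (Eventually.of_forall fun _ => zero_le) ?_
    filter_upwards [self_mem_nhdsWithin] with s hs
    refine energy_one_le_sobolevNorm hk (((hL s hs).sub (hL t ht)).congr
      (Eventually.of_forall fun x => ?_) EventuallyEq.rfl)
    simp [toC]
  · rw [hF t ht]
    exact EventuallyEq.trans (hu.equation t ht) (mild_eq_ae hn f u₀ u₁ u ht).symm


/-! ### Integrability of the transform, giving sup bounds. -/

theorem lintegral_comp_smul_pos {n : ℕ} {g : Rn n → ℝ≥0∞} (hg : Measurable g) {c : ℝ}
    (hc : 0 < c) : ∫⁻ ξ, g (c • ξ) = ENNReal.ofReal (c ^ (-(n : ℝ))) * ∫⁻ ξ, g ξ := by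
  rw [← lintegral_map (f := g) hg (measurable_const_smul c), Measure.map_addHaar_smul _ hc.ne',
    lintegral_smul_measure, finrank_euclideanSpace_fin, abs_of_pos (by positivity),
    Real.rpow_neg hc.le, Real.rpow_natCast]
  rfl

theorem one_add_rpow_le {x k : ℝ} (hx : 0 ≤ x) (hk : 0 ≤ k) :
    (1 + x) ^ k ≤ 2 ^ k * (1 + x ^ k) := by
  rcases le_total x 1 with h | h
  · calc (1 + x) ^ k ≤ 2 ^ k := by gcongr; linarith
      _ ≤ _ := le_mul_of_one_le_right (by positivity) (by linarith [Real.rpow_nonneg hx k])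
  · calc (1 + x) ^ k ≤ (2 * x) ^ k := by gcongr; linarith
      _ = 2 ^ k * x ^ k := Real.mul_rpow (by norm_num) hx
      _ ≤ _ := by gcongr; linarith

/-- In dimension at most two, `3/2` derivatives in `L²` make the transform integrable. -/
theorem exists_lintegral_enorm_le {n : ℕ} (hn2 : n ≤ 2) :
    ∃ C : ℝ, 0 < C ∧ ∀ F : Rn n → ℂ, AEStronglyMeasurable F volume → ∀ T B : ℝ, 0 < T → 0 ≤ B →
      eLpNorm F 2 volume ≤ ENNReal.ofReal B →
      homNorm (3 / 2) F ≤ ENNReal.ofReal (B * T ^ (-(3 / 4) : ℝ)) →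
      ∫⁻ ξ, ‖F ξ‖ₑ ≤ ENNReal.ofReal (C * T ^ (-((n : ℝ) / 4)) * B) := by
  have hn2' : (n : ℝ) ≤ 2 := by exact_mod_cast hn2
  -- The weight (1 + |√T ξ|)^{-3/2} is square integrable because 3 > n, and rescaling gives its
  -- squared norm as T^{-n/2} J. Cauchy-Schwarz against the inverse weight times F yields the
  -- estimate.
  set J : ℝ≥0∞ := ∫⁻ ξ : Rn n, ENNReal.ofReal ((1 + ‖ξ‖) ^ (-3 : ℝ)) with hJ
  have hJfin : J < ∞ := finite_integral_one_add_norm (by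
    rw [finrank_euclideanSpace_fin]; linarith)
  set b : ℝ := 2 ^ (3 / 2 : ℝ) * 2
  have hb : (0 : ℝ) ≤ b := by positivity
  refine ⟨b * Real.sqrt J.toReal + 1, by positivity, fun F hF T B hT hB h0 h1 => ?_⟩
  set w : Rn n → ℝ := fun ξ => (1 + ‖Real.sqrt T • ξ‖) ^ (3 / 2 : ℝ) with hw
  have hwpos (ξ : Rn n) : 0 < w ξ := by positivity
  have hwm : Measurable w := by fun_prop
  have e1 : wNorm w F ≤ ENNReal.ofReal (b * B) := by
    have h2 : wNorm w F ≤ ENNReal.ofReal (2 ^ (3 / 2 : ℝ)) *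
        wNorm (fun ξ => 1 + T ^ (3 / 4 : ℝ) * rad ξ ^ (3 / 2 : ℝ)) F := by
      refine wNorm_mono F fun ξ => ?_
      have hr := rad_nonneg ξ
      rw [abs_of_pos (hwpos ξ), abs_of_nonneg (by positivity)]
      refine (one_add_rpow_le (norm_nonneg _) (by norm_num)).trans ?_
      gcongr
      have e : T ^ (3 / 4 : ℝ) * rad ξ ^ (3 / 2 : ℝ) = (Real.sqrt T * rad ξ) ^ (3 / 2 : ℝ) := by
        rw [Real.mul_rpow (by positivity) hr, Real.sqrt_eq_rpow, ← Real.rpow_mul hT.le]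
        norm_num
      rw [e]
      gcongr
      rw [norm_smul, Real.norm_of_nonneg (Real.sqrt_nonneg T)]
      gcongr
      nlinarith [Real.pi_gt_three, norm_nonneg ξ]
    have h3 : wNorm (fun ξ => 1 + T ^ (3 / 4 : ℝ) * rad ξ ^ (3 / 2 : ℝ)) F ≤
        ENNReal.ofReal B + ENNReal.ofReal B := by
      refine (wNorm_add_weight_le (w := fun _ => 1) measurable_const
        ((measurable_rad_rpow _).const_mul _) hF).trans (add_le_add ?_ ?_)
      · rwa [wNorm_one]
      · have h4 : wNorm (fun ξ => T ^ (3 / 4 : ℝ) * rad ξ ^ (3 / 2 : ℝ)) F ≤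
            ENNReal.ofReal (T ^ (3 / 4 : ℝ)) * homNorm (3 / 2) F := by
          refine wNorm_mono F fun ξ => ?_
          rw [abs_mul, abs_of_nonneg (a := T ^ (3 / 4 : ℝ)) (by positivity)]
        refine h4.trans ((mul_le_mul_right h1 _).trans_eq ?_)
        have e : T ^ (3 / 4 : ℝ) * T ^ (-(3 / 4) : ℝ) = 1 := by
          rw [← Real.rpow_add hT]; norm_num
        rw [← ENNReal.ofReal_mul (by positivity), mul_left_comm, e, mul_one]
    refine h2.trans ((mul_le_mul_right h3 _).trans_eq ?_)
    rw [← ENNReal.ofReal_add hB hB, ← ENNReal.ofReal_mul (by positivity)]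
    congr 1
    simp only [b]
    ring
  have e2 : ∫⁻ ξ, ‖((w ξ)⁻¹ : ℂ)‖ₑ ^ 2 = ENNReal.ofReal (T ^ (-((n : ℝ) / 2))) * J := by
    have h2 := lintegral_comp_smul_pos (n := n)
      (g := fun ξ => ENNReal.ofReal ((1 + ‖ξ‖) ^ (-3 : ℝ))) (by fun_prop) (Real.sqrt_pos.2 hT)
    rw [Real.sqrt_eq_rpow, ← Real.rpow_mul hT.le,
      show (1 / 2 : ℝ) * -(n : ℝ) = -((n : ℝ) / 2) by ring] at h2
    rw [hJ, ← h2]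
    refine lintegral_congr fun ξ => ?_
    rw [← ofReal_norm, ← ENNReal.ofReal_pow (norm_nonneg _), norm_inv, Complex.norm_real,
      Real.norm_of_nonneg (hwpos ξ).le, hw, ← Real.rpow_neg (by positivity), ← Real.rpow_natCast,
      ← Real.rpow_mul (by positivity), Real.sqrt_eq_rpow]
    norm_num
  have e3 : (∫⁻ ξ, ‖F ξ‖ₑ) ^ 2 ≤ (∫⁻ ξ, ‖((w ξ)⁻¹ : ℂ)‖ₑ ^ 2) * wNorm w F ^ 2 := by
    rw [wNorm, eLpNorm_two_sq]
    refine le_trans (le_of_eq ?_) (lintegral_mul_sq_le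
      (Complex.measurable_ofReal.comp hwm).inv.enorm.aemeasurable
      ((Complex.measurable_ofReal.comp hwm).aestronglyMeasurable.mul hF).enorm)
    congr 1
    refine lintegral_congr fun ξ => ?_
    rw [← enorm_mul]
    congr 1
    have : (w ξ : ℂ) ≠ 0 := Complex.ofReal_ne_zero.2 (hwpos ξ).ne'
    rw [← mul_assoc, inv_mul_cancel₀ this, one_mul]
  rw [← ENNReal.pow_le_pow_left_iff two_ne_zero]
  refine e3.trans ?_
  rw [← ENNReal.ofReal_toReal hJfin.ne] at e2
  rw [e2]
  refine (mul_le_mul_right (pow_le_pow_left' e1 2) _).trans ?_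
  rw [← ENNReal.ofReal_pow (by positivity), ← ENNReal.ofReal_pow (by positivity),
    ← ENNReal.ofReal_mul (by positivity), ← ENNReal.ofReal_mul (by positivity)]
  refine ENNReal.ofReal_le_ofReal ?_
  have e4 : T ^ (-((n : ℝ) / 2)) = (T ^ (-((n : ℝ) / 4))) ^ 2 := by
    rw [← Real.rpow_natCast, ← Real.rpow_mul hT.le]; congr 1; push_cast; ring
  rw [e4]
  nth_rw 1 [← Real.sq_sqrt (ENNReal.toReal_nonneg (a := J))]
  calc _ = (b * Real.sqrt J.toReal * T ^ (-((n : ℝ) / 4)) * B) ^ 2 := by ring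
    _ ≤ _ := by gcongr; linarith

/-! ### Translations, difference quotients and the chain rule. -/

/-- Translation of the argument is modulation of the transform. -/
theorem fourier_comp_add_right {n : ℕ} (U : Rn n → ℂ) (a ξ : Rn n) :
    𝓕 (fun x => U (x + a)) ξ = Complex.exp (Complex.I * ((2 * Real.pi * inner ℝ a ξ : ℝ) : ℂ)) * 𝓕 U ξ := by
  rw [Real.fourier_eq', Real.fourier_eq', ← integral_const_mul, ← integral_add_right_eq_self _ (-a)]
  refine integral_congr_ae (Eventually.of_forall fun x => ?_)
  simp only [neg_add_cancel_right, smul_eq_mul, inner_add_left, inner_neg_left, ← mul_assoc]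
  rw [← Complex.exp_add]
  congr 2
  push_cast
  ring

theorem fourierInv_comp_add_right {n : ℕ} (F : Rn n → ℂ) (a x : Rn n) :
    𝓕⁻ F (x + a) =
      𝓕⁻ (fun ξ => Complex.exp (Complex.I * ((2 * Real.pi * inner ℝ a ξ : ℝ) : ℂ)) * F ξ) x := by
  rw [Real.fourierInv_eq', Real.fourierInv_eq']
  refine integral_congr_ae (Eventually.of_forall fun ξ => ?_)
  simp only [smul_eq_mul, inner_add_right, ← mul_assoc]
  rw [← Complex.exp_add]
  congr 2
  rw [real_inner_comm a ξ]
  push_cast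
  ring


/-- The character `exp(2πi a·ξ)` by which translations act on the Fourier side. -/
noncomputable def modulation {n : ℕ} (a ξ : Rn n) : ℂ :=
  Complex.exp (Complex.I * ((2 * Real.pi * inner ℝ a ξ : ℝ) : ℂ))

theorem continuous_modulation {n : ℕ} (a : Rn n) : Continuous (modulation a) := by
  unfold modulation; fun_prop

theorem norm_modulation {n : ℕ} (a ξ : Rn n) : ‖modulation a ξ‖ = 1 := by
  rw [modulation, mul_comm, Complex.norm_exp_ofReal_mul_I]

theorem enorm_modulation_sub_one_le {n : ℕ} (a ξ : Rn n) :
    ‖modulation a ξ - 1‖ₑ ^ 2 ≤ ENNReal.ofReal ((2 * Real.pi * inner ℝ a ξ) ^ 2) := by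
  rw [← ofReal_norm, ← ENNReal.ofReal_pow (norm_nonneg _)]
  refine ENNReal.ofReal_le_ofReal ?_
  rw [← sq_abs (2 * Real.pi * inner ℝ a ξ)]
  exact pow_le_pow_left₀ (norm_nonneg _) Real.norm_exp_I_mul_ofReal_sub_one_le 2

/-- The squared difference quotient at 0 of s ↦ e^{iys}, with y = 2π⟨b, ξ⟩, along s = 1/(m+1). -/
theorem tendsto_modulation_sub_one {n : ℕ} (b ξ : Rn n) :
    Tendsto (fun m : ℕ => ENNReal.ofReal (((m : ℝ) + 1) ^ 2) *
      ‖modulation ((1 / ((m : ℝ) + 1)) • b) ξ - 1‖ₑ ^ 2) atTop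
      (𝓝 (ENNReal.ofReal ((2 * Real.pi * inner ℝ b ξ) ^ 2))) := by
  set y := 2 * Real.pi * inner ℝ b ξ with hy
  have h1 : HasDerivAt (fun s : ℝ => Complex.exp (Complex.I * ((y * s : ℝ) : ℂ)))
      (Complex.I * y) 0 := by
    have h2 : HasDerivAt (fun s : ℝ => Complex.I * ((y * s : ℝ) : ℂ)) (Complex.I * y) 0 := by
      simpa using (((hasDerivAt_id (0 : ℝ)).const_mul y).ofReal_comp).const_mul Complex.I
    simpa using h2.cexp
  have h2 := h1.tendsto_slope.comp ((tendsto_nhdsWithin_iff (s := {(0 : ℝ)}ᶜ)).2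
    ⟨tendsto_one_div_add_atTop_nhds_zero_nat (𝕜 := ℝ), Eventually.of_forall fun m => by
      simp only [mem_compl_iff, mem_singleton_iff]; positivity⟩)
  have h3 := (ENNReal.continuous_ofReal.comp ((continuous_norm (E := ℂ)).pow 2)).tendsto _ |>.comp h2
  have h4 : ‖Complex.I * (y : ℂ)‖ ^ 2 = y ^ 2 := by simp
  simp only [Function.comp_apply, Pi.pow_apply, h4] at h3
  refine h3.congr fun m => ?_
  have hm : (0 : ℝ) < (m : ℝ) + 1 := by positivity
  simp only [Function.comp_apply, Pi.pow_apply, slope_def_module]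
  rw [← ofReal_norm, ← ENNReal.ofReal_pow (norm_nonneg _), ← ENNReal.ofReal_mul (by positivity),
    norm_smul, mul_pow, sub_zero, one_div, inv_inv, Real.norm_of_nonneg hm.le]
  congr 3
  simp only [modulation, inner_smul_left, hy]
  simp
  congr 3
  ring

/-- Fatou's lemma along s = 1/(m+1): a bound of order s on the increments in direction b passes to
the derivative in that direction. -/
theorem lintegral_inner_sq_le {n : ℕ} {G : Rn n → ℂ} (hG : AEStronglyMeasurable G volume)
    {b : Rn n} {K : ℝ≥0∞} (h : ∀ s : ℝ, 0 < s →
      eLpNorm (fun ξ => (modulation (s • b) ξ - 1) * G ξ) 2 volume ^ 2 ≤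
        ENNReal.ofReal (s ^ 2) * K) :
    ∫⁻ ξ, ENNReal.ofReal ((2 * Real.pi * inner ℝ b ξ) ^ 2) * ‖G ξ‖ₑ ^ 2 ≤ K := by
  set g : ℕ → Rn n → ℝ≥0∞ := fun m ξ => ENNReal.ofReal (((m : ℝ) + 1) ^ 2) *
    ‖modulation ((1 / ((m : ℝ) + 1)) • b) ξ - 1‖ₑ ^ 2 * ‖G ξ‖ₑ ^ 2 with hg
  have hlim : ∀ ξ, ENNReal.ofReal ((2 * Real.pi * inner ℝ b ξ) ^ 2) * ‖G ξ‖ₑ ^ 2 =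
      liminf (fun m => g m ξ) atTop := fun ξ =>
    (ENNReal.Tendsto.mul_const (tendsto_modulation_sub_one b ξ)
      (Or.inr (by finiteness))).liminf_eq.symm
  simp_rw [hlim]
  refine (lintegral_liminf_le' fun m => ?_).trans ?_
  · exact ((((continuous_modulation _).sub continuous_const).measurable.enorm.pow_const 2).const_mul
      _).aemeasurable.mul (hG.enorm.pow_const 2)
  · refine liminf_le_of_le (by isBoundedDefault) fun B hB => ?_
    obtain ⟨m, hm⟩ := hB.exists
    refine hm.trans ?_
    have hm0 : (0 : ℝ) < (m : ℝ) + 1 := by positivity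
    have := h (1 / ((m : ℝ) + 1)) (by positivity)
    rw [eLpNorm_two_sq] at this
    simp_rw [hg, mul_assoc]
    rw [lintegral_const_mul' _ _ ENNReal.ofReal_ne_top]
    simp_rw [enorm_mul, mul_pow] at this
    refine (mul_le_mul_right this _).trans_eq ?_
    rw [← mul_assoc, ← ENNReal.ofReal_mul (by positivity)]
    rw [show ((m : ℝ) + 1) ^ 2 * (1 / ((m : ℝ) + 1)) ^ 2 = 1 by field_simp, ENNReal.ofReal_one,
      one_mul]

/-- Since r² is the sum of the squares (2πξ_j)², the gradient can be estimated one coordinate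
direction at a time. -/
theorem homNorm_one_sq {n : ℕ} {G : Rn n → ℂ} (hG : AEStronglyMeasurable G volume) :
    homNorm 1 G ^ 2 = ∑ j, ∫⁻ ξ, ENNReal.ofReal
      ((2 * Real.pi * inner ℝ (EuclideanSpace.single j (1 : ℝ)) ξ) ^ 2) * ‖G ξ‖ₑ ^ 2 := by
  rw [homNorm_sq, ← lintegral_finsetSum' _ fun j _ => ?_]
  · refine lintegral_congr fun ξ => ?_
    rw [← Finset.sum_mul, ← ENNReal.ofReal_sum_of_nonneg fun j _ => by positivity]
    congr 2
    simp only [mul_one, Real.rpow_two, EuclideanSpace.inner_single_left, map_one, one_mul]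
    simp_rw [mul_pow, ← Finset.mul_sum]
    rw [EuclideanSpace.norm_sq_eq]
    simp
  · refine AEMeasurable.mul ?_ (hG.enorm.pow_const 2)
    exact (ENNReal.measurable_ofReal.comp (by fun_prop)).aemeasurable

theorem integrable_modulation_mul {n : ℕ} (a : Rn n) {F : Rn n → ℂ} (hF : Integrable F) :
    Integrable fun ξ => modulation a ξ * F ξ :=
  hF.bdd_mul (c := 1) (continuous_modulation a).aestronglyMeasurable
    (Eventually.of_forall fun ξ => (norm_modulation a ξ).le)

theorem memLp_modulation_mul {n : ℕ} (a : Rn n) {F : Rn n → ℂ} (hF : MemLp F 2) :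
    MemLp (fun ξ => modulation a ξ * F ξ) 2 :=
  hF.of_le ((continuous_modulation a).aestronglyMeasurable.mul hF.1)
    (Eventually.of_forall fun ξ => by rw [norm_mul, norm_modulation, one_mul])

theorem eLpNorm_translate_sub {n : ℕ} {U : Rn n → ℂ} (h1 : Integrable U) (h2 : MemLp U 2) (a : Rn n) :
    eLpNorm (fun x => U (x + a) - U x) 2 volume =
      eLpNorm (fun ξ => (modulation a ξ - 1) * 𝓕 U ξ) 2 volume := by
  have h1' : Integrable fun x => U (x + a) := h1.comp_add_right a
  have h2' : MemLp (fun x => U (x + a)) 2 :=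
    h2.comp_measurePreserving (measurePreserving_add_right volume a)
  rw [((IsL2Fourier.of_integrable h1' h2').sub (IsL2Fourier.of_integrable h1 h2)).eLpNorm_eq]
  congr 1
  ext ξ
  rw [fourier_comp_add_right, sub_mul, one_mul, modulation]

theorem eLpNorm_fourierInv_translate_sub {n : ℕ} {F : Rn n → ℂ} (h1 : Integrable F) (h2 : MemLp F 2)
    (a : Rn n) : eLpNorm (fun x => 𝓕⁻ F (x + a) - 𝓕⁻ F x) 2 volume =
      eLpNorm (fun ξ => (modulation a ξ - 1) * F ξ) 2 volume := by
  have e := ((IsL2Fourier.of_integrable_right (integrable_modulation_mul a h1)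
    (memLp_modulation_mul a h2)).sub (IsL2Fourier.of_integrable_right h1 h2)).eLpNorm_eq
  simp_rw [sub_mul, one_mul, fourierInv_comp_add_right]
  exact e

/-- Chain rule: the gradient of `f(u)` in `L²` for bounded `u`. -/
theorem IsPowerNonlinearity.exists_homNorm_one_le {p : ℝ} (hp : 1 ≤ p) {f : ℝ → ℝ}
    (hf : IsPowerNonlinearity p f) (n : ℕ) :
    ∃ C : ℝ, 0 < C ∧ ∀ U F : Rn n → ℂ, IsL2Fourier U F → Integrable (nonlin f U) →
      MemLp (nonlin f U) 2 → ∀ M : ℝ, 0 ≤ M → ∫⁻ ξ, ‖F ξ‖ₑ ≤ ENNReal.ofReal M →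
      homNorm 1 (𝓕 (nonlin f U)) ≤ ENNReal.ofReal (C * M ^ (p - 1)) * homNorm 1 F := by
  obtain ⟨C, hC, hlip⟩ := hf.exists_abs_sub_le hp
  refine ⟨C * 2 ^ (p - 1) + 1, by positivity, fun U F hU hN1 hN2 M hM hF => ?_⟩
  have hFint : Integrable F := ⟨hU.memLp_right.1, hF.trans_lt ENNReal.ofReal_lt_top⟩
  -- The integrability of F provides a representative bounded everywhere by M, on whose range f is
  -- Lipschitz with the constant L below.
  have hUV : U =ᵐ[volume] 𝓕⁻ F :=
    hU.ae_eq_left (IsL2Fourier.of_integrable_right hFint hU.memLp_right)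
  set V := 𝓕⁻ F with hV
  have hNV : nonlin f U =ᵐ[volume] nonlin f V := by
    filter_upwards [hUV] with x hx
    rw [nonlin, nonlin, hx]
  have hN1 := hN1.congr hNV
  have hN2 := hN2.ae_eq hNV
  have hNeq : 𝓕 (nonlin f U) = 𝓕 (nonlin f V) := funext (Real.fourier_congr_ae hNV)
  rw [hNeq]
  have hVM : ∀ x, ‖V x‖ ≤ M := fun x => by
    refine (norm_fourierInv_le_integral F x).trans ?_
    rw [integral_norm_eq_lintegral_enorm hFint.1]
    exact ENNReal.toReal_le_of_le_ofReal hM hF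
  set L := C * (M + M) ^ (p - 1) with hL
  have hL0 : 0 ≤ L := by positivity
  have hlipV : ∀ x y, ‖nonlin f V x - nonlin f V y‖ ≤ L * ‖V x - V y‖ := fun x y => by
    rw [nonlin, nonlin, ← Complex.ofReal_sub, Complex.norm_real, Real.norm_eq_abs]
    refine (hlip _ _).trans ?_
    have e1 : |(V x).re| ≤ M := (Complex.abs_re_le_norm _).trans (hVM x)
    have e2 : |(V y).re| ≤ M := (Complex.abs_re_le_norm _).trans (hVM y)
    have e3 : |(V x).re - (V y).re| ≤ ‖V x - V y‖ := by
      rw [← Complex.sub_re]; exact Complex.abs_re_le_norm _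
    rw [hL]
    gcongr
  have hmod (a : Rn n) : eLpNorm (fun ξ => (modulation a ξ - 1) * 𝓕 (nonlin f V) ξ) 2 volume ≤
      ENNReal.ofReal L * eLpNorm (fun ξ => (modulation a ξ - 1) * F ξ) 2 volume := by
    rw [← eLpNorm_translate_sub hN1 hN2, ← eLpNorm_fourierInv_translate_sub hFint hU.memLp_right]
    exact eLpNorm_le_mul_eLpNorm_of_ae_le_mul
      (Eventually.of_forall fun x => hlipV _ _) 2
  have hmain : homNorm 1 (𝓕 (nonlin f V)) ≤ ENNReal.ofReal L * homNorm 1 F := by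
    have hGm := (continuous_fourier_of_integrable hN1).aestronglyMeasurable (μ := volume)
    rw [← ENNReal.pow_le_pow_left_iff two_ne_zero, mul_pow, homNorm_one_sq hGm,
      homNorm_one_sq hU.memLp_right.1, Finset.mul_sum]
    -- Increments of f(V) are controlled by those of V. Fatou turns the former into a derivative,
    -- and |e^{iy} - 1| ≤ |y| bounds the latter by one.
    refine Finset.sum_le_sum fun j _ => lintegral_inner_sq_le hGm fun s hs => ?_
    refine (pow_le_pow_left' (hmod _) 2).trans ?_
    rw [mul_pow, ← mul_assoc, mul_comm _ (ENNReal.ofReal L ^ 2), mul_assoc]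
    refine mul_le_mul_right ?_ _
    rw [eLpNorm_two_sq, ← lintegral_const_mul' _ _ ENNReal.ofReal_ne_top]
    refine lintegral_mono fun ξ => ?_
    rw [enorm_mul, mul_pow, ← mul_assoc, ← ENNReal.ofReal_mul (by positivity)]
    refine mul_le_mul_left ((enorm_modulation_sub_one_le _ _).trans_eq ?_) _
    rw [real_inner_smul_left]
    congr 1
    ring
  refine hmain.trans (mul_le_mul_left (ENNReal.ofReal_le_ofReal ?_) _)
  rw [hL, ← two_mul, Real.mul_rpow (by norm_num) hM, ← mul_assoc]
  have : 0 ≤ M ^ (p - 1) := by positivity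
  nlinarith


/-! ### Decay of derivatives above the energy level. -/

/-- Decay of derivatives of order `k < 2` for the right-hand side of the integral equation. -/
theorem exists_homNorm_mild_le {n : ℕ} {α k : ℝ} (hα : 1 < α) (hk0 : 0 ≤ k) (hk2 : k < 2)
    {φ ψ : Rn n → ℂ} {h : ℝ → Rn n → ℂ} (hφ : AEStronglyMeasurable φ volume)
    (hψ : AEStronglyMeasurable ψ volume) (hφk : homNorm k φ < ∞) {D : ℝ} (hψb : ∀ ξ, ‖ψ ξ‖ ≤ D)
    (hψ2 : eLpNorm ψ 2 volume < ∞) (hh : Continuous (Function.uncurry h)) {A : ℝ} (hA : 0 ≤ A)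
    (hb : ∀ τ, 0 ≤ τ → ∀ ξ, ‖h τ ξ‖ ≤ A * (1 + τ) ^ (-α))
    (hb2 : ∀ τ, 0 ≤ τ → eLpNorm (h τ) 2 volume ≤ ENNReal.ofReal (A * (1 + τ) ^ (-(α + n / 4)))) :
    ∃ B : ℝ, 0 ≤ B ∧ ∀ t, 0 ≤ t →
      homNorm k (mild φ ψ h t) ≤ ENNReal.ofReal (B * (1 + t) ^ (-((n : ℝ) / 4 + k / 2))) := by
  obtain ⟨C1, hC1, h1⟩ := exists_homNorm_linear_le (n := n) hk0 hk2.le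
  obtain ⟨C2, hC2, h2⟩ := exists_homNorm_duhamel_le (n := n) hα le_rfl hk0 hk2
  set d := max D ((homNorm k φ).toReal + (eLpNorm ψ 2 volume).toReal) with hd
  have hd0 : 0 ≤ d := le_max_of_le_right (by positivity)
  have hd1 : homNorm k φ ≤ ENNReal.ofReal d := by
    rw [← ENNReal.ofReal_toReal hφk.ne]
    exact ENNReal.ofReal_le_ofReal (le_max_of_le_right (by linarith [ENNReal.toReal_nonneg (a := eLpNorm ψ 2 volume)]))
  have hd2 : eLpNorm ψ 2 volume ≤ ENNReal.ofReal d := by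
    rw [← ENNReal.ofReal_toReal hψ2.ne]
    exact ENNReal.ofReal_le_ofReal (le_max_of_le_right (by linarith [ENNReal.toReal_nonneg (a := homNorm k φ)]))
  have hb2' : ∀ τ, 0 ≤ τ → homNorm 0 (h τ) ≤
      ENNReal.ofReal (A * (1 + τ) ^ (-(α + (n : ℝ) / 4 + 0 / 2))) := fun τ hτ => by
    rw [homNorm_zero_eq, zero_div, add_zero]
    exact hb2 τ hτ
  refine ⟨C1 * d + C2 * A, by positivity, fun t ht => ?_⟩
  have hK : Measurable fun ξ : Rn n => (symbolK1 t ξ : ℂ) :=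
    Complex.measurable_ofReal.comp (measurable_symbolK1.comp (measurable_const.prodMk measurable_id))
  have e2 := h2 h hh A hA hb hb2' t ht
  rw [zero_add] at e2
  refine (homNorm_add_le k ((aestronglyMeasurable_const.mul hφ).add
    (hK.aestronglyMeasurable.mul hψ))
    (stronglyMeasurable_integral_symbolK1_mul hh t 0 t).aestronglyMeasurable).trans
    ((add_le_add (h1 φ ψ hφ hψ d hd0 hd1 (fun ξ => (hψb ξ).trans (le_max_left _ _)) hd2 t ht)
      e2).trans_eq ?_)
  rw [← ENNReal.ofReal_add (by positivity) (by positivity), ← add_mul]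

theorem eLpNorm_le_energy {n : ℕ} {T : ℝ} (hT : 0 < T) (F : Rn n → ℂ) :
    eLpNorm F 2 volume ≤ energy T F := by
  have := homNorm_le_energy le_rfl zero_le_one hT F
  rwa [homNorm_zero_eq, zero_div, neg_zero, Real.rpow_zero, ENNReal.ofReal_one, one_mul] at this

/-- Decay of the gradient of the nonlinear term along a decaying solution with `3/2`
derivatives in `L²`. -/
theorem IsH1Curve.exists_homNorm_one_nonlinHat_le {n : ℕ} (hn : 0 < n) (hn2 : n ≤ 2) {p : ℝ}
    (hp : 2 < p) {f : ℝ → ℝ} (hf : IsPowerNonlinearity p f)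
    {U F : ℝ → Rn n → ℂ} (hU : IsH1Curve U F) {ρ B : ℝ} (hρ : 0 ≤ ρ)
    (hE : ∀ t, 0 ≤ t → energy (1 + t) (F t) ≤ ENNReal.ofReal (ρ * (1 + t) ^ (-((n : ℝ) / 4))))
    (h3 : ∀ t, 0 ≤ t → homNorm (3 / 2) (F t) ≤
      ENNReal.ofReal (B * (1 + t) ^ (-((n : ℝ) / 4 + 3 / 2 / 2)))) :
    ∃ A : ℝ, 0 ≤ A ∧ ∀ τ, 0 ≤ τ → homNorm 1 (nonlinHat f U τ) ≤
      ENNReal.ofReal (A * (1 + τ) ^ (-((n : ℝ) * (p - 1) / 2 + n / 4 + 1 / 2))) := by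
  obtain ⟨C1, hC1, h1⟩ := exists_lintegral_enorm_le hn2
  obtain ⟨C2, hC2, h2⟩ := hf.exists_homNorm_one_le (by linarith) n
  set R := max ρ B
  have hR : 0 ≤ R := le_max_of_le_left hρ
  refine ⟨C2 * (C1 * R) ^ (p - 1) * ρ, by positivity, fun τ hτ => ?_⟩
  have hT : 0 < 1 + τ := by linarith
  have hL := hU.isL2Fourier τ hτ
  have hN := memLp_nonlin hn hn2 hp hf hL (hU.energy_lt_top τ hτ)
  -- At scale T = 1 + τ this bounds the L¹ norm of the transform by a multiple of (1+τ)^{-n/2}. Its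
  -- power p - 1 has the rate n(p-1)/2, and the gradient of u contributes the remaining n/4 + 1/2.
  have e1 := h1 (F τ) hL.memLp_right.1 (1 + τ) (R * (1 + τ) ^ (-((n : ℝ) / 4))) hT (by positivity)
    (((eLpNorm_le_energy hT _).trans (hE τ hτ)).trans (ENNReal.ofReal_le_ofReal (by
      gcongr; exact le_max_left _ _)))
    ((h3 τ hτ).trans (ENNReal.ofReal_le_ofReal (by
      rw [mul_assoc, ← Real.rpow_add hT]
      rw [show -((n : ℝ) / 4) + -(3 / 4) = -((n : ℝ) / 4 + 3 / 2 / 2) by ring]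
      gcongr; exact le_max_right _ _)))
  have e2 := h2 (U τ) (F τ) hL hN.1 hN.2 _ (by positivity) e1
  have e3 : homNorm 1 (F τ) ≤ ENNReal.ofReal ((1 + τ) ^ (-(1 / 2) : ℝ)) *
      ENNReal.ofReal (ρ * (1 + τ) ^ (-((n : ℝ) / 4))) :=
    (homNorm_le_energy zero_le_one le_rfl hT _).trans (mul_le_mul_right (hE τ hτ) _)
  rw [nonlinHat, max_eq_left hτ]
  refine e2.trans ((mul_le_mul_right e3 _).trans_eq ?_)
  rw [← ENNReal.ofReal_mul (by positivity), ← ENNReal.ofReal_mul (by positivity)]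
  congr 1
  rw [show C1 * (1 + τ) ^ (-((n : ℝ) / 4)) * (R * (1 + τ) ^ (-((n : ℝ) / 4))) =
    C1 * R * ((1 + τ) ^ (-((n : ℝ) / 4)) * (1 + τ) ^ (-((n : ℝ) / 4))) by ring,
    ← Real.rpow_add hT, Real.mul_rpow (x := C1 * R) (by positivity) (by positivity),
    ← Real.rpow_mul hT.le,
    show -((n : ℝ) * (p - 1) / 2 + n / 4 + 1 / 2) =
      (-((n : ℝ) / 4) + -((n : ℝ) / 4)) * (p - 1) + -(1 / 2) + -((n : ℝ) / 4) by ring,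
    Real.rpow_add hT, Real.rpow_add hT]
  ring


/-! ### Asymptotic profile of the linear flow. -/

theorem rad_zero {n : ℕ} : rad (0 : Rn n) = 0 := by simp [rad]

theorem rad_smul {n : ℕ} {c : ℝ} (hc : 0 ≤ c) (ξ : Rn n) : rad (c • ξ) = c * rad ξ := by
  simp only [rad, norm_smul, Real.norm_of_nonneg hc]
  ring

/-- Heat kernels concentrate at zero frequency. -/
theorem tendsto_homNorm_exp_mul {n : ℕ} {k : ℝ} (hk : 0 ≤ k) {ω : Rn n → ℝ} (hω : Measurable ω)
    {D : ℝ} (hD : ∀ ξ, |ω ξ| ≤ D) (h0 : Tendsto ω (𝓝 0) (𝓝 0)) :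
    Tendsto (fun t : ℝ => ENNReal.ofReal (t ^ ((n : ℝ) / 4 + k / 2)) *
      homNorm k (fun ξ => (Real.exp (-(t * rad ξ ^ 2)) : ℂ) * (ω ξ : ℂ))) atTop (𝓝 0) := by
  -- This is the squared integrand after the substitution ξ = η/√t, which cancels the power of t in
  -- front. The factor ω is evaluated at η/√t, which tends to 0, so dominated convergence applies.
  set g : ℝ → Rn n → ℝ≥0∞ := fun t η => ENNReal.ofReal (rad η ^ (2 * k)) *
    ‖(Real.exp (-(1 * rad η ^ 2)) : ℂ) * (ω ((Real.sqrt t)⁻¹ • η) : ℂ)‖ₑ ^ 2 with hg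
  have hgm (t : ℝ) : Measurable (g t) := by
    have h1 : Measurable fun η : Rn n => ω ((Real.sqrt t)⁻¹ • η) :=
      hω.comp (measurable_const_smul _)
    refine (ENNReal.measurable_ofReal.comp (measurable_rad_rpow (2 * k))).mul
      (Measurable.pow_const (Measurable.enorm (Measurable.mul ?_
        (Complex.measurable_ofReal.comp h1))) 2)
    fun_prop
  have hlim : Tendsto (fun t => ∫⁻ η, g t η) atTop (𝓝 (∫⁻ _ : Rn n, 0)) := by
    refine tendsto_lintegral_filter_of_dominated_convergence
      (fun η => ENNReal.ofReal (rad η ^ (2 * k)) *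
        ‖(Real.exp (-(1 * rad η ^ 2)) : ℂ)‖ₑ ^ 2 * ENNReal.ofReal D ^ 2)
      (Eventually.of_forall hgm) (Eventually.of_forall fun t => Eventually.of_forall fun η => ?_)
      ?_ (Eventually.of_forall fun η => ?_)
    · simp only [hg]
      rw [enorm_mul, mul_pow, ← mul_assoc]
      refine mul_le_mul_right (pow_le_pow_left' ?_ 2) _
      rw [← ofReal_norm, Complex.norm_real]
      exact ENNReal.ofReal_le_ofReal (hD _)
    · rw [lintegral_mul_const' _ _ (by finiteness), ← homNorm_sq]
      obtain ⟨C, -, hC⟩ := exists_homNorm_exp_le (n := n) hk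
      have := (hC 1 one_pos).trans_lt ENNReal.ofReal_lt_top
      exact (ENNReal.mul_lt_top (ENNReal.pow_lt_top this) (by finiteness)).ne
    · have h1 : Tendsto (fun t : ℝ => (Real.sqrt t)⁻¹ • η) atTop (𝓝 0) := by
        have := (tendsto_inv_atTop_zero.comp Real.tendsto_sqrt_atTop).smul_const η
        simpa using this
      have h2 : Tendsto (fun t : ℝ => (Real.exp (-(1 * rad η ^ 2)) : ℂ) *
          (ω ((Real.sqrt t)⁻¹ • η) : ℂ)) atTop (𝓝 0) := by
        have := ((Complex.continuous_ofReal.tendsto 0).comp (h0.comp h1)).const_mul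
          (Real.exp (-(1 * rad η ^ 2)) : ℂ)
        simpa [Function.comp_def] using this
      have h3 := ((ENNReal.continuous_pow 2).comp (continuous_enorm (E := ℂ))).tendsto 0 |>.comp h2
      have h4 := ENNReal.Tendsto.const_mul (a := ENNReal.ofReal (rad η ^ (2 * k))) h3
        (Or.inr ENNReal.ofReal_ne_top)
      simpa [Function.comp_def, hg] using h4
  rw [lintegral_zero] at hlim
  have h2 := (ENNReal.continuous_rpow_const (y := (1 / 2 : ℝ))).tendsto 0 |>.comp hlim
  rw [ENNReal.zero_rpow_of_pos (by norm_num)] at h2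
  refine h2.congr' ?_
  filter_upwards [eventually_gt_atTop 0] with t ht
  have hst := Real.sqrt_pos.2 ht
  have e1 := lintegral_comp_smul_pos (hgm t) hst
  have e2 : ∀ ξ : Rn n, g t (Real.sqrt t • ξ) = ENNReal.ofReal (t ^ k) *
      (ENNReal.ofReal (rad ξ ^ (2 * k)) *
        ‖(Real.exp (-(t * rad ξ ^ 2)) : ℂ) * (ω ξ : ℂ)‖ₑ ^ 2) := fun ξ => by
    simp only [hg]
    rw [rad_smul hst.le, Real.mul_rpow hst.le (rad_nonneg ξ), Real.rpow_mul hst.le, Real.rpow_two,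
      Real.sq_sqrt ht.le, ENNReal.ofReal_mul (by positivity), smul_smul, inv_mul_cancel₀ hst.ne',
      one_smul, mul_pow, Real.sq_sqrt ht.le, one_mul, mul_assoc]
  simp_rw [e2] at e1
  rw [lintegral_const_mul' _ _ ENNReal.ofReal_ne_top, ← homNorm_sq] at e1
  have e3 : ∫⁻ η, g t η = (ENNReal.ofReal (t ^ ((n : ℝ) / 4 + k / 2)) *
      homNorm k (fun ξ => (Real.exp (-(t * rad ξ ^ 2)) : ℂ) * (ω ξ : ℂ))) ^ 2 := by
    have e4 : ENNReal.ofReal (Real.sqrt t ^ (n : ℝ)) * ENNReal.ofReal (Real.sqrt t ^ (-(n : ℝ))) = 1 := by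
      rw [← ENNReal.ofReal_mul (by positivity), ← Real.rpow_add hst, add_neg_cancel, Real.rpow_zero,
        ENNReal.ofReal_one]
    rw [← one_mul (∫⁻ η, g t η), ← e4, mul_assoc, ← e1, mul_pow, ← mul_assoc,
      ← ENNReal.ofReal_mul (by positivity), ← ENNReal.ofReal_pow (by positivity)]
    congr 2
    rw [Real.sqrt_eq_rpow, ← Real.rpow_mul ht.le, ← Real.rpow_add ht, ← Real.rpow_natCast,
      ← Real.rpow_mul ht.le]
    congr 1
    push_cast
    ring
  simp only [Function.comp_apply]
  rw [e3, ← ENNReal.rpow_natCast, ← ENNReal.rpow_mul]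
  norm_num

/-- The deviation at frequency `ξ` of `K₁(t-τ)g` from its leading part `g(0)e^{-t|ξ|²}`. -/
noncomputable def lowDefect {n : ℕ} (τ : ℝ) (g : Rn n → ℂ) (ξ : Rn n) : ℝ :=
  if rad ξ ^ 2 ≤ 1 / 2 then ‖((Real.exp (τ * rad ξ ^ 2) / (1 - rad ξ ^ 2) : ℝ) : ℂ) * g ξ - g 0‖
  else ‖g 0‖

theorem measurable_lowDefect {n : ℕ} (τ : ℝ) {g : Rn n → ℂ} (hg : Continuous g) :
    Measurable (lowDefect τ g) := by
  have := hg.measurable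
  refine Measurable.ite (measurableSet_le (by fun_prop) measurable_const) ?_ measurable_const
  refine Measurable.norm (Measurable.sub (Measurable.mul (Complex.measurable_ofReal.comp ?_) this)
    measurable_const)
  fun_prop

theorem lowDefect_nonneg {n : ℕ} (τ : ℝ) (g : Rn n → ℂ) (ξ : Rn n) : 0 ≤ lowDefect τ g ξ := by
  unfold lowDefect; split_ifs <;> positivity

theorem lowDefect_le {n : ℕ} {τ : ℝ} (hτ : 0 ≤ τ) {g : Rn n → ℂ} {D : ℝ} (hD : ∀ ξ, ‖g ξ‖ ≤ D)
    (ξ : Rn n) : lowDefect τ g ξ ≤ 2 * Real.exp τ * D + D := by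
  have hD0 : 0 ≤ D := (norm_nonneg _).trans (hD 0)
  unfold lowDefect
  split_ifs with h
  · refine (norm_sub_le _ _).trans (add_le_add ?_ (hD 0))
    rw [norm_mul, Complex.norm_real, Real.norm_of_nonneg (div_nonneg (Real.exp_pos _).le (by linarith))]
    refine mul_le_mul ?_ (hD ξ) (norm_nonneg _) (by positivity)
    rw [div_le_iff₀ (by linarith)]
    have : Real.exp (τ * rad ξ ^ 2) ≤ Real.exp τ := Real.exp_le_exp.2 (by nlinarith)
    nlinarith [Real.exp_pos τ]
  · exact (hD 0).trans (le_add_of_nonneg_left (by positivity))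

/-- At zero frequency the factor e^{τr²}/(1-r²) equals 1, and g is continuous there. -/
theorem tendsto_lowDefect {n : ℕ} (τ : ℝ) {g : Rn n → ℂ} (hg : Continuous g) :
    Tendsto (lowDefect τ g) (𝓝 0) (𝓝 0) := by
  have h1 : ∀ᶠ ξ : Rn n in 𝓝 0, rad ξ ^ 2 < 1 / 2 := by
    have : Continuous fun ξ : Rn n => rad ξ ^ 2 := by fun_prop
    exact this.tendsto 0 (gt_mem_nhds (by rw [rad_zero]; norm_num))
  have h2 : ContinuousAt (fun ξ : Rn n =>
      ‖((Real.exp (τ * rad ξ ^ 2) / (1 - rad ξ ^ 2) : ℝ) : ℂ) * g ξ - g 0‖) 0 := by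
    have h3 : ContinuousAt (fun ξ : Rn n => Real.exp (τ * rad ξ ^ 2) / (1 - rad ξ ^ 2)) 0 :=
      ContinuousAt.div (by fun_prop) (by fun_prop) (by rw [rad_zero]; norm_num)
    exact (((Complex.continuous_ofReal.continuousAt.comp h3).mul hg.continuousAt).sub
      continuousAt_const).norm
  have h4 := h2.tendsto
  simp only [rad_zero, mul_zero, ne_eq, OfNat.ofNat_ne_zero, not_false_eq_true, zero_pow,
    Real.exp_zero, sub_zero, div_one, Complex.ofReal_one, one_mul, sub_self,
    norm_zero] at h4
  refine h4.congr' ?_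
  filter_upwards [h1] with ξ hξ
  rw [lowDefect, if_pos hξ.le]

/-- At low frequencies the term e^{-(t-τ)r²}/(1-r²) of K₁ is e^{-tr²} times a factor close to 1 near
the origin. The rest of K₁ there, and all of K₁ at high frequencies, is exponentially small in t - τ
with two derivatives gained. -/
theorem norm_symbolK1_mul_sub_le {n : ℕ} {τ t : ℝ} (ht : τ ≤ t) (g : Rn n → ℂ)
    (ξ : Rn n) : ‖(symbolK1 (t - τ) ξ : ℂ) * g ξ - (Real.exp (-(t * rad ξ ^ 2)) : ℂ) * g 0‖ ≤
      Real.exp (-(t * rad ξ ^ 2)) * lowDefect τ g ξ +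
        Real.exp (-((t - τ) / 4)) * (24 / (1 + rad ξ ^ 2) * ‖g ξ‖) := by
  have hs : 0 ≤ t - τ := by linarith
  have hr : 0 ≤ rad ξ ^ 2 := by positivity
  by_cases h : rad ξ ^ 2 ≤ 1 / 2
  · rw [lowDefect, if_pos h]
    have h1 : 0 < 1 - rad ξ ^ 2 := by linarith
    have e : (symbolK1 (t - τ) ξ : ℂ) * g ξ - (Real.exp (-(t * rad ξ ^ 2)) : ℂ) * g 0 =
        (Real.exp (-(t * rad ξ ^ 2)) : ℂ) *
          (((Real.exp (τ * rad ξ ^ 2) / (1 - rad ξ ^ 2) : ℝ) : ℂ) * g ξ - g 0) -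
        ((Real.exp (-(t - τ)) / (1 - rad ξ ^ 2) : ℝ) : ℂ) * g ξ := by
      have e1 : symbolK1 (t - τ) ξ = Real.exp (-(t * rad ξ ^ 2)) *
          (Real.exp (τ * rad ξ ^ 2) / (1 - rad ξ ^ 2)) - Real.exp (-(t - τ)) / (1 - rad ξ ^ 2) := by
        simp only [symbolK1]
        rw [← mul_div_assoc, ← Real.exp_add, ← sub_div]
        congr 3
        ring
      rw [e1]
      push_cast
      ring
    rw [e]
    refine (norm_sub_le _ _).trans (add_le_add ?_ ?_)
    · rw [norm_mul, Complex.norm_real, Real.norm_of_nonneg (Real.exp_pos _).le]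
    · rw [norm_mul, Complex.norm_real, Real.norm_of_nonneg (by positivity), ← mul_assoc]
      refine mul_le_mul_of_nonneg_right ?_ (norm_nonneg _)
      rw [div_eq_mul_inv]
      refine mul_le_mul (Real.exp_le_exp.2 (by linarith)) ?_ (by positivity) (by positivity)
      rw [← one_div, div_le_div_iff₀ h1 (by positivity)]
      linarith
  · rw [lowDefect, if_neg h]
    push Not at h
    refine (norm_sub_le _ _).trans ?_
    rw [add_comm, norm_mul, norm_mul, Complex.norm_real, Complex.norm_real,
      Real.norm_of_nonneg (Real.exp_pos _).le, Real.norm_of_nonneg (symbolK1_nonneg hs ξ), ← mul_assoc]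
    refine add_le_add le_rfl (mul_le_mul_of_nonneg_right ?_ (norm_nonneg _))
    refine (symbolK1_le hs ξ).trans ?_
    -- Since r² > 1/2, the factor e^{-(t-τ)r²} is at most e^{-(t-τ)/4}, and the remaining e^{-r²} is
    -- at most 1/(1+r²).
    have e1 : Real.exp (-((1 + (t - τ)) * rad ξ ^ 2)) ≤
        Real.exp (-((t - τ) / 4)) * (1 / (1 + rad ξ ^ 2)) := by
      refine le_trans ?_ (mul_le_mul_of_nonneg_left (exp_neg_le_one_div hr) (Real.exp_pos _).le)
      rw [← Real.exp_add, Real.exp_le_exp]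
      nlinarith
    calc _ ≤ 12 * (Real.exp (-((t - τ) / 4)) * (1 / (1 + rad ξ ^ 2)) +
          Real.exp (-((t - τ) / 4)) / (1 + rad ξ ^ 2)) := by gcongr
      _ = _ := by ring

theorem tendsto_ofReal_rpow_mul_exp {γ c τ : ℝ} (hc : 0 < c) {b : ℝ≥0∞} (hb : b ≠ ∞) :
    Tendsto (fun t : ℝ => ENNReal.ofReal (t ^ γ) * (ENNReal.ofReal (Real.exp (-(c * (t - τ)))) * b))
      atTop (𝓝 0) := by
  have h1 := (tendsto_rpow_mul_exp_neg_mul_atTop_nhds_zero γ c hc).mul_const (Real.exp (c * τ))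
  rw [zero_mul] at h1
  have h2 := ENNReal.Tendsto.mul_const (b := b) ((ENNReal.continuous_ofReal.tendsto 0).comp h1)
    (Or.inr hb)
  rw [ENNReal.ofReal_zero, zero_mul] at h2
  refine h2.congr' ?_
  filter_upwards [eventually_gt_atTop 0] with t ht
  simp only [Function.comp_apply]
  rw [← mul_assoc, ← ENNReal.ofReal_mul (by positivity), mul_assoc, ← Real.exp_add]
  congr 4
  ring

/-- Asymptotic profile of `K₁(t-τ)g`. -/
theorem tendsto_homNorm_symbolK1_mul_sub {n : ℕ} {k τ D : ℝ} (hk : 0 ≤ k) (hτ : 0 ≤ τ)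
    {g : Rn n → ℂ} (hg : Continuous g) (hD : ∀ ξ, ‖g ξ‖ ≤ D)
    (hgk : wNorm (fun ξ => rad ξ ^ k * (24 / (1 + rad ξ ^ 2))) g < ∞) :
    Tendsto (fun t : ℝ => ENNReal.ofReal (t ^ ((n : ℝ) / 4 + k / 2)) *
      homNorm k (fun ξ => (symbolK1 (t - τ) ξ : ℂ) * g ξ -
        (Real.exp (-(t * rad ξ ^ 2)) : ℂ) * g 0)) atTop (𝓝 0) := by
  have h1 := tendsto_homNorm_exp_mul hk (measurable_lowDefect τ hg)
    (fun ξ => (abs_of_nonneg (lowDefect_nonneg τ g ξ)).trans_le (lowDefect_le hτ hD ξ))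
    (tendsto_lowDefect τ hg)
  have h2 := tendsto_ofReal_rpow_mul_exp (γ := (n : ℝ) / 4 + k / 2) (c := 1 / 4) (τ := τ)
    (by norm_num) hgk.ne
  have h3 := h1.add h2
  rw [add_zero] at h3
  refine tendsto_of_tendsto_of_tendsto_of_le_of_le' tendsto_const_nhds h3
    (Eventually.of_forall fun _ => zero_le) ?_
  filter_upwards [eventually_ge_atTop τ] with t ht
  rw [← mul_add]
  refine mul_le_mul_right ?_ _
  have hwm := measurable_rad_rpow_div (n := n) k
  have hexp : Continuous fun ξ : Rn n => (Real.exp (-(t * rad ξ ^ 2)) : ℂ) := by fun_prop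
  have hm1 : AEStronglyMeasurable (fun ξ : Rn n => (Real.exp (-(t * rad ξ ^ 2)) : ℂ) *
      (lowDefect τ g ξ : ℂ)) volume := (hexp.measurable.mul
    (Complex.measurable_ofReal.comp (measurable_lowDefect τ hg))).aestronglyMeasurable
  set G2 : Rn n → ℂ := fun ξ => ((Real.exp (-((t - τ) / 4)) * (24 / (1 + rad ξ ^ 2)) * ‖g ξ‖ : ℝ) : ℂ)
    with hG2
  have hm2 : AEStronglyMeasurable G2 volume := by
    have := hg.measurable
    refine (Complex.measurable_ofReal.comp ?_).aestronglyMeasurable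
    fun_prop
  have e1 : homNorm k (fun ξ => (symbolK1 (t - τ) ξ : ℂ) * g ξ -
      (Real.exp (-(t * rad ξ ^ 2)) : ℂ) * g 0) ≤
      homNorm k (fun ξ => (Real.exp (-(t * rad ξ ^ 2)) : ℂ) * (lowDefect τ g ξ : ℂ) + G2 ξ) := by
    refine wNorm_le_of_norm_le (w := fun ξ => rad ξ ^ k) (Eventually.of_forall fun ξ => ?_)
    refine (norm_symbolK1_mul_sub_le ht g ξ).trans_eq ?_
    rw [hG2, ← Complex.ofReal_mul, ← Complex.ofReal_add, Complex.norm_real, Real.norm_of_nonneg, mul_assoc]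
    have := lowDefect_nonneg τ g ξ
    positivity
  refine e1.trans ((homNorm_add_le k hm1 hm2).trans (add_le_add le_rfl ?_))
  refine wNorm_le_of_ae (Eventually.of_forall fun ξ => ?_)
  have hr : 0 ≤ rad ξ ^ k := by positivity
  rw [hG2, Complex.norm_real, Real.norm_of_nonneg (by positivity), abs_of_nonneg hr,
    abs_of_nonneg (by positivity), show 1 / 4 * (t - τ) = (t - τ) / 4 by ring]
  exact le_of_eq (by ring)


/-! ### Asymptotic profile of the Duhamel term and of the solution. -/

theorem tendsto_mul_homNorm_add {n : ℕ} {k : ℝ} {a : ℝ → ℝ≥0∞} {G H : ℝ → Rn n → ℂ}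
    (hGm : ∀ t, AEStronglyMeasurable (G t) volume) (hHm : ∀ t, AEStronglyMeasurable (H t) volume)
    (hG : Tendsto (fun t => a t * homNorm k (G t)) atTop (𝓝 0))
    (hH : Tendsto (fun t => a t * homNorm k (H t)) atTop (𝓝 0)) :
    Tendsto (fun t => a t * homNorm k (fun ξ => G t ξ + H t ξ)) atTop (𝓝 0) := by
  have h := hG.add hH
  rw [add_zero] at h
  refine tendsto_of_tendsto_of_tendsto_of_le_of_le tendsto_const_nhds h (fun _ => zero_le)
    fun t => ?_
  change a t * _ ≤ a t * _ + a t * _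
  rw [← mul_add]
  exact mul_le_mul_right (homNorm_add_le k (hGm t) (hHm t)) _

theorem wNorm_rad_rpow_div_le {n : ℕ} {m κ : ℝ} (hm : 0 ≤ m) (h0 : 0 ≤ κ) (h2 : κ ≤ 2)
    (g : Rn n → ℂ) : wNorm (fun ξ => rad ξ ^ (m + κ) * (24 / (1 + rad ξ ^ 2))) g ≤
      ENNReal.ofReal 24 * homNorm m g := by
  refine wNorm_mono g fun ξ => ?_
  have hr := rad_nonneg ξ
  rw [abs_of_nonneg (by positivity), abs_of_nonneg (by positivity),
    Real.rpow_add_of_nonneg hr hm h0, ← mul_div_assoc, div_le_iff₀ (by positivity)]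
  have := mul_le_mul_of_nonneg_left (rpow_le_one_add_sq hr h0 h2) (Real.rpow_nonneg hr m)
  linarith

theorem lintegral_Ioi_one_add_rpow_lt_top {α : ℝ} (hα : 1 < α) (K : ℝ) :
    ∫⁻ τ in Ioi (0 : ℝ), ENNReal.ofReal (K * (1 + τ) ^ (-α)) < ∞ := by
  have h := integrableOn_add_rpow_Ioi_of_lt (a := -α) (c := 0) (m := 1) (by linarith) (by norm_num)
  simp_rw [add_comm _ (1 : ℝ)] at h
  exact (h.const_mul K).lintegral_lt_top

theorem homNorm_mul_const {n : ℕ} (k : ℝ) (F : Rn n → ℂ) (c : ℂ) :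
    homNorm k (fun ξ => F ξ * c) ≤ ENNReal.ofReal ‖c‖ * homNorm k F := by
  refine wNorm_le_of_ae (Eventually.of_forall fun ξ => ?_)
  rw [norm_mul]
  exact le_of_eq (by ring)

theorem rpow_mul_one_add_rpow_neg_le {t γ : ℝ} (ht : 0 ≤ t) (hγ : 0 ≤ γ) :
    t ^ γ * (1 + t) ^ (-γ) ≤ 1 := by
  rw [Real.rpow_neg (by positivity), ← div_eq_mul_inv]
  exact div_le_one_of_le₀ (by gcongr; linarith) (by positivity)

section Far

variable {n : ℕ} {α m κ : ℝ} {h : ℝ → Rn n → ℂ} {A : ℝ}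

/-- The integrand of the Duhamel term at time `t`, with its expected profile removed. -/
noncomputable def duhamelDefect (h : ℝ → Rn n → ℂ) (t τ : ℝ) (ξ : Rn n) : ℂ :=
  (symbolK1 (t - τ) ξ : ℂ) * h τ ξ - (Real.exp (-(t * rad ξ ^ 2)) : ℂ) * h τ 0

theorem measurable_duhamelDefect (hh : Continuous (Function.uncurry h)) (t : ℝ) :
    Measurable (Function.uncurry (duhamelDefect h t)) := by
  refine (measurable_symbolK1_mul hh t).sub (Measurable.mul ?_ ?_)
  · have : Continuous fun z : ℝ × Rn n => (Real.exp (-(t * rad z.2 ^ 2)) : ℂ) := by fun_prop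
    exact this.measurable
  · exact (hh.comp (continuous_fst.prodMk continuous_const)).measurable

/-- A majorant in τ uniform in t ≥ 2τ, integrable when α > 1: for τ ≤ t/2 both K₁(t-τ)h(τ) and its
profile decay at the full heat rate, so the power of t is compensated. -/
theorem exists_homNorm_duhamelDefect_le (hm : 0 ≤ m) (h0 : 0 ≤ κ) (h2 : κ ≤ 2)
    (hh : Continuous (Function.uncurry h)) (hA : 0 ≤ A)
    (hb : ∀ τ, 0 ≤ τ → ∀ ξ, ‖h τ ξ‖ ≤ A * (1 + τ) ^ (-α))
    (hb2 : ∀ τ, 0 ≤ τ →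
      homNorm m (h τ) ≤ ENNReal.ofReal (A * (1 + τ) ^ (-(α + n / 4 + m / 2)))) :
    ∃ K : ℝ, ∀ τ t, 0 < τ → τ ≤ t / 2 →
      ENNReal.ofReal (t ^ ((n : ℝ) / 4 + (m + κ) / 2)) * homNorm (m + κ) (duhamelDefect h t τ) ≤
        ENNReal.ofReal (K * (1 + τ) ^ (-α)) := by
  obtain ⟨C, hC, h1⟩ := exists_homNorm_symbolK1_mul_le (n := n) hm h0 h2
  obtain ⟨C3, hC3, h3⟩ := exists_exp_neg_le_rpow (c := 1 / 8)
    (γ := (n : ℝ) / 4 + (m + κ) / 2) (by norm_num) (by positivity)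
  obtain ⟨C4, hC4, h4⟩ := exists_homNorm_exp_le (n := n) (k := m + κ) (by positivity)
  set γ := (n : ℝ) / 4 + (m + κ) / 2 with hγ
  have hγ0 : 0 ≤ γ := by positivity
  refine ⟨C * A * 2 ^ γ + C * C3 * A + C4 * A, fun τ t hτ hτt => ?_⟩
  have ht : 0 < t := by linarith
  have hP : 0 ≤ (1 + τ) ^ (-α) := by positivity
  have hs : 0 ≤ t - τ := by linarith
  have hcont : Continuous (h τ) := hh.comp (continuous_const.prodMk continuous_id)
  have hK : Measurable fun ξ : Rn n => (symbolK1 (t - τ) ξ : ℂ) :=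
    Complex.measurable_ofReal.comp (measurable_symbolK1.comp (measurable_const.prodMk measurable_id))
  have hE : Continuous fun ξ : Rn n => (Real.exp (-(t * rad ξ ^ 2)) : ℂ) := by fun_prop
  have e1 := h1 (t - τ) hs (h τ) hcont.aestronglyMeasurable (A * (1 + τ) ^ (-α)) (by positivity)
    (hb τ hτ.le)
  have e2 : homNorm m (h τ) ≤ ENNReal.ofReal (A * (1 + τ) ^ (-α)) := by
    refine (hb2 τ hτ.le).trans (ENNReal.ofReal_le_ofReal ?_)
    gcongr
    · linarith
    · have : 0 ≤ (n : ℝ) / 4 := by positivity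
      linarith
  have e3 : homNorm (m + κ) (fun ξ : Rn n => (Real.exp (-(t * rad ξ ^ 2)) : ℂ) * h τ 0) ≤
      ENNReal.ofReal (A * (1 + τ) ^ (-α)) * ENNReal.ofReal (C4 * t ^ (-γ)) := by
    refine (homNorm_mul_const _ _ _).trans ?_
    gcongr
    · exact hb τ hτ.le 0
    · exact h4 t ht
  have e4 : homNorm (m + κ) (duhamelDefect h t τ) ≤ ENNReal.ofReal
      (C * (A * (1 + τ) ^ (-α)) * (1 + (t - τ)) ^ (-γ) +
        C * Real.exp (-((t - τ) / 4)) * (A * (1 + τ) ^ (-α)) +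
        A * (1 + τ) ^ (-α) * (C4 * t ^ (-γ))) := by
    rw [ENNReal.ofReal_add (by positivity) (by positivity), ENNReal.ofReal_add (by positivity)
      (by positivity), ENNReal.ofReal_mul (p := C * Real.exp _) (by positivity),
      ENNReal.ofReal_mul (p := A * (1 + τ) ^ (-α)) (by positivity)]
    refine (wNorm_sub_le (measurable_rad_rpow _)
      (hK.aestronglyMeasurable.mul hcont.aestronglyMeasurable)
      (hE.aestronglyMeasurable.mul aestronglyMeasurable_const)).trans (add_le_add (e1.trans ?_) e3)
    exact add_le_add le_rfl (mul_le_mul_right e2 _)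
  refine (mul_le_mul_right e4 _).trans ?_
  rw [← ENNReal.ofReal_mul (by positivity)]
  refine ENNReal.ofReal_le_ofReal ?_
  have f1 : t ^ γ * (1 + (t - τ)) ^ (-γ) ≤ 2 ^ γ := by
    calc t ^ γ * (1 + (t - τ)) ^ (-γ) ≤ t ^ γ * (2 ^ γ * (1 + t) ^ (-γ)) := by
          gcongr; exact one_add_half_rpow_le ht.le hγ0 (by linarith)
      _ = 2 ^ γ * (t ^ γ * (1 + t) ^ (-γ)) := by ring
      _ ≤ 2 ^ γ * 1 := by gcongr; exact rpow_mul_one_add_rpow_neg_le ht.le hγ0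
      _ = _ := mul_one _
  have f2 : t ^ γ * Real.exp (-((t - τ) / 4)) ≤ C3 := by
    calc t ^ γ * Real.exp (-((t - τ) / 4)) ≤ t ^ γ * (C3 * (1 + t) ^ (-γ)) := by
          gcongr
          exact (Real.exp_le_exp.2 (by linarith)).trans (h3 t ht.le)
      _ = C3 * (t ^ γ * (1 + t) ^ (-γ)) := by ring
      _ ≤ C3 * 1 := by gcongr; exact rpow_mul_one_add_rpow_neg_le ht.le hγ0
      _ = _ := mul_one _
  have f3 : t ^ γ * t ^ (-γ) = 1 := by rw [← Real.rpow_add ht, add_neg_cancel, Real.rpow_zero]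
  calc _ = C * (A * (1 + τ) ^ (-α)) * (t ^ γ * (1 + (t - τ)) ^ (-γ)) +
        C * (A * (1 + τ) ^ (-α)) * (t ^ γ * Real.exp (-((t - τ) / 4))) +
        A * (1 + τ) ^ (-α) * C4 * (t ^ γ * t ^ (-γ)) := by ring
    _ ≤ C * (A * (1 + τ) ^ (-α)) * 2 ^ γ + C * (A * (1 + τ) ^ (-α)) * C3 +
        A * (1 + τ) ^ (-α) * C4 * 1 := by rw [f3]; gcongr
    _ = _ := by ring

/-- Dominated convergence in τ over (0, ∞): for fixed τ the defect is negligible by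
`tendsto_homNorm_symbolK1_mul_sub`, and `exists_homNorm_duhamelDefect_le` provides the majorant. An
indicator takes care of the moving endpoint t/2. -/
theorem tendsto_homNorm_far (hα : 1 < α) (hm : 0 ≤ m) (h0 : 0 ≤ κ) (h2 : κ ≤ 2)
    (hh : Continuous (Function.uncurry h)) (hA : 0 ≤ A)
    (hb : ∀ τ, 0 ≤ τ → ∀ ξ, ‖h τ ξ‖ ≤ A * (1 + τ) ^ (-α))
    (hb2 : ∀ τ, 0 ≤ τ →
      homNorm m (h τ) ≤ ENNReal.ofReal (A * (1 + τ) ^ (-(α + n / 4 + m / 2)))) :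
    Tendsto (fun t : ℝ => ENNReal.ofReal (t ^ ((n : ℝ) / 4 + (m + κ) / 2)) *
      homNorm (m + κ) (fun ξ => ∫ τ in (0 : ℝ)..(t / 2), duhamelDefect h t τ ξ)) atTop (𝓝 0) := by
  obtain ⟨K, hK⟩ := exists_homNorm_duhamelDefect_le hm h0 h2 hh hA hb hb2
  set γ := (n : ℝ) / 4 + (m + κ) / 2 with hγ
  set Φ : ℝ → ℝ → ℝ≥0∞ := fun t => (Iic (t / 2)).indicator fun τ =>
    ENNReal.ofReal (t ^ γ) * homNorm (m + κ) (duhamelDefect h t τ) with hΦ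
  have hlim : Tendsto (fun t => ∫⁻ τ in Ioi (0 : ℝ), Φ t τ) atTop
      (𝓝 (∫⁻ _ in Ioi (0 : ℝ), 0)) := by
    refine tendsto_lintegral_filter_of_dominated_convergence
      (fun τ => ENNReal.ofReal (K * (1 + τ) ^ (-α))) (Eventually.of_forall fun t => ?_)
      (Eventually.of_forall fun t => ?_) (lintegral_Ioi_one_add_rpow_lt_top hα K).ne ?_
    · exact ((measurable_wNorm (measurable_rad_rpow _) (measurable_duhamelDefect hh t)).const_mul
        _).indicator measurableSet_Iic
    · refine (ae_restrict_mem measurableSet_Ioi).mono fun τ hτ => ?_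
      simp only [hΦ, indicator_apply]
      split_ifs with hτt
      · exact hK τ t hτ hτt
      · exact zero_le
    · refine (ae_restrict_mem measurableSet_Ioi).mono fun τ hτ => ?_
      have hτ' : 0 ≤ τ := le_of_lt hτ
      have hcont : Continuous (h τ) := hh.comp (continuous_const.prodMk continuous_id)
      have hlin := tendsto_homNorm_symbolK1_mul_sub (k := m + κ) (by positivity) hτ' hcont (hb τ hτ')
        ((wNorm_rad_rpow_div_le hm h0 h2 _).trans_lt (ENNReal.mul_lt_top ENNReal.ofReal_lt_top
          ((hb2 τ hτ').trans_lt ENNReal.ofReal_lt_top)))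
      exact tendsto_of_tendsto_of_tendsto_of_le_of_le tendsto_const_nhds hlin (fun _ => zero_le)
        fun t => by
          simp only [hΦ, indicator_apply]
          split_ifs
          · exact le_rfl
          · exact zero_le
  rw [lintegral_zero] at hlim
  refine tendsto_of_tendsto_of_tendsto_of_le_of_le' tendsto_const_nhds hlim
    (Eventually.of_forall fun _ => zero_le) ?_
  filter_upwards [eventually_ge_atTop 0] with t ht
  have e := wNorm_integral_le (measurable_rad_rpow (m + κ)) (measurable_duhamelDefect hh t)
    (a := 0) (b := t / 2) (by linarith)
  refine (mul_le_mul_right e _).trans_eq ?_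
  rw [← lintegral_const_mul' _ _ ENNReal.ofReal_ne_top, hΦ, lintegral_indicator measurableSet_Iic,
    Measure.restrict_restrict measurableSet_Iic, inter_comm, Ioi_inter_Iic]
  rfl

theorem integrableOn_apply_zero (hα : 1 < α) (hh : Continuous (Function.uncurry h))
    (hb : ∀ τ, 0 ≤ τ → ∀ ξ, ‖h τ ξ‖ ≤ A * (1 + τ) ^ (-α)) :
    IntegrableOn (fun τ => h τ 0) (Ioi 0) := by
  have h1 := integrableOn_add_rpow_Ioi_of_lt (a := -α) (c := 0) (m := 1) (by linarith) (by norm_num)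
  simp_rw [add_comm _ (1 : ℝ)] at h1
  refine (h1.const_mul A).mono' (hh.comp (continuous_id.prodMk continuous_const)).aestronglyMeasurable
    ((ae_restrict_mem measurableSet_Ioi).mono fun τ hτ => hb τ (le_of_lt hτ) 0)

/-- Asymptotic profile of decaying solutions of the integral equation. -/
theorem tendsto_homNorm_mild_sub (hα : 1 < α) (hm : 0 ≤ m) (h0 : 0 ≤ κ) (h2 : κ < 2)
    {φ ψ : Rn n → ℂ} (hφ : AEStronglyMeasurable φ volume) (hψ : Continuous ψ)
    (hφk : homNorm (m + κ) φ < ∞) {D : ℝ} (hψD : ∀ ξ, ‖ψ ξ‖ ≤ D)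
    (hψk : wNorm (fun ξ => rad ξ ^ (m + κ) * (24 / (1 + rad ξ ^ 2))) ψ < ∞)
    (hh : Continuous (Function.uncurry h)) (hA : 0 ≤ A)
    (hb : ∀ τ, 0 ≤ τ → ∀ ξ, ‖h τ ξ‖ ≤ A * (1 + τ) ^ (-α))
    (hb2 : ∀ τ, 0 ≤ τ →
      homNorm m (h τ) ≤ ENNReal.ofReal (A * (1 + τ) ^ (-(α + n / 4 + m / 2)))) :
    Tendsto (fun t : ℝ => ENNReal.ofReal (t ^ ((n : ℝ) / 4 + (m + κ) / 2)) *
      homNorm (m + κ) (fun ξ => mild φ ψ h t ξ -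
        (Real.exp (-(t * rad ξ ^ 2)) : ℂ) * (ψ 0 + ∫ τ in Ioi (0 : ℝ), h τ 0))) atTop (𝓝 0) := by
  set γ := (n : ℝ) / 4 + (m + κ) / 2 with hγ
  have hγ0 : 0 ≤ γ := by positivity
  have hK (t : ℝ) : Measurable fun ξ : Rn n => (symbolK1 t ξ : ℂ) :=
    Complex.measurable_ofReal.comp (measurable_symbolK1.comp (measurable_const.prodMk measurable_id))
  have hE (t : ℝ) : Continuous fun ξ : Rn n => (Real.exp (-(t * rad ξ ^ 2)) : ℂ) := by fun_prop
  have hint := integrableOn_apply_zero hα hh hb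
  have hc0 : Continuous fun τ => h τ 0 := hh.comp (continuous_id.prodMk continuous_const)
  set c := ∫ τ in Ioi (0 : ℝ), h τ 0 with hc
  set H : ℝ → Rn n → ℂ := fun t ξ => ∫ τ in (0 : ℝ)..(t / 2), duhamelDefect h t τ ξ with hH
  have hHeq (t : ℝ) : H t = fun ξ => (∫ τ in (0 : ℝ)..(t / 2), (symbolK1 (t - τ) ξ : ℂ) * h τ ξ) -
      (Real.exp (-(t * rad ξ ^ 2)) : ℂ) * ∫ τ in (0 : ℝ)..(t / 2), h τ 0 := by
    ext ξ
    rw [hH, ← intervalIntegral.integral_const_mul, ← intervalIntegral.integral_sub]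
    · rfl
    · exact (continuous_symbolK1_mul hh t ξ).intervalIntegrable _ _
    · exact (hc0.intervalIntegrable _ _).const_mul _
  have m1 (t : ℝ) : AEStronglyMeasurable (fun ξ => (Real.exp (-t) : ℂ) * φ ξ) volume :=
    aestronglyMeasurable_const.mul hφ
  have m2 (t : ℝ) : AEStronglyMeasurable (fun ξ => (symbolK1 (t - 0) ξ : ℂ) * ψ ξ -
      (Real.exp (-(t * rad ξ ^ 2)) : ℂ) * ψ 0) volume :=
    ((hK _).aestronglyMeasurable.mul hψ.aestronglyMeasurable).sub
      ((hE t).aestronglyMeasurable.mul aestronglyMeasurable_const)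
  have m3 (t : ℝ) : AEStronglyMeasurable (H t) volume := by
    rw [hHeq]
    exact (stronglyMeasurable_integral_symbolK1_mul hh t 0 (t / 2)).aestronglyMeasurable.sub
      ((hE t).aestronglyMeasurable.mul aestronglyMeasurable_const)
  have m4 (t : ℝ) : AEStronglyMeasurable (fun ξ => ∫ τ in (t / 2)..t,
      (symbolK1 (t - τ) ξ : ℂ) * h τ ξ) volume :=
    (stronglyMeasurable_integral_symbolK1_mul hh t (t / 2) t).aestronglyMeasurable
  have m5 (t : ℝ) : AEStronglyMeasurable (fun ξ : Rn n => (Real.exp (-(t * rad ξ ^ 2)) : ℂ) *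
      ((∫ τ in (0 : ℝ)..(t / 2), h τ 0) - c)) volume :=
    (hE t).aestronglyMeasurable.mul aestronglyMeasurable_const
  -- Five negligible pieces make up the difference: e^{-t}φ, K₁ψ minus its profile, the earlier half
  -- of the Duhamel term minus its profile, the later half, and the profile carrying the missing
  -- tail of the mass integral.
  have t1 : Tendsto (fun t : ℝ => ENNReal.ofReal (t ^ γ) *
      homNorm (m + κ) (fun ξ => (Real.exp (-t) : ℂ) * φ ξ)) atTop (𝓝 0) := by
    refine tendsto_of_tendsto_of_tendsto_of_le_of_le tendsto_const_nhds
      (tendsto_ofReal_rpow_mul_exp (γ := γ) (c := 1) (τ := 0) one_pos hφk.ne)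
      (fun _ => zero_le) fun t => mul_le_mul_right ?_ _
    refine wNorm_le_of_ae (Eventually.of_forall fun ξ => ?_)
    rw [norm_mul, Complex.norm_real, Real.norm_of_nonneg (Real.exp_pos _).le, one_mul, sub_zero]
    exact le_of_eq (by ring)
  have t2 := tendsto_homNorm_symbolK1_mul_sub (k := m + κ) (by positivity) le_rfl hψ hψD hψk
  have t3 := tendsto_homNorm_far hα hm h0 h2.le hh hA hb hb2
  have t4 : Tendsto (fun t : ℝ => ENNReal.ofReal (t ^ γ) * homNorm (m + κ)
      (fun ξ => ∫ τ in (t / 2)..t, (symbolK1 (t - τ) ξ : ℂ) * h τ ξ)) atTop (𝓝 0) := by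
    obtain ⟨C, hC, hn⟩ := exists_homNorm_duhamel_near_le (n := n) hα hm h0 h2
    have l1 : Tendsto (fun t : ℝ => ENNReal.ofReal (C * A * (1 + t) ^ (-(α - 1)))) atTop (𝓝 0) := by
      have := ((tendsto_rpow_neg_atTop (show 0 < α - 1 by linarith)).comp
        (tendsto_atTop_add_const_left atTop (1 : ℝ) tendsto_id)).const_mul (C * A)
      rw [mul_zero] at this
      have := (ENNReal.continuous_ofReal.tendsto 0).comp this
      rwa [ENNReal.ofReal_zero] at this
    refine tendsto_of_tendsto_of_tendsto_of_le_of_le' tendsto_const_nhds l1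
      (Eventually.of_forall fun _ => zero_le) ?_
    filter_upwards [eventually_ge_atTop 0] with t ht
    refine (mul_le_mul_right (hn h hh A hA hb2 t ht) _).trans ?_
    rw [← ENNReal.ofReal_mul (by positivity)]
    refine ENNReal.ofReal_le_ofReal ?_
    rw [show 1 - α - γ = -(α - 1) + -γ by ring,
      Real.rpow_add (show 0 < 1 + t by linarith)]
    calc _ = C * A * (1 + t) ^ (-(α - 1)) * (t ^ γ * (1 + t) ^ (-γ)) := by ring
      _ ≤ C * A * (1 + t) ^ (-(α - 1)) * 1 := by
        gcongr; exact rpow_mul_one_add_rpow_neg_le ht hγ0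
      _ = _ := mul_one _
  have t5 : Tendsto (fun t : ℝ => ENNReal.ofReal (t ^ γ) * homNorm (m + κ)
      (fun ξ : Rn n => (Real.exp (-(t * rad ξ ^ 2)) : ℂ) * ((∫ τ in (0 : ℝ)..(t / 2), h τ 0) - c))) atTop (𝓝 0) := by
    obtain ⟨C, hC, hg⟩ := exists_homNorm_exp_le (n := n) (k := m + κ) (by positivity)
    have l1 : Tendsto (fun t : ℝ => ENNReal.ofReal (C * ‖(∫ τ in (0 : ℝ)..(t / 2), h τ 0) - c‖))
        atTop (𝓝 0) := by
      have := ((intervalIntegral_tendsto_integral_Ioi 0 hint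
        (tendsto_id.atTop_div_const (show (0 : ℝ) < 2 by norm_num))).sub_const c).norm.const_mul C
      rw [sub_self, norm_zero, mul_zero] at this
      have := (ENNReal.continuous_ofReal.tendsto 0).comp this
      rwa [ENNReal.ofReal_zero] at this
    refine tendsto_of_tendsto_of_tendsto_of_le_of_le' tendsto_const_nhds l1
      (Eventually.of_forall fun _ => zero_le) ?_
    filter_upwards [eventually_gt_atTop 0] with t ht
    refine (mul_le_mul_right ((homNorm_mul_const _ _ _).trans (mul_le_mul_right (hg t ht) _))
      _).trans_eq ?_
    rw [← ENNReal.ofReal_mul (by positivity), ← ENNReal.ofReal_mul (by positivity)]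
    congr 1
    have f3 : t ^ γ * t ^ (-γ) = 1 := by rw [← Real.rpow_add ht, add_neg_cancel, Real.rpow_zero]
    rw [show ∀ x : ℝ, t ^ γ * (x * (C * t ^ (-γ))) = C * x * (t ^ γ * t ^ (-γ)) by intro x; ring,
      f3, mul_one]
  have hsum := tendsto_mul_homNorm_add (fun t => (((m1 t).add (m2 t)).add (m3 t)).add (m4 t)) m5
    (tendsto_mul_homNorm_add (fun t => ((m1 t).add (m2 t)).add (m3 t)) m4
      (tendsto_mul_homNorm_add (fun t => (m1 t).add (m2 t)) m3
        (tendsto_mul_homNorm_add m1 m2 t1 t2) t3) t4) t5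
  refine hsum.congr fun t => ?_
  congr 2
  ext ξ
  simp only [Pi.add_apply]
  rw [hHeq, mild, duhamel_split hh t (t / 2), sub_zero]
  ring

end Far


/-! ### The Gauss kernel. -/

theorem IsL2Fourier.const_mul {n : ℕ} {U F : Rn n → ℂ} (h : IsL2Fourier U F) (c : ℂ) :
    IsL2Fourier (fun x => c * U x) (fun ξ => c * F ξ) := by
  obtain ⟨g, h1, h2⟩ := h
  refine ⟨c • g, ?_, ?_⟩
  · filter_upwards [h1, Lp.coeFn_smul c g] with x a b
    rw [b, a, Pi.smul_apply, smul_eq_mul]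
  · have : 𝓕 (c • g) = c • 𝓕 g := (Lp.fourierTransformₗᵢ (Rn n) ℂ).map_smul c g
    rw [this]
    filter_upwards [h2, Lp.coeFn_smul c (𝓕 g)] with x a b
    rw [b, a, Pi.smul_apply, smul_eq_mul]

theorem integrable_exp_neg_mul_rad_sq {n : ℕ} {t : ℝ} (ht : 0 < t) :
    Integrable fun ξ : Rn n => (Real.exp (-(t * rad ξ ^ 2)) : ℂ) := by
  have hc : Continuous fun ξ : Rn n => Real.exp (-(t * rad ξ ^ 2)) := by fun_prop
  have h1 : Integrable fun ξ : Rn n => Real.exp (-(t * rad ξ ^ 2)) := by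
    refine ⟨hc.aestronglyMeasurable, ?_⟩
    refine lt_of_eq_of_lt (lintegral_congr fun ξ => ?_)
      ((lintegral_exp_neg_mul_rad_sq (n := n) ht).trans_lt ENNReal.ofReal_lt_top)
    rw [← ofReal_norm, Real.norm_of_nonneg (Real.exp_pos _).le]
  exact h1.ofReal

theorem memLp_exp_neg_mul_rad_sq {n : ℕ} {t : ℝ} (ht : 0 < t) :
    MemLp (fun ξ : Rn n => (Real.exp (-(t * rad ξ ^ 2)) : ℂ)) 2 := by
  obtain ⟨C, -, h⟩ := exists_homNorm_exp_le (n := n) (k := 0) le_rfl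
  refine ⟨(integrable_exp_neg_mul_rad_sq ht).1, ?_⟩
  rw [← homNorm_zero_eq]
  exact (h t ht).trans_lt ENNReal.ofReal_lt_top

/-- The transform of the Gauss kernel. -/
theorem isL2Fourier_gaussKernel {n : ℕ} {t : ℝ} (ht : 0 < t) :
    IsL2Fourier (toC (gaussKernel (n := n) t)) fun ξ => (Real.exp (-(t * rad ξ ^ 2)) : ℂ) := by
  refine (IsL2Fourier.of_integrable_right (integrable_exp_neg_mul_rad_sq ht)
    (memLp_exp_neg_mul_rad_sq ht)).congr (Eventually.of_forall fun x => ?_) EventuallyEq.rfl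
  have hπ := Real.pi_pos
  set b : ℝ := 4 * Real.pi ^ 2 * t with hb
  have hb0 : 0 < b := by positivity
  have e1 : (fun ξ : Rn n => (Real.exp (-(t * rad ξ ^ 2)) : ℂ)) =
      fun v => Complex.exp (-(b : ℂ) * ‖v‖ ^ 2) := by
    ext ξ
    rw [Complex.ofReal_exp, hb]
    congr 1
    push_cast
    ring
  rw [e1, Real.fourierInv_eq_fourier_neg, fourier_gaussian_innerProductSpace (by simpa using hb0),
    norm_neg, finrank_euclideanSpace_fin]
  have e2 : (((Real.pi / b) ^ ((n : ℝ) / 2) : ℝ) : ℂ) = ((Real.pi : ℂ) / b) ^ ((n : ℂ) / 2) := by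
    rw [Complex.ofReal_cpow (by positivity)]
    push_cast
    rfl
  have e3 : (Real.pi / b) ^ ((n : ℝ) / 2) = (Real.sqrt (4 * Real.pi * t) ^ n)⁻¹ := by
    rw [show Real.pi / b = (4 * Real.pi * t)⁻¹ by rw [hb]; field_simp, Real.inv_rpow (by positivity),
      Real.sqrt_eq_rpow, ← Real.rpow_natCast, ← Real.rpow_mul (by positivity)]
    congr 2
    ring
  rw [← e2, e3, toC, gaussKernel]
  push_cast
  congr 2
  rw [hb]
  push_cast
  have : (t : ℂ) ≠ 0 := Complex.ofReal_ne_zero.2 ht.ne'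
  have : (Real.pi : ℂ) ≠ 0 := Complex.ofReal_ne_zero.2 hπ.ne'
  field_simp

/-! ### Recovering the regularity of the source; interpolation. -/

/-- The converse, up to a constant, of `symbolK1_le_div` at time 1: K₁(1) gains no more than two
derivatives, so it can be inverted on the scale of Sobolev norms. On the sphere r = 1 the quotient
is 0 by convention and the bound fails. -/
theorem le_symbolK1_one {n : ℕ} {ξ : Rn n} (h : rad ξ ≠ 1) :
    Real.exp (-1) / (1 + rad ξ ^ 2) ≤ symbolK1 1 ξ := by
  have ha : 0 ≤ rad ξ ^ 2 := by positivity
  have ha1 : rad ξ ^ 2 ≠ 1 := fun h2 =>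
    h ((pow_eq_one_iff_of_nonneg (rad_nonneg ξ) two_ne_zero).1 h2)
  simp only [symbolK1]
  change _ ≤ (Real.exp (-1 * rad ξ ^ 2) - Real.exp (-1)) / (1 - rad ξ ^ 2)
  generalize rad ξ ^ 2 = a at ha ha1
  have e : Real.exp (-1 * a) = Real.exp (-1) * Real.exp (1 - a) := by
    rw [← Real.exp_add]; congr 1; ring
  have he := Real.exp_pos (-1)
  rw [e]
  rcases lt_or_gt_of_ne ha1 with h1 | h1
  · rw [div_le_div_iff₀ (by linarith) (by linarith)]
    have h2 := Real.add_one_le_exp (1 - a)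
    have h3 : 1 - a ≤ (Real.exp (1 - a) - 1) * (1 + a) := by nlinarith
    nlinarith
  · rw [← neg_div_neg_eq (Real.exp (-1) * _ - _), div_le_div_iff₀ (by linarith) (by linarith)]
    have h2 : Real.exp (1 - a) * a ≤ 1 := by
      have := Real.add_one_le_exp (a - 1)
      calc Real.exp (1 - a) * a ≤ Real.exp (1 - a) * Real.exp (a - 1) := by gcongr; linarith
        _ = 1 := by rw [← Real.exp_add]; norm_num
    have h3 : a - 1 ≤ (1 - Real.exp (1 - a)) * (1 + a) := by
      have : Real.exp (1 - a) ≤ 1 := Real.exp_le_one_iff.2 (by linarith)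
      nlinarith
    nlinarith

theorem rpow_le_one_add_rpow {y k l : ℝ} (hy : 0 ≤ y) (hk : 0 ≤ k) (hkl : k ≤ l) :
    y ^ k ≤ 1 + y ^ l := by
  rcases le_total y 1 with h | h
  · linarith [Real.rpow_le_one hy h hk, Real.rpow_nonneg hy l]
  · linarith [Real.rpow_le_rpow_of_exponent_le h hkl]

/-- Interpolation between weighted `L²` norms. -/
theorem wNorm_rad_rpow_mul_le {n : ℕ} {k l : ℝ} (hk : 0 ≤ k) (hkl : k ≤ l) {v : Rn n → ℝ}
    (hv : Measurable v) {F : Rn n → ℂ} (hF : AEStronglyMeasurable F volume) :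
    wNorm (fun ξ => rad ξ ^ k * v ξ) F ≤ wNorm v F + wNorm (fun ξ => rad ξ ^ l * v ξ) F := by
  have hvl : Measurable fun ξ => rad ξ ^ l * v ξ := (measurable_rad_rpow l).mul hv
  have h1 : wNorm (fun ξ => rad ξ ^ k * v ξ) F ≤
      ENNReal.ofReal 1 * wNorm (fun ξ => v ξ + rad ξ ^ l * v ξ) F := by
    refine wNorm_mono F fun ξ => ?_
    have hr := rad_nonneg ξ
    rw [one_mul, show v ξ + rad ξ ^ l * v ξ = (1 + rad ξ ^ l) * v ξ by ring, abs_mul, abs_mul,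
      abs_of_nonneg (Real.rpow_nonneg hr k),
      abs_of_nonneg (a := 1 + rad ξ ^ l) (by positivity)]
    exact mul_le_mul_of_nonneg_right (rpow_le_one_add_rpow hr hk hkl) (abs_nonneg _)
  rw [ENNReal.ofReal_one, one_mul] at h1
  exact h1.trans (wNorm_add_weight_le hv hvl hF)

theorem homNorm_lt_top_of_le {n : ℕ} {k l : ℝ} (hk : 0 ≤ k) (hkl : k ≤ l) {F : Rn n → ℂ}
    (hF : MemLp F 2) (h : homNorm l F < ∞) : homNorm k F < ∞ := by
  have := wNorm_rad_rpow_mul_le hk hkl (v := fun _ => 1) measurable_const hF.1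
  simp only [mul_one] at this
  refine this.trans_lt (ENNReal.add_lt_top.2 ⟨?_, h⟩)
  rw [wNorm_one]
  exact hF.2

theorem wNorm_div_lt_top_of_le {n : ℕ} {k l : ℝ} (hk : 0 ≤ k) (hkl : k ≤ l) {F : Rn n → ℂ}
    (hF : MemLp F 2) (h : wNorm (fun ξ => rad ξ ^ l * (24 / (1 + rad ξ ^ 2))) F < ∞) :
    wNorm (fun ξ => rad ξ ^ k * (24 / (1 + rad ξ ^ 2))) F < ∞ := by
  have := wNorm_rad_rpow_mul_le hk hkl (v := fun ξ => 24 / (1 + rad ξ ^ 2)) (by fun_prop) hF.1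
  refine this.trans_lt (ENNReal.add_lt_top.2 ⟨?_, h⟩)
  have h2 := wNorm_rad_rpow_div_le (m := 0) (κ := 0) le_rfl le_rfl (by norm_num) F
  simp only [add_zero, Real.rpow_zero, one_mul] at h2
  rw [homNorm_zero_eq] at h2
  exact h2.trans_lt (ENNReal.mul_lt_top ENNReal.ofReal_lt_top hF.2)

/-- The regularity of the source term is determined by that of the solution at a positive time. -/
theorem wNorm_div_le_homNorm_symbolK1_mul {n : ℕ} (hn : 0 < n) (k : ℝ) (ψ : Rn n → ℂ) :
    wNorm (fun ξ => rad ξ ^ k * (24 / (1 + rad ξ ^ 2))) ψ ≤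
      ENNReal.ofReal (24 * Real.exp 1) * homNorm k (fun ξ => (symbolK1 1 ξ : ℂ) * ψ ξ) := by
  refine wNorm_le_of_ae ?_
  filter_upwards [ae_rad_ne_one hn] with ξ hξ
  have hr := rad_nonneg ξ
  rw [norm_mul, Complex.norm_real, Real.norm_of_nonneg (symbolK1_nonneg zero_le_one ξ),
    abs_of_nonneg (by positivity), abs_of_nonneg (by positivity)]
  have h1 : 24 / (1 + rad ξ ^ 2) ≤ 24 * Real.exp 1 * symbolK1 1 ξ := by
    calc 24 / (1 + rad ξ ^ 2) = 24 * Real.exp 1 * (Real.exp (-1) / (1 + rad ξ ^ 2)) := by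
          rw [Real.exp_neg]; field_simp
      _ ≤ _ := by gcongr; exact le_symbolK1_one hξ
  calc rad ξ ^ k * (24 / (1 + rad ξ ^ 2)) * ‖ψ ξ‖ ≤
        rad ξ ^ k * (24 * Real.exp 1 * symbolK1 1 ξ) * ‖ψ ξ‖ := by gcongr
    _ = _ := by ring


/-! ### The transform of the data. -/

theorem continuous_fourier_toC {n : ℕ} {g : Rn n → ℝ} (hg : MemLp g 1) :
    Continuous (𝓕 (toC g)) :=
  continuous_fourier_of_integrable (memLp_one_iff_integrable.1 hg).ofReal

theorem isL2Fourier_fourier_toC {n : ℕ} {g : Rn n → ℝ} (h1 : MemLp g 1) (h2 : MemLp g 2) :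
    IsL2Fourier (toC g) (𝓕 (toC g)) :=
  IsL2Fourier.of_integrable (memLp_one_iff_integrable.1 h1).ofReal (memLp_toC h2)

section Source

variable {n : ℕ} {u₀ u₁ : Rn n → ℝ}

theorem continuous_sourceHat (h₀ : MemLp u₀ 1) (h₁ : MemLp u₁ 1) : Continuous (sourceHat u₀ u₁) :=
  (continuous_fourier_toC h₀).add (continuous_fourier_toC h₁)

theorem memLp_sourceHat (h₀ : MemLp u₀ 1) (h₀' : MemLp u₀ 2) (h₁ : MemLp u₁ 1) (h₁' : MemLp u₁ 2) :
    MemLp (sourceHat u₀ u₁) 2 :=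
  (isL2Fourier_fourier_toC h₀ h₀').memLp_right.add (isL2Fourier_fourier_toC h₁ h₁').memLp_right

theorem eLpNorm_sourceHat_le (h₀ : MemLp u₀ 1) (h₀' : MemLp u₀ 2) (h₁ : MemLp u₁ 1)
    (h₁' : MemLp u₁ 2) :
    eLpNorm (sourceHat u₀ u₁) 2 volume ≤ eLpNorm u₀ 2 volume + eLpNorm u₁ 2 volume := by
  have e₀ := isL2Fourier_fourier_toC h₀ h₀'
  have e₁ := isL2Fourier_fourier_toC h₁ h₁'
  refine (eLpNorm_add_le e₀.memLp_right.1 e₁.memLp_right.1 (by norm_num)).trans_eq ?_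
  rw [← e₀.eLpNorm_eq, ← e₁.eLpNorm_eq, eLpNorm_toC, eLpNorm_toC]

theorem norm_sourceHat_le (h₀ : MemLp u₀ 1) (h₁ : MemLp u₁ 1) (ξ : Rn n) :
    ‖sourceHat u₀ u₁ ξ‖ ≤ (eLpNorm u₀ 1 volume + eLpNorm u₁ 1 volume).toReal := by
  have key (g : Rn n → ℝ) (hg : MemLp g 1) : ‖𝓕 (toC g) ξ‖ ≤ (eLpNorm g 1 volume).toReal := by
    refine norm_fourier_le_of_eLpNorm (memLp_one_iff_integrable.1 hg).ofReal.1
      ENNReal.toReal_nonneg ?_ ξ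
    rw [ENNReal.ofReal_toReal hg.2.ne]
    exact (eLpNorm_toC g 1).le
  rw [ENNReal.toReal_add h₀.2.ne h₁.2.ne]
  exact (norm_add_le _ _).trans (add_le_add (key _ h₀) (key _ h₁))

theorem sourceHat_zero (h₀ : MemLp u₀ 1) (h₁ : MemLp u₁ 1) :
    sourceHat u₀ u₁ 0 = ((∫ y, (u₀ y + u₁ y) : ℝ) : ℂ) := by
  rw [sourceHat, fourier_zero_eq_integral, fourier_zero_eq_integral,
    integral_add (memLp_one_iff_integrable.1 h₀) (memLp_one_iff_integrable.1 h₁),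
    Complex.ofReal_add]
  exact congrArg₂ (· + ·) integral_complex_ofReal integral_complex_ofReal

end Source

/-! ### Solutions with fewer than three derivatives. -/

/-- Decay of the nonlinear term in a norm from which `k` derivatives of the Duhamel term can be
controlled. -/
theorem IsH1Curve.exists_nonlinHat_bounds {n : ℕ} (hn : 0 < n) (hn2 : n ≤ 2) {p : ℝ} (hp : 2 < p)
    (hα : 1 < n * (p - 1) / 2) {f : ℝ → ℝ} (hf : IsPowerNonlinearity p f)
    {U F : ℝ → Rn n → ℂ} (hU : IsH1Curve U F) {φ ψ : Rn n → ℂ} (hφ : MemLp φ 2)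
    (hψ : MemLp ψ 2) {D : ℝ} (hψD : ∀ ξ, ‖ψ ξ‖ ≤ D)
    (hF : ∀ t, 0 ≤ t → F t =ᵐ[volume] mild φ ψ (nonlinHat f U) t) {ρ : ℝ} (hρ : 0 ≤ ρ)
    (hE : ∀ t, 0 ≤ t → energy (1 + t) (F t) ≤ ENNReal.ofReal (ρ * (1 + t) ^ (-((n : ℝ) / 4))))
    {k : ℝ} (hk0 : 0 ≤ k) (hk3 : k < 3) (hφk : homNorm k φ < ∞) :
    ∃ m κ A : ℝ, k = m + κ ∧ 0 ≤ m ∧ 0 ≤ κ ∧ κ < 2 ∧ 0 ≤ A ∧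
      (∀ τ, 0 ≤ τ → ∀ ξ, ‖nonlinHat f U τ ξ‖ ≤ A * (1 + τ) ^ (-(n * (p - 1) / 2))) ∧
      (∀ τ, 0 ≤ τ → homNorm m (nonlinHat f U τ) ≤
        ENNReal.ofReal (A * (1 + τ) ^ (-(n * (p - 1) / 2 + n / 4 + m / 2)))) := by
  obtain ⟨C, hC, h⟩ := exists_nonlinHat_le hn hn2 hp hf
  obtain ⟨hb, hb2⟩ := h U F hU ρ hρ hE
  set A := C * ρ ^ (p - 1) * ρ with hA
  have hA0 : 0 ≤ A := by positivity
  -- Below order two, K₁ alone supplies the derivatives (m = 0). From order two on, one derivative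
  -- goes to f(u), leaving κ = k - 1 < 2. The sup bound needed for this rests on the decay of 3/2
  -- derivatives, an order below two.
  rcases lt_or_ge k 2 with hk | hk
  · refine ⟨0, k, A, by ring, le_rfl, hk0, hk, hA0, hb, fun τ hτ => ?_⟩
    rw [homNorm_zero_eq, zero_div, add_zero]
    exact hb2 τ hτ
  · have h3 := homNorm_lt_top_of_le (k := 3 / 2) (by norm_num) (by linarith) hφ hφk
    have hh := hU.continuous_nonlinHat hn hn2 hp hf
    obtain ⟨B, hB, hB3⟩ := exists_homNorm_mild_le hα (by norm_num) (by norm_num) hφ.1 hψ.1 h3 hψD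
      hψ.2 hh hA0 hb hb2
    obtain ⟨A', hA', h1⟩ := hU.exists_homNorm_one_nonlinHat_le hn hn2 hp hf hρ (B := B) hE
      fun t ht => (wNorm_congr (w := fun ξ => rad ξ ^ (3 / 2 : ℝ)) (hF t ht)).trans_le (hB3 t ht)
    refine ⟨1, k - 1, max A A', by ring, zero_le_one, by linarith, by linarith,
      le_max_of_le_left hA0, fun τ hτ ξ => (hb τ hτ ξ).trans ?_, fun τ hτ => (h1 τ hτ).trans
        (ENNReal.ofReal_le_ofReal ?_)⟩
    · gcongr
      exact le_max_left _ _
    · gcongr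
      exact le_max_right _ _

/-- The solution with small data in `H^k` is a global solution in the sense of `H^k`. -/
theorem IsH1Curve.homNorm_regular {n : ℕ} (hn : 0 < n) (hn2 : n ≤ 2) {p : ℝ} (hp : 2 < p)
    (hα : 1 < n * (p - 1) / 2) {f : ℝ → ℝ} (hf : IsPowerNonlinearity p f)
    {U F : ℝ → Rn n → ℂ} (hU : IsH1Curve U F) {φ ψ : Rn n → ℂ} (hφ : MemLp φ 2)
    (hψ : MemLp ψ 2) {D : ℝ} (hψD : ∀ ξ, ‖ψ ξ‖ ≤ D)
    (hF : ∀ t, 0 ≤ t → F t =ᵐ[volume] mild φ ψ (nonlinHat f U) t) {ρ : ℝ} (hρ : 0 ≤ ρ)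
    (hE : ∀ t, 0 ≤ t → energy (1 + t) (F t) ≤ ENNReal.ofReal (ρ * (1 + t) ^ (-((n : ℝ) / 4))))
    {k : ℝ} (hk0 : 0 ≤ k) (hk3 : k < 3) (hφk : homNorm k φ < ∞)
    (hψk : wNorm (fun ξ => rad ξ ^ k * (24 / (1 + rad ξ ^ 2))) ψ < ∞) {t : ℝ} (ht : 0 ≤ t) :
    homNorm k (F t) < ∞ ∧
      Tendsto (fun s => homNorm k (fun ξ => F s ξ - F t ξ)) (𝓝[Ici 0] t) (𝓝 0) := by
  obtain ⟨m, κ, A, hk, hm, h0, h2, hA, -, hb2⟩ :=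
    hU.exists_nonlinHat_bounds hn hn2 hp hα hf hφ hψ hψD hF hρ hE hk0 hk3 hφk
  obtain ⟨r1, r2⟩ := homNorm_mild_regular hφ.1 hψ.1 (hU.continuous_nonlinHat hn hn2 hp hf) hφk hψk
    (fun T _ => ⟨24 * A, fun τ hτ => by
      rw [hk, ENNReal.ofReal_mul (by norm_num)]
      refine (wNorm_rad_rpow_div_le hm h0 h2.le _).trans (mul_le_mul_right ((hb2 τ hτ.1.le).trans
        (ENNReal.ofReal_le_ofReal (mul_le_of_le_one_right hA ?_))) _)
      refine Real.rpow_le_one_of_one_le_of_nonpos (by linarith [hτ.1]) ?_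
      have : (0 : ℝ) ≤ n / 4 := by positivity
      linarith⟩) ht
  refine ⟨(wNorm_congr (w := fun ξ => rad ξ ^ k) (hF t ht)).trans_lt r1, r2.congr' ?_⟩
  filter_upwards [self_mem_nhdsWithin] with s hs
  exact wNorm_congr (w := fun ξ => rad ξ ^ k) (((hF s hs).sub (hF t ht)).symm)

/-- Regularity of the source term, deduced from that of the solution. -/
theorem IsH1Curve.wNorm_source_lt_top {n : ℕ} (hn : 0 < n) (hn2 : n ≤ 2) {p : ℝ} (hp : 2 < p)
    (hα : 1 < n * (p - 1) / 2) {f : ℝ → ℝ} (hf : IsPowerNonlinearity p f)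
    {U F : ℝ → Rn n → ℂ} (hU : IsH1Curve U F) {φ ψ : Rn n → ℂ} (hφ : MemLp φ 2)
    (hψ : MemLp ψ 2) {D : ℝ} (hψD : ∀ ξ, ‖ψ ξ‖ ≤ D)
    (hF : ∀ t, 0 ≤ t → F t =ᵐ[volume] mild φ ψ (nonlinHat f U) t) {ρ : ℝ} (hρ : 0 ≤ ρ)
    (hE : ∀ t, 0 ≤ t → energy (1 + t) (F t) ≤ ENNReal.ofReal (ρ * (1 + t) ^ (-((n : ℝ) / 4))))
    {k : ℝ} (hk0 : 0 ≤ k) (hk3 : k < 3) (hφk : homNorm k φ < ∞) (hFk : homNorm k (F 1) < ∞) :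
    wNorm (fun ξ => rad ξ ^ k * (24 / (1 + rad ξ ^ 2))) ψ < ∞ := by
  obtain ⟨m, κ, A, hk, hm, h0, h2, hA, hb, hb2⟩ :=
    hU.exists_nonlinHat_bounds hn hn2 hp hα hf hφ hψ hψD hF hρ hE hk0 hk3 hφk
  have hh := hU.continuous_nonlinHat hn hn2 hp hf
  obtain ⟨C, -, hC⟩ := exists_homNorm_duhamel_le (n := n) hα hm h0 h2
  have hd : homNorm k (duhamel (nonlinHat f U) 1) < ∞ := by
    rw [hk]
    exact (hC _ hh A hA hb hb2 1 zero_le_one).trans_lt ENNReal.ofReal_lt_top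
  have hdm : AEStronglyMeasurable (duhamel (nonlinHat f U) 1) volume :=
    (stronglyMeasurable_integral_symbolK1_mul hh 1 0 1).aestronglyMeasurable
  have hφe : homNorm k (fun ξ => (Real.exp (-1) : ℂ) * φ ξ) < ∞ := by
    refine lt_of_le_of_lt (wNorm_le_of_ae (w' := fun ξ => rad ξ ^ k) (G := φ) (c := Real.exp (-1))
      (Eventually.of_forall fun ξ => ?_)) (ENNReal.mul_lt_top ENNReal.ofReal_lt_top hφk)
    rw [norm_mul, Complex.norm_real, Real.norm_of_nonneg (Real.exp_pos _).le]
    exact le_of_eq (by ring)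
  have hm1 : AEStronglyMeasurable (fun ξ => (Real.exp (-1) : ℂ) * φ ξ) volume :=
    aestronglyMeasurable_const.mul hφ.1
  have hFm := (hU.isL2Fourier 1 zero_le_one).memLp_right.1
  refine (wNorm_div_le_homNorm_symbolK1_mul hn k ψ).trans_lt
    (ENNReal.mul_lt_top ENNReal.ofReal_lt_top ?_)
  -- The equation at time 1, solved for the source term.
  have e : (fun ξ => (symbolK1 1 ξ : ℂ) * ψ ξ) =ᵐ[volume]
      fun ξ => (F 1 ξ - (Real.exp (-1) : ℂ) * φ ξ) - duhamel (nonlinHat f U) 1 ξ := by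
    filter_upwards [hF 1 zero_le_one] with ξ hξ
    rw [hξ, mild]
    ring
  rw [homNorm_eq_wNorm, wNorm_congr e]
  refine (wNorm_sub_le (measurable_rad_rpow k) (hFm.sub hm1) hdm).trans_lt
    (ENNReal.add_lt_top.2 ⟨?_, hd⟩)
  exact (wNorm_sub_le (measurable_rad_rpow k) hFm hm1).trans_lt (ENNReal.add_lt_top.2 ⟨hFk, hφe⟩)

/-- The nonlinear term is integrable in space-time along a decaying curve. -/
theorem IsH1Curve.integrableOn_integral_norm_nonlin {n : ℕ} (hn : 0 < n) (hn2 : n ≤ 2) {p : ℝ}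
    (hp : 2 < p) (hα : 1 < n * (p - 1) / 2) {f : ℝ → ℝ} (hf : IsPowerNonlinearity p f)
    {U F : ℝ → Rn n → ℂ} (hU : IsH1Curve U F) {ρ : ℝ} (hρ : 0 ≤ ρ)
    (hE : ∀ t, 0 ≤ t → energy (1 + t) (F t) ≤ ENNReal.ofReal (ρ * (1 + t) ^ (-((n : ℝ) / 4)))) :
    IntegrableOn (fun t => ∫ x, ‖nonlin f (U t) x‖) (Ioi 0) := by
  obtain ⟨C, hC, h⟩ := exists_nonlin_le hn hn2 hp hf
  have h1 := integrableOn_add_rpow_Ioi_of_lt (a := -(n * (p - 1) / 2)) (c := 0) (m := 1)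
    (by linarith) (by norm_num)
  simp_rw [add_comm _ (1 : ℝ)] at h1
  have h2 : IntegrableOn (fun t => ∫ x, ‖nonlin f (U (max t 0)) x‖) (Ioi 0) := by
    refine (h1.const_mul (C * ρ ^ p)).mono'
      (hU.continuous_integral_norm_nonlin hn hn2 hp hf).aestronglyMeasurable
      ((ae_restrict_mem measurableSet_Ioi).mono fun t ht => ?_)
    have ht : 0 < t := ht
    have hT : 0 < 1 + t := by linarith
    have hi := hU.integrable_nonlin hn hn2 hp hf t
    rw [Real.norm_of_nonneg (integral_nonneg fun _ => norm_nonneg _),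
      integral_norm_eq_lintegral_enorm hi.1, ← eLpNorm_one_eq_lintegral_enorm, max_eq_left ht.le]
    refine ENNReal.toReal_le_of_le_ofReal (by positivity) ?_
    refine (h (U t) (F t) (hU.isL2Fourier t ht.le) (1 + t) _ hT (by positivity) (hE t ht.le)).1.trans
      (ENNReal.ofReal_le_ofReal (le_of_eq ?_))
    rw [Real.mul_rpow hρ (by positivity), ← Real.rpow_mul hT.le,
      show -((n : ℝ) * (p - 1) / 2) = -(n * (p - 2) / 4) + -((n : ℝ) / 4) * p by ring,
      Real.rpow_add hT]
    ring
  refine h2.congr_fun (fun t ht => ?_) measurableSet_Ioi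
  have ht : 0 < t := ht
  simp only [max_eq_left ht.le]


/-! ### The theorem. -/

theorem theorem1p2 (n : ℕ) (p k₀ : ℝ) (f : ℝ → ℝ)
    (hn : (n = 1 ∧ k₀ = 1) ∨ (n = 2 ∧ ∃ ε : ℝ, 0 ≤ ε ∧ ε < 2 ∧ k₀ = 1 + ε))
    (hp : 1 + 2 / (n : ℝ) < p) (hf : IsPowerNonlinearity p f) :
    ∃ δ : ℝ, 0 < δ ∧ ∀ u₀ u₁ : Rn n → ℝ,
      MemLp u₀ 1 → MemSobolevH k₀ u₀ → MemLp u₁ 1 → MemLp u₁ 2 →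
      eLpNorm u₀ 1 volume + sobolevNorm k₀ u₀ + eLpNorm u₁ 1 volume + eLpNorm u₁ 2 volume
        ≤ ENNReal.ofReal δ →
      -- existence
      ((k₀ ≤ 2 ∨ MemSobolevH (k₀ - 2) u₁) →
        ∃ u : ℝ → Rn n → ℝ, IsGlobalSolution f k₀ u₀ u₁ u) ∧
      -- uniqueness
      (∀ u v : ℝ → Rn n → ℝ, IsGlobalSolution f k₀ u₀ u₁ u → IsGlobalSolution f k₀ u₀ u₁ v →
        ∀ t : ℝ, 0 ≤ t → u t =ᵐ[volume] v t) ∧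
      -- the mass of the nonlinear term is finite, and the solution has the asymptotic profile
      (∀ u : ℝ → Rn n → ℝ, IsGlobalSolution f k₀ u₀ u₁ u →
        (∀ s : ℝ, 0 ≤ s → Integrable (fun y => f (u s y))) ∧
        IntegrableOn (fun s => ∫ y, |f (u s y)|) (Ioi 0) ∧
        IntegrableOn (fun s => ∫ y, f (u s y)) (Ioi 0) ∧
        ∀ M : ℝ, M = (∫ y, (u₀ y + u₁ y)) + (∫ s in Ioi (0 : ℝ), ∫ y, f (u s y)) →
          ∀ k : ℝ, 0 ≤ k → k ≤ k₀ →
            Tendsto (fun t : ℝ => ENNReal.ofReal (t ^ ((n : ℝ) / 4 + k / 2)) *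
              gradNorm k (fun x => u t x - M * gaussKernel t x)) atTop (𝓝 0)) := by
  have hn0 : 0 < n := by rcases hn with h | h <;> omega
  have hn2 : n ≤ 2 := by rcases hn with h | h <;> omega
  have hk1 : 1 ≤ k₀ := by
    rcases hn with ⟨-, h⟩ | ⟨-, ε, h1, -, h⟩ <;> linarith
  have hk3 : k₀ < 3 := by
    rcases hn with ⟨-, h⟩ | ⟨-, ε, -, h1, h⟩ <;> linarith
  have hnr : (0 : ℝ) < n := by exact_mod_cast hn0
  have hn2r : (n : ℝ) ≤ 2 := by exact_mod_cast hn2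
  -- The supercriticality of p is exactly the integrability in time of the rate of f(u) in L¹.
  have hα : 1 < n * (p - 1) / 2 := by
    have : 2 / (n : ℝ) < p - 1 := by linarith
    rw [div_lt_iff₀ hnr] at this
    linarith
  have hp2 : 2 < p := by
    have : 1 ≤ 2 / (n : ℝ) := by rw [le_div_iff₀ hnr]; linarith
    linarith
  obtain ⟨δ, ρ, hδ, hρ, hex⟩ := exists_mild_solution hn0 hn2 hp2 hα hf
  -- The division by 3 absorbs the constant in `energy_one_le_sobolevNorm`.
  refine ⟨δ / 3, by positivity, fun u₀ u₁ h01 h0k h11 h12 hsmall => ?_⟩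
  have h02 := h0k.1
  set φ := 𝓕 (toC u₀) with hφdef
  set ψ := sourceHat u₀ u₁ with hψdef
  have hL0 : IsL2Fourier (toC u₀) φ := isL2Fourier_fourier_toC h01 h02
  have hφ : MemLp φ 2 := hL0.memLp_right
  have hψ : MemLp ψ 2 := memLp_sourceHat h01 h02 h11 h12
  have hψc : Continuous ψ := continuous_sourceHat h01 h11
  have hφk : homNorm k₀ φ < ∞ := (gradNorm_eq_homNorm hL0 k₀).symm.trans_lt h0k.2
  have hδ3 : ENNReal.ofReal (δ / 3) ≤ ENNReal.ofReal δ := ENNReal.ofReal_le_ofReal (by linarith)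
  have hφδ : energy 1 φ ≤ ENNReal.ofReal δ := by
    have h1 : sobolevNorm k₀ u₀ ≤ ENNReal.ofReal (δ / 3) :=
      (le_add_self.trans (le_self_add.trans le_self_add)).trans hsmall
    calc energy 1 φ ≤ 3 * sobolevNorm k₀ u₀ := energy_one_le_sobolevNorm hk1 hL0
      _ ≤ 3 * ENNReal.ofReal (δ / 3) := by gcongr
      _ = ENNReal.ofReal δ := by
        rw [← ENNReal.ofReal_ofNat, ← ENNReal.ofReal_mul (by norm_num)]
        congr 1
        ring
  have hψδ : ∀ ξ, ‖ψ ξ‖ ≤ δ := fun ξ => by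
    refine (norm_sourceHat_le h01 h11 ξ).trans (ENNReal.toReal_le_of_le_ofReal hδ.le ?_)
    refine le_trans ?_ (hsmall.trans hδ3)
    exact (add_le_add le_self_add le_rfl).trans le_self_add
  have hψ2 : eLpNorm ψ 2 volume ≤ ENNReal.ofReal δ := by
    refine (eLpNorm_sourceHat_le h01 h02 h11 h12).trans (le_trans ?_ (hsmall.trans hδ3))
    refine add_le_add ?_ le_rfl
    exact (eLpNorm_le_sobolevNorm k₀ u₀).trans (le_add_self.trans le_self_add)
  obtain ⟨U, F, hU, hF, hE⟩ := hex φ ψ hφ.1 hψ.1 hφδ hψδ hψ2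
  refine ⟨fun hreg => ?_, fun u v hu hv t ht => ?_, fun u hu => ?_⟩
  -- For k₀ ≤ 2 the gain from K₁ makes square integrability of ψ sufficient. Beyond that, k₀ - 2
  -- derivatives of u₁ are needed, while u₀ has more than enough.
  · have hψk : wNorm (fun ξ => rad ξ ^ k₀ * (24 / (1 + rad ξ ^ 2))) ψ < ∞ := by
      rcases le_or_gt k₀ 2 with hk2 | hk2
      · have h1 := wNorm_rad_rpow_div_le (m := 0) (κ := k₀) le_rfl (by linarith) hk2 ψ
        rw [zero_add, homNorm_zero_eq] at h1
        exact h1.trans_lt (ENNReal.mul_lt_top ENNReal.ofReal_lt_top hψ.2)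
      · have h1 := wNorm_rad_rpow_div_le (m := k₀ - 2) (κ := 2) (by linarith) (by norm_num) le_rfl ψ
        rw [sub_add_cancel] at h1
        refine h1.trans_lt (ENNReal.mul_lt_top ENNReal.ofReal_lt_top ?_)
        have hL1 := isL2Fourier_fourier_toC h11 h12
        refine (homNorm_add_le _ hφ.1 hL1.memLp_right.1).trans_lt (ENNReal.add_lt_top.2
          ⟨homNorm_lt_top_of_le (by linarith) (by linarith) hφ hφk, ?_⟩)
        rw [← gradNorm_eq_homNorm hL1]
        exact (hreg.resolve_left (not_le.2 hk2)).2
    have hr := fun t ht => hU.homNorm_regular hn0 hn2 hp2 hα hf hφ hψ hψδ hF hρ.le hE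
      (by linarith) hk3 hφk hψk (t := t) ht
    exact hU.exists_isGlobalSolution hn0 hF (fun t ht => (hr t ht).1) fun t ht => (hr t ht).2
  · obtain ⟨Fu, hUu, hFu⟩ := hu.exists_isH1Curve hn0 hk1
    obtain ⟨Fv, hUv, hFv⟩ := hv.exists_isH1Curve hn0 hk1
    have h1 := hUu.ae_eq_of_mild hn0 hn2 hp2 hf hUv hFu hFv ht
    filter_upwards [((hUu.isL2Fourier t ht).congr EventuallyEq.rfl h1.symm).ae_eq_left
      (hUv.isL2Fourier t ht)] with x hx
    exact Complex.ofReal_injective hx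
  · obtain ⟨G, hV, hG⟩ := hu.exists_isH1Curve hn0 hk1
    -- Uniqueness identifies the given solution with the constructed one, whose decay it inherits.
    have hGE : ∀ t, 0 ≤ t →
        energy (1 + t) (G t) ≤ ENNReal.ofReal (ρ * (1 + t) ^ (-((n : ℝ) / 4))) := fun t ht =>
      (wNorm_congr (hV.ae_eq_of_mild hn0 hn2 hp2 hf hU hG hF ht)).trans_le (hE t ht)
    have hcont := hV.continuous_nonlinHat hn0 hn2 hp2 hf
    have hint : ∀ s : ℝ, 0 ≤ s → Integrable fun y => f (u s y) := fun s hs => by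
      have := (hV.integrable_nonlin hn0 hn2 hp2 hf s).re
      rw [max_eq_left hs] at this
      exact this
    have hzero : ∀ s ∈ Ioi (0 : ℝ), nonlinHat f (fun t => toC (u t)) s 0 =
        ((∫ y, f (u s y) : ℝ) : ℂ) := fun s hs => by
      rw [nonlinHat, fourier_zero_eq_integral, max_eq_left (le_of_lt hs)]
      exact integral_complex_ofReal
    have hcompl : ∀ k : ℝ, 0 ≤ k → k ≤ k₀ → _ := fun k hk0 hkk =>
      hV.exists_nonlinHat_bounds hn0 hn2 hp2 hα hf hφ hψ hψδ hG hρ.le hGE hk0 (by linarith)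
        (homNorm_lt_top_of_le hk0 hkk hφ hφk)
    have hint0 : IntegrableOn (fun s => ((∫ y, f (u s y) : ℝ) : ℂ)) (Ioi 0) := by
      obtain ⟨-, -, A, -, -, -, -, -, hb, -⟩ := hcompl 0 le_rfl (by linarith)
      exact (integrableOn_apply_zero hα hcont hb).congr_fun hzero measurableSet_Ioi
    refine ⟨hint, ?_, hint0.re, fun M hM k hk0 hkk => ?_⟩
    · refine (hV.integrableOn_integral_norm_nonlin hn0 hn2 hp2 hα hf hρ.le hGE).congr_fun
        (fun s _ => integral_congr_ae (Eventually.of_forall fun y => ?_)) measurableSet_Ioi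
      exact (Complex.norm_real _).trans (Real.norm_eq_abs _)
    · obtain ⟨m, κ, A, hk, hm, h0, h2, hA, hb, hb2⟩ := hcompl k hk0 hkk
      have hG1 : homNorm k₀ (G 1) < ∞ :=
        (gradNorm_eq_homNorm (hV.isL2Fourier 1 zero_le_one) k₀).symm.trans_lt
          (hu.mem 1 zero_le_one).2
      -- No regularity of u₁ beyond L² is available here; that of ψ is deduced from u(1) ∈ H^{k₀}.
      have hψk := wNorm_div_lt_top_of_le hk0 hkk hψ (hV.wNorm_source_lt_top hn0 hn2 hp2 hα hf hφ hψ
        hψδ hG hρ.le hGE (by linarith) hk3 hφk hG1)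
      have hφk' := homNorm_lt_top_of_le hk0 hkk hφ hφk
      -- Values of transforms at zero frequency are integrals, so M is the coefficient of the heat
      -- kernel in the profile.
      have hMc : (M : ℂ) = ψ 0 + ∫ s in Ioi (0 : ℝ), nonlinHat f (fun t => toC (u t)) s 0 := by
        rw [setIntegral_congr_fun measurableSet_Ioi hzero, hψdef, sourceHat_zero h01 h11, hM,
          Complex.ofReal_add]
        exact congrArg₂ (· + ·) rfl integral_complex_ofReal.symm
      subst hk
      refine (tendsto_homNorm_mild_sub hα hm h0 h2 hφ.1 hψc hφk' hψδ hψk hcont hA hb hb2).congr' ?_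
      filter_upwards [eventually_gt_atTop 0] with t ht
      congr 1
      have hgauss : IsL2Fourier (toC fun x => u t x - M * gaussKernel t x)
          (fun ξ => G t ξ - (Real.exp (-(t * rad ξ ^ 2)) : ℂ) * (M : ℂ)) := by
        have h1 : IsL2Fourier (toC fun x => M * gaussKernel (n := n) t x)
            (fun ξ => (Real.exp (-(t * rad ξ ^ 2)) : ℂ) * (M : ℂ)) := by
          refine ((isL2Fourier_gaussKernel ht).const_mul (M : ℂ)).congr
            (Eventually.of_forall fun x => ?_) (Eventually.of_forall fun ξ => mul_comm _ _)
          simp [toC]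
        refine ((hV.isL2Fourier t ht.le).sub h1).congr (Eventually.of_forall fun x => ?_)
          EventuallyEq.rfl
        simp [toC]
      rw [gradNorm_eq_homNorm hgauss, ← hMc]
      refine wNorm_congr (w := fun ξ => rad ξ ^ (m + κ)) ?_
      filter_upwards [hG t ht.le] with ξ hξ
      rw [hξ]
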